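/- Let $X$ be a smooth manifold (Hausdorff, second countable), let $Y\subset X$ be a closed embedded submanifold (without boundary) of dimension $m$ and codimension $\mathfrak c$, let $1\le \mathfrak c_1\le \mathfrak c-1$, and set $\mathfrak c_2=\mathfrak c-\mathfrak c_1$. Let $\mathcal N=TX|_Y/TY\to Y$ be the normal bundle and let $\mathcal N^{\mathfrak c_1}\subset\mathcal N$ be a smooth subbundle of corank $\mathfrak c_1$. *Augmented atlases.* A chart for $Y$ in $X$ is a coordinate chart $\varphi=(\varphi_1,\dots,\varphi_{\mathfrak c+m}):U\to\mathbb R^{\mathfrak c}\times\mathbb R^m$ of $X$ with $U\cap Y=\{x\in U:\varphi_1(x)=\dots=\varphi_{\mathfrak c}(x)=0\}$. A $\mathfrak c_1$-augmented atlas for $Y$ in $X$ is a collection $\{\varphi_\alpha:U_\alpha\to\mathbb R^{\mathfrak c}\times\mathbb R^m\}_{\alpha\in\mathcal I}$ of charts for $Y$ in $X$ whose domains cover $Y$ such that for all $\alpha,\alpha'\in\mathcal I$ there are smooth maps $h_{\alpha\alpha'}:\varphi_{\alpha'}(U_\alpha\cap U_{\alpha'})\to\mathrm{End}(\mathbb R^{\mathfrak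 c})$ and $f_{\alpha\alpha'}:\varphi_{\alpha'}(U_\alpha\cap U_{\alpha'})\to\mathbb R^+$ such that, for all $(r,s)\in\varphi_{\alpha'}(U_\alpha\cap U_{\alpha'})\subset\mathbb R^{\mathfrak c}\times\mathbb R^m$, the first $\mathfrak c$ components of $\varphi_\alpha(\varphi_{\alpha'}^{-1}(r,s))$ form the vector $h_{\alpha\alpha'}(r,s)r$, the endomorphism $h_{\alpha\alpha'}(r,s)$ maps $0^{\mathfrak c_1}\times\mathbb R^{\mathfrak c_2}$ into itself, and $|h_{\alpha\alpha'}(r,s)(0,t)|^2=f_{\alpha\alpha'}(r,s)|t|^2$ for all $t\in\mathbb R^{\mathfrak c_2}$. It is $\mathcal N^{\mathfrak c_1}$-augmented if, for every $\alpha$ and $y\in U_\alpha\cap Y$, the fibre $\mathcal N^{\mathfrak c_1}_y$ is the image of $0^{\mathfrak c_1}\times\mathbb R^{\mathfrak c_2}$ under the isomorphism $\mathbb R^{\mathfrak c}\to\mathcal N_y$, $r\mapsto\sum_{j\le\mathfrak c} r_j\,\partial/\partial\varphi_{\alpha;j}|_y+T_yY$. Two $\mathfrak c_1$-augmented atlases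 are $\mathfrak c_1$-augmented equivalent if their union is a $\mathfrak c_1$-augmented atlas. *Cutting out.* A tubular neighborhood identification for $Y\subset X$ is a pair $(W_Y,\Psi_Y)$ of an open neighborhood $W_Y$ of the zero section $Y\subset\mathcal N$ and a diffeomorphism $\Psi_Y$ of $W_Y$ onto an open subset of $X$ which restricts to the identity on $Y$ and is such that the composition $T\mathcal N|_Y\xrightarrow{d\Psi_Y}TX|_Y\to\mathcal N$ restricts to the identity on the vertical tangent bundle $\mathcal N\subset T\mathcal N|_Y$. Given $(W_Y,\Psi_Y)$ and a smooth inner product $\langle\cdot,\cdot\rangle$ on $\mathcal N^{\mathfrak c_1}$, a chart cut out from these data is a chart $\Phi\circ\Psi_Y^{-1}:\Psi_Y(W_Y|_{U})\to\mathbb R^{\mathfrak c}\times\mathbb R^m$, where $U\subset Y$ is open and $\Phi:\mathcal N|_U\to\mathbb R^{\mathfrak c}\times\mathbb R^m$ is a diffeomorphism onto an open set whose first component is a linear isomorphism on each fibre, whose second component factors through the projection to $U$, and whose first component maps $\mathcal N^{\mathfrak c_1}|_U$ into $0^{\mathfrak c_1}\times\mathbb R^{\mathfrak c_2}$ so that the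 squared Euclidean length of the image of $w$ is $\langle w,w\rangle$. An atlas cut out from $(W_Y,\Psi_Y)$ and $\langle\cdot,\cdot\rangle$ is a collection of charts cut out from these data whose domains cover $Y$. **Proposition.** Let $\{\varphi_\alpha:U_\alpha\to\mathbb R^{\mathfrak c}\times\mathbb R^m\}_{\alpha\in\mathcal I}$ be an $\mathcal N^{\mathfrak c_1}$-augmented atlas for $Y$ in $X$. There exist a smooth inner product $\langle\cdot,\cdot\rangle$ on $\mathcal N^{\mathfrak c_1}$, a tubular neighborhood identification $(W_Y,\Psi_Y)$ for $Y\subset X$, and open neighborhoods $U_\alpha'\subset X$ of $U_\alpha\cap Y$, $\alpha\in\mathcal I$, such that the atlas $\{\varphi_\alpha|_{U_\alpha\cap U_\alpha'}\}_{\alpha\in\mathcal I}$ is $\mathfrak c_1$-augmented equivalent to $\{\varphi_\alpha\}_{\alpha\in\mathcal I}$ and every atlas cut out from $(W_Y,\Psi_Y)$ and $\langle\cdot,\cdot\rangle$ is a $\mathfrak c_1$-augmented atlas that is $\mathfrak c_1$-augmented equivalent to $\{\varphi_\alpha|_{U_\alpha\cap U_\alpha'}\}_{\alpha\in\mathcal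 I}$. -/

import Mathlib

open Set Manifold Bundle Topology
open scoped ContDiff

noncomputable section

namespace AugAtlas

set_option linter.unusedSectionVars false

/-- Euclidean space `ℝᵏ`. -/
abbrev Euc (k : ℕ) : Type := EuclideanSpace ℝ (Fin k)

section Submanifold

variable (c m : ℕ) {X Y : Type*}
  [TopologicalSpace X] [ChartedSpace (Euc (c + m)) X]
  [TopologicalSpace Y] [ChartedSpace (Euc m) Y]

/-- The smooth `m`-manifold `Y`, included by `ι`, is a closed (embedded) submanifold of
codimension `c` of the smooth `(c + m)`-manifold `X`. -/
class IsClosedSubmanifold (ι : Y → X) : Prop where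
  isSmoothEmbedding : IsSmoothEmbedding (𝓡 m) (𝓡 (c + m)) ∞ ι
  isClosed_range : IsClosed (range ι)

/-- The tangent space `T_yY`, as a subspace of `T_yX`. -/
def tangentSubspace (ι : Y → X) (y : Y) : Submodule ℝ (TangentSpace (𝓡 (c + m)) (ι y)) :=
  LinearMap.range (mfderiv (𝓡 m) (𝓡 (c + m)) ι y).toLinearMap

/-- The fibre `T_yX / T_yY` of the normal bundle of `Y` in `X`. -/
def NormalFiber (ι : Y → X) (y : Y) : Type :=
  TangentSpace (𝓡 (c + m)) (ι y) ⧸ tangentSubspace c m ι y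

variable (ι : Y → X)

instance (y : Y) : AddCommGroup (NormalFiber c m ι y) :=
  inferInstanceAs (AddCommGroup (_ ⧸ tangentSubspace c m ι y))
instance (y : Y) : Module ℝ (NormalFiber c m ι y) :=
  inferInstanceAs (Module ℝ (_ ⧸ tangentSubspace c m ι y))
instance (y : Y) : TopologicalSpace (NormalFiber c m ι y) :=
  inferInstanceAs (TopologicalSpace (_ ⧸ tangentSubspace c m ι y))

/-- The quotient projection `T_yX → T_yX / T_yY`. -/
def normalProj (y : Y) : TangentSpace (𝓡 (c + m)) (ι y) →L[ℝ] NormalFiber c m ι y :=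
  (tangentSubspace c m ι y).mkQL

/-- A coordinate chart for `Y` in `X`: a chart `φ : U → ℝᶜ × ℝᵐ` of `X` such that `U ∩ Y` is the
zero set of the first `c` coordinates. -/
structure IsChartFor (φ : OpenPartialHomeomorph X (Euc c × Euc m)) : Prop where
  contMDiffOn : ContMDiffOn (𝓡 (c + m)) 𝓘(ℝ, Euc c × Euc m) ∞ φ φ.source
  contMDiffOn_symm : ContMDiffOn 𝓘(ℝ, Euc c × Euc m) (𝓡 (c + m)) ∞ φ.symm φ.target
  mem_iff : ∀ x ∈ φ.source, x ∈ range ι ↔ (φ x).1 = 0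

/-- The isomorphism `ℝᶜ → T_yX / T_yY`, `r ↦ ∑ rⱼ ∂/∂φⱼ + T_yY`, induced by a chart `φ` for `Y` in
`X` whose domain contains `y`. -/
def chartFrame (φ : OpenPartialHomeomorph X (Euc c × Euc m)) (y : Y) :
    Euc c →L[ℝ] NormalFiber c m ι y :=
  (normalProj c m ι y).comp
    ((mfderiv 𝓘(ℝ, Euc c × Euc m) (𝓡 (c + m)) φ.symm (φ (ι y)) :
      Euc c × Euc m →L[ℝ] TangentSpace (𝓡 (c + m)) (ι y)).comp
        (ContinuousLinearMap.inl ℝ (Euc c) (Euc m)))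

variable {c m ι}

/-! ### The normal bundle as a smooth vector bundle -/

lemma IsChartFor.mdifferentiable {φ : OpenPartialHomeomorph X (Euc c × Euc m)}
    (hφ : IsChartFor c m ι φ) : φ.MDifferentiable (𝓡 (c + m)) 𝓘(ℝ, Euc c × Euc m) :=
  ⟨hφ.contMDiffOn.mdifferentiableOn (by simp), hφ.contMDiffOn_symm.mdifferentiableOn (by simp)⟩

lemma IsClosedSubmanifold.mdifferentiable [IsClosedSubmanifold c m ι] :
    MDifferentiable (𝓡 m) (𝓡 (c + m)) ι :=
  (IsClosedSubmanifold.isSmoothEmbedding (c := c) (m := m) (ι := ι)).contMDiff.mdifferentiable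
    (by simp)

lemma mfderiv_injective [IsManifold (𝓡 m) ∞ Y] [IsManifold (𝓡 (c + m)) ∞ X]
    [hι : IsClosedSubmanifold c m ι] (y : Y) :
    Function.Injective (mfderiv (𝓡 m) (𝓡 (c + m)) ι y) := by
  have h := hι.isSmoothEmbedding.isImmersion.isImmersionAt y
  have hδ : h.domChart.MDifferentiable (𝓡 m) (𝓡 m) :=
    ⟨(contMDiffOn_of_mem_maximalAtlas h.domChart_mem_maximalAtlas).mdifferentiableOn (by simp),
      (contMDiffOn_symm_of_mem_maximalAtlas h.domChart_mem_maximalAtlas).mdifferentiableOn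
        (by simp)⟩
  have hκ : MDifferentiableAt (𝓡 (c + m)) (𝓡 (c + m)) h.codChart (ι y) :=
    (contMDiffAt_of_mem_maximalAtlas h.codChart_mem_maximalAtlas
      h.mem_codChart_source).mdifferentiableAt (by simp)
  have hy := h.mem_domChart_source
  let P : Euc (c + m) →L[ℝ] Euc m :=
    (ContinuousLinearMap.fst ℝ (Euc m) h.complement).comp h.equiv.symm.toContinuousLinearMap
  have hP : MDifferentiableAt (𝓡 (c + m)) (𝓡 m) P (h.codChart (ι y)) :=
    P.differentiableAt.mdifferentiableAt
  have key : (fun z => P (h.codChart (ι z))) =ᶠ[𝓝 y] h.domChart := by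
    filter_upwards [h.domChart.open_source.mem_nhds hy] with z hz
    have h1 := h.writtenInCharts (show h.domChart z ∈ (h.domChart.extend (𝓡 m)).target by
      simpa using h.domChart.map_source hz)
    have h2 : h.codChart (ι z) = h.equiv (h.domChart z, 0) := by
      simpa [h.domChart.left_inv hz] using h1
    simp [P, h2]
  have hd := (hP.hasMFDerivAt.comp y
    (hκ.hasMFDerivAt.comp y (hι.mdifferentiable y).hasMFDerivAt)).congr_of_eventuallyEq
      (f₁ := h.domChart) (key.symm)
  have hinj := hδ.mfderiv_injective hy
  rw [hd.mfderiv] at hinj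
  intro a b hab
  exact hinj (congrArg (fun w => mfderiv (𝓡 (c + m)) (𝓡 m) P (h.codChart (ι y))
    (mfderiv (𝓡 (c + m)) (𝓡 (c + m)) h.codChart (ι y) w)) hab)

lemma exists_chartFor [IsManifold (𝓡 m) ∞ Y] [IsManifold (𝓡 (c + m)) ∞ X]
    [hι : IsClosedSubmanifold c m ι] (y : Y) :
    ∃ φ : OpenPartialHomeomorph X (Euc c × Euc m), IsChartFor c m ι φ ∧ ι y ∈ φ.source := by
  have h := hι.isSmoothEmbedding.isImmersion.isImmersionAt y
  have hy := h.mem_domChart_source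
  have hfin : Module.Finite ℝ h.complement :=
    Module.Finite.of_surjective
      ((LinearMap.snd ℝ (Euc m) h.complement).comp h.equiv.symm.toLinearEquiv.toLinearMap)
      (fun w => ⟨h.equiv (0, w), by simp⟩)
  have hrank : Module.finrank ℝ h.complement = Module.finrank ℝ (Euc c) := by
    have := h.equiv.toLinearEquiv.finrank_eq
    simp at this ⊢
    omega
  let T : h.complement ≃L[ℝ] Euc c := ContinuousLinearEquiv.ofFinrankEq hrank
  let L : Euc (c + m) ≃L[ℝ] (Euc c × Euc m) :=
    h.equiv.symm.trans
      ((ContinuousLinearEquiv.prodComm ℝ (Euc m) h.complement).trans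
        (T.prodCongr (ContinuousLinearEquiv.refl ℝ (Euc m))))
  let φ₀ : OpenPartialHomeomorph X (Euc c × Euc m) :=
    h.codChart.trans L.toHomeomorph.toOpenPartialHomeomorph
  have hφ₀ : ∀ x, φ₀ x = L (h.codChart x) := fun x => rfl
  have hφι : ∀ z ∈ h.domChart.source, φ₀ (ι z) = (0, h.domChart z) := by
    intro z hz
    have h1 := h.writtenInCharts (show h.domChart z ∈ (h.domChart.extend (𝓡 m)).target by
      simpa using h.domChart.map_source hz)
    have h2 : h.codChart (ι z) = h.equiv (h.domChart z, 0) := by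
      simpa [h.domChart.left_inv hz] using h1
    rw [hφ₀, h2]
    simp [L]
  have hsrc : φ₀.source = h.codChart.source := by simp [φ₀]
  obtain ⟨O, hO, hOι⟩ := hι.isSmoothEmbedding.isEmbedding.isInducing.isOpen_iff.1
    h.domChart.open_source
  have hS : IsOpen (φ₀.source ∩ φ₀ ⁻¹' (univ ×ˢ h.domChart.target)) :=
    φ₀.isOpen_inter_preimage (isOpen_univ.prod h.domChart.open_target)
  have hR := (φ₀.restr_source (O ∩ (φ₀.source ∩ φ₀ ⁻¹' (univ ×ˢ h.domChart.target)))).trans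
    (congrArg (φ₀.source ∩ ·) (hO.inter hS).interior_eq)
  refine ⟨φ₀.restr (O ∩ (φ₀.source ∩ φ₀ ⁻¹' (univ ×ˢ h.domChart.target))), ⟨?_, ?_, ?_⟩, ?_⟩
  · have h1 : ContMDiffOn (𝓡 (c + m)) 𝓘(ℝ, Euc c × Euc m) ∞ φ₀ φ₀.source := by
      rw [hsrc]
      exact L.contDiff.contMDiff.comp_contMDiffOn
        (contMDiffOn_of_mem_maximalAtlas h.codChart_mem_maximalAtlas)
    rw [hR]
    exact h1.mono inter_subset_left
  · have h1 : ContMDiffOn 𝓘(ℝ, Euc c × Euc m) (𝓡 (c + m)) ∞ φ₀.symm φ₀.target := by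
      have h2 := contMDiffOn_symm_of_mem_maximalAtlas (I := 𝓡 (c + m)) (n := ∞)
        h.codChart_mem_maximalAtlas
      refine h2.comp (t := h.codChart.target) L.symm.contDiff.contMDiff.contMDiffOn ?_
      intro p hp
      simpa [φ₀] using hp
    exact h1.mono inter_subset_left
  · intro x hx
    rw [hR] at hx
    simp only [mem_inter_iff, mem_preimage, mem_prod, mem_univ, true_and] at hx
    obtain ⟨hx1, hxO, -, hx2⟩ := hx
    change _ ↔ (φ₀ x).1 = 0
    constructor
    · rintro ⟨z, rfl⟩
      have hz : z ∈ h.domChart.source := by rw [← hOι]; exact hxO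
      rw [hφι z hz]
    · intro h0
      refine ⟨h.domChart.symm (φ₀ x).2, ?_⟩
      have hz := h.domChart.map_target hx2
      refine φ₀.injOn ?_ hx1 ?_
      · rw [hsrc]; exact h.source_subset_preimage_source hz
      · rw [hφι _ hz, h.domChart.right_inv hx2]
        exact Prod.ext h0.symm rfl
  · have hyO : ι y ∈ O := by
      have : y ∈ ι ⁻¹' O := by rw [hOι]; exact hy
      exact this
    have hyκ : ι y ∈ φ₀.source := by rw [hsrc]; exact h.mem_codChart_source
    rw [hR]
    simp only [mem_inter_iff, mem_preimage, mem_prod, mem_univ, true_and]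
    refine ⟨hyκ, hyO, hyκ, ?_⟩
    rw [hφι y hy]
    exact h.domChart.map_source hy

/-- In a chart for `Y`, the tangent space of `Y` is the kernel of the first `c` coordinates. -/
lemma mem_tangentSubspace_iff [IsManifold (𝓡 m) ∞ Y] [IsManifold (𝓡 (c + m)) ∞ X]
    [hι : IsClosedSubmanifold c m ι] {φ : OpenPartialHomeomorph X (Euc c × Euc m)}
    (hφ : IsChartFor c m ι φ) {y : Y} (hy : ι y ∈ φ.source)
    (v : TangentSpace (𝓡 (c + m)) (ι y)) :
    v ∈ tangentSubspace c m ι y ↔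
      (mfderiv (𝓡 (c + m)) 𝓘(ℝ, Euc c × Euc m) φ (ι y) v : Euc c × Euc m).1 = 0 := by
  have hD := hφ.mdifferentiable.mfderiv_injective hy
  let D : TangentSpace (𝓡 (c + m)) (ι y) ≃L[ℝ] (Euc c × Euc m) := hφ.mdifferentiable.mfderiv hy
  have hDv : ∀ v, D v = mfderiv (𝓡 (c + m)) 𝓘(ℝ, Euc c × Euc m) φ (ι y) v := fun v => rfl
  let K : Submodule ℝ (TangentSpace (𝓡 (c + m)) (ι y)) :=
    LinearMap.ker ((LinearMap.fst ℝ (Euc c) (Euc m)).comp D.toLinearEquiv.toLinearMap)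
  have hle : tangentSubspace c m ι y ≤ K := by
    rintro _ ⟨u, rfl⟩
    have hcomp : (fun z => (φ (ι z)).1) =ᶠ[𝓝 y] fun _ => (0 : Euc c) := by
      filter_upwards [(hι.mdifferentiable y).continuousAt.preimage_mem_nhds
        (φ.open_source.mem_nhds hy)] with z hz
      exact (hφ.mem_iff _ hz).1 ⟨z, rfl⟩
    have h1 : HasMFDerivAt 𝓘(ℝ, Euc c × Euc m) 𝓘(ℝ, Euc c) Prod.fst (φ (ι y))
        (ContinuousLinearMap.fst ℝ (Euc c) (Euc m)) :=
      (ContinuousLinearMap.fst ℝ (Euc c) (Euc m)).hasFDerivAt.hasMFDerivAt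
    have h2 := h1.comp y ((hφ.mdifferentiable.mdifferentiableAt hy).hasMFDerivAt.comp y
      (hι.mdifferentiable y).hasMFDerivAt)
    have h3 := (hasMFDerivAt_const (I := 𝓡 m) (I' := 𝓘(ℝ, Euc c)) (0 : Euc c)
      y).congr_of_eventuallyEq hcomp
    have h4 := hasMFDerivAt_unique h2 h3
    exact DFunLike.congr_fun h4 u
  have hX : Module.finrank ℝ (TangentSpace (𝓡 (c + m)) (ι y)) = c + m :=
    finrank_euclideanSpace_fin
  have hfin : FiniteDimensional ℝ (TangentSpace (𝓡 (c + m)) (ι y)) :=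
    inferInstanceAs (FiniteDimensional ℝ (Euc (c + m)))
  have heq : tangentSubspace c m ι y = K := by
    refine Submodule.eq_of_le_of_finrank_eq hle ?_
    have hr : Module.finrank ℝ (tangentSubspace c m ι y) = m := by
      have := LinearMap.finrank_range_of_inj
        (f := (mfderiv (𝓡 m) (𝓡 (c + m)) ι y).toLinearMap) (mfderiv_injective y)
      rw [tangentSubspace, this]
      exact finrank_euclideanSpace_fin
    have hk := LinearMap.finrank_range_add_finrank_ker
      ((LinearMap.fst ℝ (Euc c) (Euc m)).comp D.toLinearEquiv.toLinearMap)
    have hs : LinearMap.range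
        ((LinearMap.fst ℝ (Euc c) (Euc m)).comp D.toLinearEquiv.toLinearMap) = ⊤ := by
      rw [LinearMap.range_eq_top]
      intro w
      exact ⟨D.symm (w, 0), by simp⟩
    rw [hs, finrank_top, hX, finrank_euclideanSpace_fin] at hk
    rw [hr]
    change m = Module.finrank ℝ (LinearMap.ker _)
    omega
  rw [heq]
  exact Iff.rfl

/-- The coordinates on `T_yX / T_yY` given by a chart for `Y`; inverse to `chartFrame`. -/
def normalCoord (φ : OpenPartialHomeomorph X (Euc c × Euc m)) (y : Y) (w : NormalFiber c m ι y) :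
    Euc c :=
  (mfderiv (𝓡 (c + m)) 𝓘(ℝ, Euc c × Euc m) φ (ι y)
    (Function.surjInv (Submodule.mkQ_surjective (tangentSubspace c m ι y)) w) : Euc c × Euc m).1

lemma normalProj_surjective (y : Y) : Function.Surjective (normalProj c m ι y) :=
  Submodule.mkQ_surjective _

section Charts

variable [IsManifold (𝓡 m) ∞ Y] [IsManifold (𝓡 (c + m)) ∞ X] [hι : IsClosedSubmanifold c m ι]
  {φ : OpenPartialHomeomorph X (Euc c × Euc m)}

lemma normalCoord_normalProj (hφ : IsChartFor c m ι φ) {y : Y} (hy : ι y ∈ φ.source)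
    (v : TangentSpace (𝓡 (c + m)) (ι y)) :
    normalCoord φ y (normalProj c m ι y v) =
      (mfderiv (𝓡 (c + m)) 𝓘(ℝ, Euc c × Euc m) φ (ι y) v : Euc c × Euc m).1 := by
  have h := Function.surjInv_eq (Submodule.mkQ_surjective (tangentSubspace c m ι y))
    (normalProj c m ι y v)
  have h2 := (mem_tangentSubspace_iff hφ hy _).1 ((Submodule.Quotient.eq _).1 h)
  rw [map_sub] at h2
  exact sub_eq_zero.1 h2

lemma mfderiv_apply_symm (hφ : IsChartFor c m ι φ) {y : Y} (hy : ι y ∈ φ.source)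
    (p : Euc c × Euc m) :
    (mfderiv (𝓡 (c + m)) 𝓘(ℝ, Euc c × Euc m) φ (ι y)
      (mfderiv 𝓘(ℝ, Euc c × Euc m) (𝓡 (c + m)) φ.symm (φ (ι y)) p) : Euc c × Euc m) = p := by
  have := hφ.mdifferentiable.comp_symm_deriv (φ.map_source hy)
  rw [φ.left_inv hy] at this
  exact DFunLike.congr_fun this p

lemma normalCoord_chartFrame (hφ : IsChartFor c m ι φ) {y : Y} (hy : ι y ∈ φ.source)
    (r : Euc c) : normalCoord φ y (chartFrame c m ι φ y r) = r := by
  refine (normalCoord_normalProj hφ hy _).trans ?_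
  exact congrArg Prod.fst (mfderiv_apply_symm hφ hy (r, 0))

lemma chartFrame_normalCoord (hφ : IsChartFor c m ι φ) {y : Y} (hy : ι y ∈ φ.source)
    (w : NormalFiber c m ι y) : chartFrame c m ι φ y (normalCoord φ y w) = w := by
  obtain ⟨v, rfl⟩ := normalProj_surjective y w
  refine (Submodule.Quotient.eq _).2 ((mem_tangentSubspace_iff hφ hy _).2 ?_)
  rw [map_sub, normalCoord_normalProj hφ hy]
  refine sub_eq_zero.2 ?_
  have h := congrArg Prod.fst (mfderiv_apply_symm hφ hy
    ((mfderiv (𝓡 (c + m)) 𝓘(ℝ, Euc c × Euc m) φ (ι y) v : Euc c × Euc m).1, 0))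
  exact h

/-- The trivialization of the normal bundle over `U ∩ Y` induced by a chart `φ : U → ℝᶜ × ℝᵐ` for
`Y` in `X`, before the total space is topologized. -/
def chartPretriv (φ : OpenPartialHomeomorph X (Euc c × Euc m)) (hφ : IsChartFor c m ι φ) :
    Pretrivialization (Euc c) (π (Euc c) (NormalFiber c m ι)) where
  toFun v := (v.1, normalCoord φ v.1 v.2)
  invFun p := ⟨p.1, chartFrame c m ι φ p.1 p.2⟩
  source := π (Euc c) (NormalFiber c m ι) ⁻¹' (ι ⁻¹' φ.source)
  target := (ι ⁻¹' φ.source) ×ˢ univ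
  map_source' v hv := ⟨hv, mem_univ _⟩
  map_target' p hp := hp.1
  left_inv' v hv := by
    obtain ⟨y, w⟩ := v
    exact congrArg (TotalSpace.mk y) (chartFrame_normalCoord hφ hv w)
  right_inv' p hp := Prod.ext rfl (normalCoord_chartFrame hφ hp.1 p.2)
  open_target := (φ.open_source.preimage hι.mdifferentiable.continuous).prod isOpen_univ
  baseSet := ι ⁻¹' φ.source
  open_baseSet := φ.open_source.preimage hι.mdifferentiable.continuous
  source_eq := rfl
  target_eq := rfl
  proj_toFun _ _ := rfl

/-- The transition maps of the normal bundle: the normal part of the derivative of the overlap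
map of two charts. -/
def normalTransition (ι : Y → X) (φ φ' : OpenPartialHomeomorph X (Euc c × Euc m)) (y : Y) :
    Euc c →L[ℝ] Euc c :=
  (ContinuousLinearMap.fst ℝ (Euc c) (Euc m)).comp
    ((fderiv ℝ (φ' ∘ φ.symm) (φ (ι y))).comp (ContinuousLinearMap.inl ℝ (Euc c) (Euc m)))

lemma normalTransition_apply (hφ : IsChartFor c m ι φ)
    {φ' : OpenPartialHomeomorph X (Euc c × Euc m)} (hφ' : IsChartFor c m ι φ') {y : Y}
    (hy : ι y ∈ φ.source) (hy' : ι y ∈ φ'.source) (r : Euc c) :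
    normalTransition ι φ φ' y r = normalCoord φ' y (chartFrame c m ι φ y r) := by
  refine Eq.trans ?_ (normalCoord_normalProj hφ' hy' _).symm
  have h1 := hφ.mdifferentiable.symm.mdifferentiableAt (φ.map_source hy)
  have h2 := hφ'.mdifferentiable.mdifferentiableAt hy'
  have h3 : MDifferentiableAt (𝓡 (c + m)) 𝓘(ℝ, Euc c × Euc m) φ' (φ.symm (φ (ι y))) := by
    rwa [φ.left_inv hy]
  have h4 := mfderiv_comp (φ (ι y)) h3 h1
  rw [mfderiv_eq_fderiv, φ.left_inv hy] at h4
  exact congrArg Prod.fst (DFunLike.congr_fun h4 ((r, 0) : Euc c × Euc m))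

lemma contMDiffOn_normalTransition (hφ : IsChartFor c m ι φ)
    {φ' : OpenPartialHomeomorph X (Euc c × Euc m)} (hφ' : IsChartFor c m ι φ') :
    ContMDiffOn (𝓡 m) 𝓘(ℝ, Euc c →L[ℝ] Euc c) ∞ (normalTransition ι φ φ')
      (ι ⁻¹' φ.source ∩ ι ⁻¹' φ'.source) := by
  have hO : IsOpen (φ.symm.trans φ').source := (φ.symm.trans φ').open_source
  have h1 : ContDiffOn ℝ ∞ (φ' ∘ φ.symm) (φ.symm.trans φ').source := by
    rw [← contMDiffOn_iff_contDiffOn]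
    refine hφ'.contMDiffOn.comp (hφ.contMDiffOn_symm.mono ?_) ?_
    · intro p hp; exact hp.1
    · intro p hp; exact hp.2
  have h2 : ContDiffOn ℝ ∞ (fderiv ℝ (φ' ∘ φ.symm)) (φ.symm.trans φ').source :=
    h1.fderiv_of_isOpen hO (by simp)
  have h3 : ContDiffOn ℝ ∞ (fun p => (ContinuousLinearMap.fst ℝ (Euc c) (Euc m)).comp
      ((fderiv ℝ (φ' ∘ φ.symm) p).comp (ContinuousLinearMap.inl ℝ (Euc c) (Euc m))))
      (φ.symm.trans φ').source :=
    contDiffOn_const.clm_comp (h2.clm_comp contDiffOn_const)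
  have h4 : ContMDiffOn (𝓡 m) 𝓘(ℝ, Euc c × Euc m) ∞ (fun y => φ (ι y))
      (ι ⁻¹' φ.source ∩ ι ⁻¹' φ'.source) :=
    hφ.contMDiffOn.comp hι.isSmoothEmbedding.contMDiff.contMDiffOn fun y hy => hy.1
  refine h3.contMDiffOn.comp h4 ?_
  intro y hy
  refine ⟨φ.map_source hy.1, ?_⟩
  change φ.symm (φ (ι y)) ∈ φ'.source
  rw [φ.left_inv hy.1]
  exact hy.2

lemma chartPretriv_symm (hφ : IsChartFor c m ι φ) {y : Y} (hy : ι y ∈ φ.source) (r : Euc c) :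
    (chartPretriv φ hφ).symm y r = chartFrame c m ι φ y r := by
  have h := (chartPretriv φ hφ).mk_symm (b := y) hy r
  exact eq_of_heq (TotalSpace.mk.inj h).2

variable (c m ι) in
/-- The normal bundle of `Y` in `X`, with the local trivializations induced by all charts for `Y`
in `X`. -/
def normalPrebundle : VectorPrebundle ℝ (Euc c) (NormalFiber c m ι) where
  pretrivializationAtlas := {e | ∃ φ, ∃ hφ : IsChartFor c m ι φ, e = chartPretriv φ hφ}
  pretrivialization_linear' := by
    rintro _ ⟨φ, hφ, rfl⟩
    refine ⟨fun y hy => ⟨fun w w' => ?_, fun a w => ?_⟩⟩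
    · change normalCoord φ y (w + w') = normalCoord φ y w + normalCoord φ y w'
      obtain ⟨v, rfl⟩ := normalProj_surjective y w
      obtain ⟨v', rfl⟩ := normalProj_surjective y w'
      rw [← map_add]
      simp only [normalCoord_normalProj hφ hy]
      rw [map_add]; rfl
    · change normalCoord φ y (a • w) = a • normalCoord φ y w
      obtain ⟨v, rfl⟩ := normalProj_surjective y w
      rw [← map_smul]
      simp only [normalCoord_normalProj hφ hy]
      rw [map_smul]; rfl
  pretrivializationAt y :=
    chartPretriv (exists_chartFor (c := c) (m := m) (ι := ι) y).choose (exists_chartFor (c := c) (m := m) (ι := ι) y).choose_spec.1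
  mem_base_pretrivializationAt y := (exists_chartFor (c := c) (m := m) (ι := ι) y).choose_spec.2
  pretrivialization_mem_atlas y := ⟨_, _, rfl⟩
  exists_coordChange := by
    rintro _ ⟨φ, hφ, rfl⟩ _ ⟨φ', hφ', rfl⟩
    refine ⟨normalTransition ι φ φ', (contMDiffOn_normalTransition hφ hφ').continuousOn, ?_⟩
    intro y hy r
    rw [normalTransition_apply hφ hφ' hy.1 hy.2, chartPretriv_symm hφ hy.1]
    rfl
  totalSpaceMk_isInducing y := by
    obtain ⟨hφ, hy⟩ := (exists_chartFor (c := c) (m := m) (ι := ι) y).choose_spec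
    set φ := (exists_chartFor (c := c) (m := m) (ι := ι) y).choose
    have hcont : Continuous (normalCoord (ι := ι) φ y) := by
      have hq : IsQuotientMap (normalProj c m ι y) := Submodule.isQuotientMap_mkQ _
      rw [hq.continuous_iff]
      have : normalCoord φ y ∘ normalProj c m ι y = fun v =>
          (mfderiv (𝓡 (c + m)) 𝓘(ℝ, Euc c × Euc m) φ (ι y) v : Euc c × Euc m).1 :=
        funext (normalCoord_normalProj hφ hy)
      rw [this]
      exact continuous_fst.comp
        (mfderiv (𝓡 (c + m)) 𝓘(ℝ, Euc c × Euc m) φ (ι y)).continuous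
    let e : NormalFiber c m ι y ≃ₜ Euc c :=
      { toFun := normalCoord φ y
        invFun := chartFrame c m ι φ y
        left_inv := chartFrame_normalCoord hφ hy
        right_inv := normalCoord_chartFrame hφ hy
        continuous_toFun := hcont
        continuous_invFun := ContinuousLinearMap.continuous _ }
    have h : IsInducing (fun w : NormalFiber c m ι y => (y, normalCoord φ y w)) :=
      isInducing_const_prod.2 e.isInducing
    exact h

instance : TopologicalSpace (TotalSpace (Euc c) (NormalFiber c m ι)) :=
  (normalPrebundle c m ι).totalSpaceTopology

instance : FiberBundle (Euc c) (NormalFiber c m ι) :=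
  (normalPrebundle c m ι).toFiberBundle

instance : VectorBundle ℝ (Euc c) (NormalFiber c m ι) :=
  (normalPrebundle c m ι).toVectorBundle

instance : (normalPrebundle c m ι).IsContMDiff (𝓡 m) ∞ where
  exists_contMDiffCoordChange := by
    rintro _ ⟨φ, hφ, rfl⟩ _ ⟨φ', hφ', rfl⟩
    refine ⟨normalTransition ι φ φ', contMDiffOn_normalTransition hφ hφ', ?_⟩
    intro y hy r
    rw [normalTransition_apply hφ hφ' hy.1 hy.2, chartPretriv_symm hφ hy.1]
    rfl

instance : ContMDiffVectorBundle ∞ (Euc c) (NormalFiber c m ι) (𝓡 m) :=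
  (normalPrebundle c m ι).contMDiffVectorBundle (𝓡 m)

end Charts

/-! ### Normal data: subbundles, inner products, tubular neighbourhoods -/

section NormalData

variable (ι)
variable [IsManifold (𝓡 m) ∞ Y] [IsManifold (𝓡 (c + m)) ∞ X] [IsClosedSubmanifold c m ι]

/-- The subspace `0^{c₁} × ℝ^{c - c₁}` of `ℝᶜ`. -/
def coordSubspace (c c₁ : ℕ) : Submodule ℝ (Euc c) where
  carrier := {r | ∀ i : Fin c, (i : ℕ) < c₁ → r i = 0}
  zero_mem' _ _ := rfl
  add_mem' ha hb i hi := by simp [ha i hi, hb i hi]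
  smul_mem' a r hr i hi := by simp [hr i hi]

/-- A trivialization `Φ : N|_U → ℝᶜ × ℝᵐ` of the normal bundle `N` of `Y` over an open subset `U`
of `Y`: a diffeomorphism onto an open set whose first component restricts to linear isomorphisms
of the fibres and whose second component is (a coordinate chart on `U`) pulled back from `U`. -/
structure IsNormalTrivialization
    (Φ : OpenPartialHomeomorph (TotalSpace (Euc c) (NormalFiber c m ι)) (Euc c × Euc m))
    (U : Set Y) : Prop where
  isOpen : IsOpen U
  source_eq : Φ.source = π (Euc c) (NormalFiber c m ι) ⁻¹' U
  contMDiffOn : ContMDiffOn ((𝓡 m).prod 𝓘(ℝ, Euc c)) 𝓘(ℝ, Euc c × Euc m) ∞ Φ Φ.source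
  contMDiffOn_symm :
    ContMDiffOn 𝓘(ℝ, Euc c × Euc m) ((𝓡 m).prod 𝓘(ℝ, Euc c)) ∞ Φ.symm Φ.target
  linear : ∀ y ∈ U, ∃ L : NormalFiber c m ι y ≃ₗ[ℝ] Euc c, ∀ w, (Φ ⟨y, w⟩).1 = L w
  snd_eq : ∀ y ∈ U, ∀ w w' : NormalFiber c m ι y, (Φ ⟨y, w⟩).2 = (Φ ⟨y, w'⟩).2

/-- The family `S` of subspaces of the fibres is a smooth subbundle of corank `c₁` of the normal
bundle. -/
def IsSubbundle (c₁ : ℕ) (S : ∀ y, Submodule ℝ (NormalFiber c m ι y)) : Prop :=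
  ∀ y₀ : Y, ∃ Φ U, IsNormalTrivialization ι Φ U ∧ y₀ ∈ U ∧
    ∀ y ∈ U, ∀ w : NormalFiber c m ι y, w ∈ S y ↔ (Φ ⟨y, w⟩).1 ∈ coordSubspace c c₁

/-- A smooth inner product on the subbundle `S` of the normal bundle. Smoothness means that the
product of any two smooth local sections of `S` is smooth. -/
structure SubbundleInner (S : ∀ y, Submodule ℝ (NormalFiber c m ι y)) where
  inner : ∀ y, S y →ₗ[ℝ] S y →ₗ[ℝ] ℝ
  symm : ∀ y v w, inner y v w = inner y w v
  pos : ∀ y v, v ≠ 0 → 0 < inner y v v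
  smooth : ∀ (U : Set Y) (s t : ∀ y, S y), IsOpen U →
    ContMDiffOn (𝓡 m) ((𝓡 m).prod 𝓘(ℝ, Euc c)) ∞
      (fun y => TotalSpace.mk' (Euc c) y (s y : NormalFiber c m ι y)) U →
    ContMDiffOn (𝓡 m) ((𝓡 m).prod 𝓘(ℝ, Euc c)) ∞
      (fun y => TotalSpace.mk' (Euc c) y (t y : NormalFiber c m ι y)) U →
    ContMDiffOn (𝓡 m) 𝓘(ℝ, ℝ) ∞ (fun y => inner y (s y) (t y)) U

variable (c m)

/-- A tubular neighbourhood identification `(W, Ψ)` for `Y` in `X`: an open neighbourhood `W` of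
the zero section of the normal bundle `N` and a map `Ψ` restricting to a diffeomorphism from `W`
onto an open subset of `X` (an injective local diffeomorphism) so that `Ψ` is the identity on `Y`
and the composition of the differential of `Ψ` along `Y` with the projection `TX|_Y → N` restricts
to the identity on the vertical tangent vectors. -/
structure TubularNbhd where
  W : Set (TotalSpace (Euc c) (NormalFiber c m ι))
  Ψ : TotalSpace (Euc c) (NormalFiber c m ι) → X
  isOpen_W : IsOpen W
  zero_mem : ∀ y, TotalSpace.mk' (Euc c) y 0 ∈ W
  injOn : InjOn Ψ W
  isLocalDiffeomorphOn :
    IsLocalDiffeomorphOn ((𝓡 m).prod 𝓘(ℝ, Euc c)) (𝓡 (c + m)) ∞ Ψ W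
  map_zero : ∀ y, Ψ (TotalSpace.mk' (Euc c) y 0) = ι y
  normalProj_deriv : ∀ (y : Y) (w : NormalFiber c m ι y),
    normalProj c m ι y (mfderiv 𝓘(ℝ, ℝ) (𝓡 (c + m))
      (fun t : ℝ => Ψ (TotalSpace.mk' (Euc c) y (t • w))) 0 (1 : ℝ)) = w

end NormalData

/-! ### Augmented atlases -/

section Atlases

variable (ι)

/-- The overlap condition on a pair of charts `φ`, `φ'` for `Y` in `X`: there are a smooth
`End(ℝᶜ)`-valued map `h` and a smooth positive function `f` on the domain of the overlap map
`φ ∘ φ'⁻¹` so that the first `c` components of the overlap map are `h(r, s) r` and `h` sends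
`0^{c₁} × ℝ^{c - c₁}` to itself, scaling squared norms of its elements by `f`. -/
def AugCompatible (c₁ : ℕ) (φ φ' : OpenPartialHomeomorph X (Euc c × Euc m)) : Prop :=
  ∃ (h : Euc c × Euc m → Euc c →L[ℝ] Euc c) (f : Euc c × Euc m → ℝ),
    ContDiffOn ℝ ∞ h (φ'.symm.trans φ).source ∧
    ContDiffOn ℝ ∞ f (φ'.symm.trans φ).source ∧
    ∀ p ∈ (φ'.symm.trans φ).source,
      (φ (φ'.symm p)).1 = h p p.1 ∧ 0 < f p ∧
      ∀ r ∈ coordSubspace c c₁, h p r ∈ coordSubspace c c₁ ∧ ‖h p r‖ ^ 2 = f p * ‖r‖ ^ 2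

/-- A `c₁`-augmented atlas for `Y` in `X`. -/
structure IsAugmentedAtlas (c₁ : ℕ) (𝒜 : Set (OpenPartialHomeomorph X (Euc c × Euc m))) :
    Prop where
  isChartFor : ∀ φ ∈ 𝒜, IsChartFor c m ι φ
  covers : range ι ⊆ ⋃ φ ∈ 𝒜, φ.source
  compatible : ∀ φ ∈ 𝒜, ∀ φ' ∈ 𝒜, AugCompatible c₁ φ φ'

/-- An `S`-augmented atlas: a `c₁`-augmented atlas whose charts `φ` identify
`0^{c₁} × ℝ^{c - c₁}` with the fibres of `S`. -/
structure IsSubbundleAugmentedAtlas (c₁ : ℕ) (S : ∀ y, Submodule ℝ (NormalFiber c m ι y))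
    (𝒜 : Set (OpenPartialHomeomorph X (Euc c × Euc m))) : Prop
    extends IsAugmentedAtlas ι c₁ 𝒜 where
  map_frame : ∀ φ ∈ 𝒜, ∀ y, ι y ∈ φ.source →
    S y = (coordSubspace c c₁).map (chartFrame c m ι φ y).toLinearMap

/-- Two `c₁`-augmented atlases are equivalent if their union is a `c₁`-augmented atlas. -/
structure AugEquivalent (c₁ : ℕ) (𝒜 ℬ : Set (OpenPartialHomeomorph X (Euc c × Euc m))) :
    Prop where
  left : IsAugmentedAtlas ι c₁ 𝒜
  right : IsAugmentedAtlas ι c₁ ℬ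
  union : IsAugmentedAtlas ι c₁ (𝒜 ∪ ℬ)

/-- The restrictions of the charts `φ` of `𝒜` to the open subsets `U φ`. -/
def restrictCharts (𝒜 : Set (OpenPartialHomeomorph X (Euc c × Euc m)))
    (U : OpenPartialHomeomorph X (Euc c × Euc m) → Set X) :
    Set (OpenPartialHomeomorph X (Euc c × Euc m)) :=
  (fun φ => φ.restr (U φ)) '' 𝒜

variable {ι}
variable [IsManifold (𝓡 m) ∞ Y] [IsManifold (𝓡 (c + m)) ∞ X] [IsClosedSubmanifold c m ι]
  {S : ∀ y, Submodule ℝ (NormalFiber c m ι y)}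

/-- The chart `φ` is cut out from the tubular neighbourhood identification `(W, Ψ)` and the inner
product `g` on `S`: it is `Φ ∘ Ψ⁻¹` on `Ψ(W|_U)` for a trivialization `Φ` of the normal bundle over
an open subset `U` of `Y` which sends `S` isometrically into `0^{c₁} × ℝ^{c - c₁}`. -/
def IsCutOutChart (c₁ : ℕ) (T : TubularNbhd c m ι) (g : SubbundleInner ι S)
    (φ : OpenPartialHomeomorph X (Euc c × Euc m)) : Prop :=
  ∃ Φ U, IsNormalTrivialization ι Φ U ∧
    (∀ y ∈ U, ∀ w : S y, (Φ ⟨y, w⟩).1 ∈ coordSubspace c c₁ ∧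
      ‖(Φ ⟨y, w⟩).1‖ ^ 2 = g.inner y w w) ∧
    φ.source = T.Ψ '' (T.W ∩ Φ.source) ∧
    ∀ v ∈ T.W ∩ Φ.source, φ (T.Ψ v) = Φ v

/-- An atlas cut out from `(W, Ψ)` and `g`: a collection of charts cut out from these data over
open subsets covering `Y`. -/
structure IsCutOutAtlas (c₁ : ℕ) (T : TubularNbhd c m ι) (g : SubbundleInner ι S)
    (ℬ : Set (OpenPartialHomeomorph X (Euc c × Euc m))) : Prop where
  isCutOutChart : ∀ φ ∈ ℬ, IsCutOutChart c₁ T g φ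
  covers : range ι ⊆ ⋃ φ ∈ ℬ, φ.source

end Atlases

end Submanifold
end AugAtlas

end

open AugAtlas

noncomputable section

/-! Each chart `α` of the atlas carries its own Euler field, the radial field `∑ rⱼ ∂/∂rⱼ` in its
first `c` coordinates. These fields are averaged with a partition of unity, and the resulting field
is linearized along `Y` to produce the tubular neighborhood.

Let `E` be `0^{c₁} × ℝ^{c - c₁}`. The normal part of the overlap map from `α` to `β` is `h(r, s) r`.
By the product rule, the field of `α`, read in `β` at `(w, s)`, therefore has normal part `w +
θ(w)w` with `θ(w) = Dh(h⁻¹w, 0) h⁻¹`, and its tangential part is an operator depending on the point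
applied to `w` (`fderiv_transition_radial`). Differentiating `‖h e‖² = f ‖e‖²` shows that `θ(w)`
preserves `E` and is infinitesimally conformal on it (`isInfConformalOn_pairTheta`). This condition
is linear in the operator, unlike conformality itself, so the average `ζ` of the fields has the same
form (`AugData.mem_good`).

To linearize `ζ`, look for curves `γ(t) = (t κ(t) w, ς(t))` with `t γ' = ζ(γ)`, `κ(0) = 1` and `ς(0)
= s`. The factor `t` cancels and leaves a regular equation for `(κ, ς)`, whose time-one map is a
local diffeomorphism at the points `(0, s)` (`exists_radialFlow`). Since `κ` solves `κ' = Aκ` with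
`A` infinitesimally conformal, `κ(1)` is conformal on `E` (`isConformalOn_of_ode`). The field `ζ`
lives on `X`, so uniqueness of solutions makes the constructions in different charts agree near `Y`
(`AugData.flow_transition`, `toNormal_eventuallyEq`). They glue to a map from a neighborhood of `Y`
to the normal bundle, whose inverse is `Ψ` (`exists_tubularNbhd`). In a chart `β` the normal part of
`β ∘ Ψ` is then `κ(1)` applied to the normal coordinates.

The inner product is the average of the Euclidean ones pulled back by the normal coordinates of the
charts. It is conformal to each of them on the subbundle, because the transition maps of the normal
bundle are the values of `h` on `Y` (`AugData.normalForm_chartFrame`).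

Both the restricted charts of the atlas and the cut-out charts are thus adapted: the normal part of
`φ ∘ Ψ` is a smooth family of fibrewise isomorphisms `M`, conformal on the subbundle. For two such
charts, `M ∘ M'⁻¹` is the `h` required of an overlap map (`IsAdapted.augCompatible`). -/

namespace AugAtlas

set_option linter.unusedSectionVars false

/-! ### Inverse function theorem with an inverse smooth on an open set. -/

section InverseFunction

variable {V W : Type*} [NormedAddCommGroup V] [NormedSpace ℝ V] [CompleteSpace V]
  [NormedAddCommGroup W] [NormedSpace ℝ W]

/-- The inverse function theorem for smooth maps, with a smooth local inverse on an open set. -/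
theorem exists_smooth_openPartialHomeomorph {f : V → W} {Ω : Set V} (hΩ : IsOpen Ω)
    (hf : ContDiffOn ℝ ∞ f Ω) {a : V} (ha : a ∈ Ω) (f' : V ≃L[ℝ] W)
    (hf' : HasFDerivAt f (f' : V →L[ℝ] W) a) :
    ∃ e : OpenPartialHomeomorph V W, (∀ x, e x = f x) ∧ a ∈ e.source ∧ e.source ⊆ Ω ∧
      ContDiffOn ℝ ∞ e.symm e.target := by
  have hca : ContDiffAt ℝ ∞ f a := hf.contDiffAt (hΩ.mem_nhds ha)
  let e₀ := hca.toOpenPartialHomeomorph f hf' (by simp)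
  have he₀ : ∀ x, e₀ x = f x := fun x => rfl
  have ha₀ : a ∈ e₀.source := hca.mem_toOpenPartialHomeomorph_source hf' (by simp)
  have hcont : ContinuousOn (fderiv ℝ f) Ω := hf.continuousOn_fderiv_of_isOpen hΩ (by simp)
  -- The inverse is to be smooth at every point of the target, not only at `f a`, so the source is
  -- cut down to the open set where the derivative is invertible.
  let Ω' : Set V := Ω ∩ fderiv ℝ f ⁻¹' range ((↑) : (V ≃L[ℝ] W) → V →L[ℝ] W)
  have hΩ' : IsOpen Ω' := hcont.isOpen_inter_preimage hΩ ContinuousLinearEquiv.isOpen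
  have haΩ' : a ∈ Ω' := ⟨ha, f', hf'.fderiv.symm⟩
  refine ⟨e₀.restrOpen Ω' hΩ', he₀, ⟨ha₀, haΩ'⟩, fun x hx => hx.2.1, ?_⟩
  intro p hp
  have hx := (e₀.restrOpen Ω' hΩ').map_target hp
  set x := (e₀.restrOpen Ω' hΩ').symm p with hxdef
  obtain ⟨A, hA⟩ := hx.2.2
  have hd : HasFDerivAt e₀ (A : V →L[ℝ] W) x := by
    have := ((hf.contDiffAt (hΩ.mem_nhds hx.2.1)).differentiableAt (by simp)).hasFDerivAt
    rw [← hA] at this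
    exact this
  exact ((e₀.restrOpen Ω' hΩ').contDiffAt_symm hp hd
    (hf.contDiffAt (hΩ.mem_nhds hx.2.1))).contDiffWithinAt

end InverseFunction

/-! ### Smoothness of composition operators on spaces of continuous functions. -/

section Nemytskii

variable {K : Type*} [TopologicalSpace K] [CompactSpace K]
variable {Z : Type} [NormedAddCommGroup Z] [NormedSpace ℝ Z]

set_option synthInstance.maxHeartbeats 200000 in
/-- Pointwise application of a continuous family of operators, as a bounded linear map. -/
def pointwiseApply (K : Type*) [TopologicalSpace K] [CompactSpace K]
    (Z Z' : Type) [NormedAddCommGroup Z] [NormedSpace ℝ Z]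
    [NormedAddCommGroup Z'] [NormedSpace ℝ Z'] :
    C(K, Z →L[ℝ] Z') →L[ℝ] C(K, Z) →L[ℝ] C(K, Z') :=
  LinearMap.mkContinuous₂
    (LinearMap.mk₂ ℝ
      (fun (A : C(K, Z →L[ℝ] Z')) (η : C(K, Z)) =>
        (⟨fun t => A t (η t), by fun_prop⟩ : C(K, Z')))
      (fun A B η => by ext t; simp) (fun a A η => by ext t; simp)
      (fun A η η' => by ext t; simp) (fun a A η => by ext t; simp)) 1
    (fun A η => by
      rw [one_mul, ContinuousMap.norm_le _ (by positivity)]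
      intro t
      refine ((A t).le_opNorm (η t)).trans ?_
      gcongr
      · exact A.norm_coe_le_norm t
      · exact η.norm_coe_le_norm t)

@[simp] lemma pointwiseApply_apply {Z' : Type} [NormedAddCommGroup Z'] [NormedSpace ℝ Z']
    (A : C(K, Z →L[ℝ] Z')) (η : C(K, Z)) (t : K) :
    pointwiseApply K Z Z' A η t = A t (η t) := rfl

-- The mean value inequality on a ball about `γ t` bounds the remainder at `t`. Its constant does
-- not depend on `t`, so the bound holds in the sup norm.
set_option synthInstance.maxHeartbeats 200000 in
lemma hasFDerivAt_postcomp {Z' : Type} [NormedAddCommGroup Z'] [NormedSpace ℝ Z']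
    {L : C(Z, Z')} {L' : C(Z, Z →L[ℝ] Z')} (hL : ∀ z, HasFDerivAt L (L' z) z) (γ : C(K, Z)) :
    HasFDerivAt (fun γ : C(K, Z) => L.comp γ) (pointwiseApply K Z Z' (L'.comp γ)) γ := by
  rw [hasFDerivAt_iff_isLittleO_nhds_zero, Asymptotics.isLittleO_iff]
  intro ε hε
  have hc : Continuous fun γ : C(K, Z) => L'.comp γ := ContinuousMap.continuous_postcomp L'
  obtain ⟨δ, hδ, h⟩ :=
    (Metric.continuous_iff (α := C(K, Z)) (β := C(K, Z →L[ℝ] Z'))).1 hc γ ε hε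
  filter_upwards [Metric.ball_mem_nhds (0 : C(K, Z)) hδ] with η hη
  rw [mem_ball_zero_iff] at hη
  rw [ContinuousMap.norm_le _ (by positivity)]
  intro t
  -- Continuity of `γ ↦ L' ∘ γ`, tested on translates of `γ` by the constant `z - γ t`, yields a
  -- modulus of continuity of `L'` along `γ` that is uniform in `t`.
  have hb : ∀ z ∈ Metric.ball (γ t) δ, ‖L' z - L' (γ t)‖ ≤ ε := by
    intro z hz
    have h1 := h (γ + ContinuousMap.const K (z - γ t)) (by
      rw [dist_eq_norm, add_sub_cancel_left, ContinuousMap.norm_lt_iff _ hδ]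
      intro s
      simpa [dist_eq_norm] using hz)
    have h2 := (ContinuousMap.dist_apply_le_dist t).trans h1.le
    simpa [dist_eq_norm] using h2
  have := (convex_ball (γ t) δ).norm_image_sub_le_of_norm_hasFDerivWithin_le'
    (f := L) (f' := fun z => L' z) (φ := L' (γ t)) (C := ε)
    (fun z hz => (hL z).hasFDerivWithinAt) hb (Metric.mem_ball_self hδ)
    (y := γ t + η t) (by
      rw [Metric.mem_ball, dist_eq_norm, add_sub_cancel_left]
      exact (η.norm_coe_le_norm t).trans_lt hη)
  rw [add_sub_cancel_left] at this
  refine (show _ ≤ _ from this).trans ?_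
  gcongr
  exact η.norm_coe_le_norm t

set_option synthInstance.maxHeartbeats 200000 in
/-- Composition with a smooth map is a smooth map of spaces of continuous functions. -/
theorem contDiff_postcomp {Z' : Type} [NormedAddCommGroup Z'] [NormedSpace ℝ Z']
    (L : C(Z, Z')) (hL : ContDiff ℝ ∞ L) :
    ContDiff ℝ ∞ (fun γ : C(K, Z) => L.comp γ) := by
  rw [contDiff_infty]
  intro n
  -- The derivative of composition with `L` is a bounded linear map applied to composition with
  -- `fderiv ℝ L`, so regularity bootstraps. The target changes from `Z'` to `Z →L[ℝ] Z'` at each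
  -- step.
  induction n generalizing Z' with
  | zero =>
    rw [Nat.cast_zero, contDiff_zero]
    exact ContinuousMap.continuous_postcomp L
  | succ n ih =>
    have h2 := (contDiff_infty_iff_fderiv.1 hL)
    let L' : C(Z, Z →L[ℝ] Z') := ⟨fderiv ℝ L, h2.2.continuous⟩
    have hd := fun γ : C(K, Z) => hasFDerivAt_postcomp (L := L) (L' := L')
      (fun z => (h2.1 z).hasFDerivAt) γ
    rw [Nat.cast_succ, contDiff_succ_iff_hasFDerivAt]
    refine ⟨fun γ => pointwiseApply K Z Z' (L'.comp γ), ?_, hd⟩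
    have h3 : ContDiff ℝ n (fun A => pointwiseApply K Z Z' A) :=
      ContinuousLinearMap.contDiff (𝕜 := ℝ) (E := C(K, Z →L[ℝ] Z'))
        (F := C(K, Z) →L[ℝ] C(K, Z')) (pointwiseApply K Z Z')
    exact h3.comp (ih L' h2.2)

end Nemytskii

/-! ### Smooth dependence on parameters, by the implicit function theorem in path space. -/

section

open scoped unitInterval

section ODE

variable {W Z : Type} [NormedAddCommGroup W] [NormedSpace ℝ W]
  [NormedAddCommGroup Z] [NormedSpace ℝ Z]

/-- Constant functions, as a bounded linear map. -/
def constPath (Z : Type) [NormedAddCommGroup Z] [NormedSpace ℝ Z] : Z →L[ℝ] C(I, Z) :=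
  LinearMap.mkContinuous
    { toFun := fun z => ContinuousMap.const I z
      map_add' := fun _ _ => rfl
      map_smul' := fun _ _ => rfl } 1
    (fun z => by
      rw [one_mul, ContinuousMap.norm_le _ (norm_nonneg _)]
      intro t; exact le_rfl)

@[simp] lemma constPath_apply (z : Z) (t : I) : constPath Z z t = z := rfl

/-- The linear paths `t ↦ t w`, as a bounded linear map. -/
def linearPath (W : Type) [NormedAddCommGroup W] [NormedSpace ℝ W] : W →L[ℝ] C(I, W) :=
  LinearMap.mkContinuous
    { toFun := fun w => ⟨fun t => (t : ℝ) • w, by fun_prop⟩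
      map_add' := fun _ _ => by ext t; simp
      map_smul' := fun _ _ => by ext t; exact smul_comm _ _ _ } 1
    (fun w => by
      rw [one_mul, ContinuousMap.norm_le _ (norm_nonneg _)]
      intro t
      change ‖(t : ℝ) • w‖ ≤ _
      rw [norm_smul, Real.norm_of_nonneg t.2.1]
      exact mul_le_of_le_one_left (norm_nonneg _) t.2.2)

@[simp] lemma linearPath_apply (w : W) (t : I) : linearPath W w t = (t : ℝ) • w := rfl

/-- The primitive of a path vanishing at `0`, as a bounded linear map. -/
def primitivePath (Z : Type) [NormedAddCommGroup Z] [NormedSpace ℝ Z] [CompleteSpace Z] :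
    C(I, Z) →L[ℝ] C(I, Z) :=
  LinearMap.mkContinuous
    { toFun := fun η => ⟨fun t => ∫ τ in (0 : ℝ)..t, IccExtend zero_le_one η τ, by
        have h : Continuous (IccExtend zero_le_one η) := η.continuous.Icc_extend'
        exact (intervalIntegral.continuous_primitive (fun _ _ => h.intervalIntegrable _ _)
          0).comp continuous_subtype_val⟩
      map_add' := fun η η' => by
        ext t
        have h : Continuous (IccExtend zero_le_one η) := η.continuous.Icc_extend'
        have h' : Continuous (IccExtend zero_le_one η') := η'.continuous.Icc_extend'
        exact intervalIntegral.integral_add (h.intervalIntegrable _ _) (h'.intervalIntegrable _ _)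
      map_smul' := fun a η => by
        ext t
        exact intervalIntegral.integral_smul a _ } 1
    (fun η => by
      rw [one_mul, ContinuousMap.norm_le _ (norm_nonneg _)]
      intro t
      refine (intervalIntegral.norm_integral_le_of_norm_le_const (C := ‖η‖) ?_).trans ?_
      · intro τ _; exact η.norm_coe_le_norm _
      · rw [sub_zero, abs_of_nonneg t.2.1]
        exact mul_le_of_le_one_right (norm_nonneg _) t.2.2)

lemma primitivePath_apply [CompleteSpace Z] (η : C(I, Z)) (t : I) :
    primitivePath Z η t = ∫ τ in (0 : ℝ)..t, IccExtend zero_le_one η τ := rfl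

/-- Pairs of paths are paths of pairs; the second path is `t ↦ t w`. -/
def pairPath (W Z : Type) [NormedAddCommGroup W] [NormedSpace ℝ W]
    [NormedAddCommGroup Z] [NormedSpace ℝ Z] : (W × C(I, Z)) →L[ℝ] C(I, Z × W) :=
  ((ContinuousLinearMap.inr ℝ Z W).compLeftContinuous ℝ I).comp
      ((linearPath W).comp (ContinuousLinearMap.fst ℝ W C(I, Z))) +
    ((ContinuousLinearMap.inl ℝ Z W).compLeftContinuous ℝ I).comp
      (ContinuousLinearMap.snd ℝ W C(I, Z))

lemma pairPath_apply (w : W) (γ : C(I, Z)) (t : I) :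
    pairPath W Z (w, γ) t = (γ t, (t : ℝ) • w) := by
  change ((0 : Z), (t : ℝ) • w) + (γ t, (0 : W)) = _
  simp

variable [CompleteSpace W] [CompleteSpace Z]

set_option synthInstance.maxHeartbeats 400000 in
set_option maxHeartbeats 1000000 in
/-- Smooth dependence on initial conditions, in integral form, for `γ' = L(γ, t w) w`. -/
theorem exists_smooth_integral_solution (L : C(Z × W, W →L[ℝ] Z)) (hL : ContDiff ℝ ∞ L)
    (z₀ : Z) : ∃ (Γ : W × Z → C(I, Z)) (B : Set (W × Z)), IsOpen B ∧ ((0 : W), z₀) ∈ B ∧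
      ContDiffOn ℝ ∞ Γ B ∧ ∀ p ∈ B, ∀ t : I,
        Γ p t = p.2 + ∫ τ in (0 : ℝ)..t,
          IccExtend zero_le_one (fun τ : I => L (Γ p τ, (τ : ℝ) • p.1) p.1) τ := by
  let N : (W × Z) × C(I, Z) → C(I, Z) := fun q =>
    pointwiseApply I W Z (L.comp (pairPath W Z (q.1.1, q.2))) (constPath W q.1.1)
  -- Solutions are the zeros of `G`. Pairing `G` with the parameters, as in `Φ` below, turns the
  -- inverse function theorem into the implicit one.
  let G : (W × Z) × C(I, Z) → C(I, Z) := fun q =>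
    q.2 - constPath Z q.1.2 - primitivePath Z (N q)
  let C₁ : (W × Z) × C(I, Z) → C(I, W →L[ℝ] Z) := fun q =>
    L.comp (pairPath W Z (q.1.1, q.2))
  have hC₁ : ContDiff ℝ ∞ C₁ := by
    have h1 : ContDiff ℝ ∞ (fun γ : C(I, Z × W) => L.comp γ) := contDiff_postcomp L hL
    have h2 : ContDiff ℝ ∞ (fun q : (W × Z) × C(I, Z) => pairPath W Z (q.1.1, q.2)) :=
      ContinuousLinearMap.contDiff ((pairPath W Z).comp
        (((ContinuousLinearMap.fst ℝ W Z).comp (ContinuousLinearMap.fst ℝ (W × Z) C(I, Z))).prod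
          (ContinuousLinearMap.snd ℝ (W × Z) C(I, Z))))
    exact h1.comp h2
  let C₂ : (W × Z) × C(I, Z) → C(I, W) →L[ℝ] C(I, Z) := fun q => pointwiseApply I W Z (C₁ q)
  have hC₂ : ContDiff ℝ ∞ C₂ := by
    have h3 : ContDiff ℝ ∞ (fun A => pointwiseApply I W Z A) :=
      ContinuousLinearMap.contDiff (𝕜 := ℝ) (E := C(I, W →L[ℝ] Z))
        (F := C(I, W) →L[ℝ] C(I, Z)) (pointwiseApply I W Z)
    exact h3.comp hC₁
  let cw : ((W × Z) × C(I, Z)) →L[ℝ] C(I, W) := (constPath W).comp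
    ((ContinuousLinearMap.fst ℝ W Z).comp (ContinuousLinearMap.fst ℝ (W × Z) C(I, Z)))
  let cz : ((W × Z) × C(I, Z)) →L[ℝ] C(I, Z) := (constPath Z).comp
    ((ContinuousLinearMap.snd ℝ W Z).comp (ContinuousLinearMap.fst ℝ (W × Z) C(I, Z)))
  have hN : ContDiff ℝ ∞ N := hC₂.clm_apply cw.contDiff
  have hG : ContDiff ℝ ∞ G :=
    (contDiff_snd.sub cz.contDiff).sub ((primitivePath Z).contDiff.comp hN)
  let Φ : (W × Z) × C(I, Z) → (W × Z) × C(I, Z) := fun q => (q.1, G q)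
  have hΦ : ContDiff ℝ ∞ Φ := contDiff_fst.prodMk hG
  let q₀ : (W × Z) × C(I, Z) := ((0, z₀), constPath Z z₀)
  -- At `w = 0` the nonlinear term `N` vanishes for every path, so `G` has derivative the identity
  -- in the path and `-T` in the parameters. The derivative of `Φ` is thus a shear, invertible
  -- without any smallness estimate.
  let T : (W × Z) →L[ℝ] C(I, Z) :=
    (constPath Z).comp (ContinuousLinearMap.snd ℝ W Z) +
      (primitivePath Z).comp ((C₂ q₀).comp ((constPath W).comp (ContinuousLinearMap.fst ℝ W Z)))
  let F' : ((W × Z) × C(I, Z)) ≃L[ℝ] ((W × Z) × C(I, Z)) :=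
    ContinuousLinearEquiv.equivOfInverse
      ((ContinuousLinearMap.fst ℝ _ _).prod
        (ContinuousLinearMap.snd ℝ _ _ - T.comp (ContinuousLinearMap.fst ℝ _ _)))
      ((ContinuousLinearMap.fst ℝ _ _).prod
        (ContinuousLinearMap.snd ℝ _ _ + T.comp (ContinuousLinearMap.fst ℝ _ _)))
      (fun q => by simp) (fun q => by simp)
  have hd : HasFDerivAt Φ (F' : _ →L[ℝ] _) q₀ := by
    have hC₂' : HasFDerivAt C₂ (fderiv ℝ C₂ q₀) q₀ :=
      (hC₂.differentiable (by simp) q₀).hasFDerivAt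
    have hN' := hC₂'.clm_apply cw.hasFDerivAt
    have hG' := ((hasFDerivAt_snd (𝕜 := ℝ) (p := q₀)).sub cz.hasFDerivAt).sub
      ((primitivePath Z).hasFDerivAt.comp q₀ hN')
    have hΦ' := (hasFDerivAt_fst (𝕜 := ℝ) (p := q₀)).prodMk hG'
    refine hΦ'.congr_fderiv ?_
    have h0 : cw q₀ = 0 := map_zero (constPath W)
    refine ContinuousLinearMap.ext fun q => ?_
    refine Prod.ext rfl ?_
    simp only [F', T, cz, cw] at h0 ⊢
    simp [h0, ← sub_sub]
  obtain ⟨e, he, hq₀, -, hsymm⟩ := exists_smooth_openPartialHomeomorph isOpen_univ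
    hΦ.contDiffOn (mem_univ q₀) F' hd
  have hΦq₀ : Φ q₀ = ((0, z₀), 0) := by
    refine Prod.ext rfl ?_
    have h0 : N q₀ = 0 := by
      change C₂ q₀ (constPath W 0) = 0
      rw [map_zero, map_zero]
    change constPath Z z₀ - constPath Z z₀ - primitivePath Z (N q₀) = 0
    rw [h0, map_zero, sub_self, sub_zero]
  let j : W × Z → (W × Z) × C(I, Z) := fun p => (p, 0)
  have hj : ContDiff ℝ ∞ j := contDiff_id.prodMk contDiff_const
  refine ⟨fun p => (e.symm (j p)).2, j ⁻¹' e.target, e.open_target.preimage hj.continuous, ?_, ?_,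
    ?_⟩
  · have := e.map_source hq₀
    rw [he, hΦq₀] at this
    exact this
  · exact (hsymm.comp hj.contDiffOn fun p hp => hp).snd
  · intro p hp t
    have h1 := e.right_inv hp
    rw [he] at h1
    have h2 : (e.symm (j p)).1 = p := congrArg Prod.fst h1
    have h3 : G (e.symm (j p)) = 0 := congrArg Prod.snd h1
    set q := e.symm (j p) with hq
    have h4 : q.2 t - p.2 - primitivePath Z (N q) t = 0 := by
      have := DFunLike.congr_fun h3 t
      rw [← h2]
      exact this
    rw [sub_sub, sub_eq_zero] at h4
    rw [h4, primitivePath_apply]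
    congr 3
    funext τ
    congr 1
    funext τ
    change L (pairPath W Z (q.1.1, q.2) τ) q.1.1 = _
    rw [pairPath_apply, h2]

end ODE

end

/-! ### Local form of smooth dependence, and uniqueness of solutions. -/

section

open scoped unitInterval

section ODE

/-- A smooth function on an open set agrees near each point of it with a globally smooth one. -/
lemma exists_contDiff_eventuallyEq {V F : Type*} [NormedAddCommGroup V] [NormedSpace ℝ V]
    [FiniteDimensional ℝ V] [NormedAddCommGroup F] [NormedSpace ℝ F] {Ω : Set V} (hΩ : IsOpen Ω)
    {f : V → F} (hf : ContDiffOn ℝ ∞ f Ω) {a : V} (ha : a ∈ Ω) :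
    ∃ g : V → F, ContDiff ℝ ∞ g ∧ g =ᶠ[𝓝 a] f := by
  obtain ⟨r, hr, hrΩ⟩ := Metric.nhds_basis_closedBall.mem_iff.1 (hΩ.mem_nhds ha)
  let b : ContDiffBump a := ⟨r / 2, r, by linarith, by linarith⟩
  refine ⟨fun x => b x • f x, ?_, ?_⟩
  · rw [contDiff_iff_contDiffAt]
    intro x
    by_cases hx : x ∈ Ω
    · exact b.contDiff.contDiffAt.smul (hf.contDiffAt (hΩ.mem_nhds hx))
    · have : (fun x => b x • f x) =ᶠ[𝓝 x] fun _ => 0 := by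
        have h1 : (Metric.closedBall a r)ᶜ ∈ 𝓝 x :=
          Metric.isClosed_closedBall.isOpen_compl.mem_nhds fun h => hx (hrΩ h)
        filter_upwards [h1] with z hz
        have : b z = 0 := by
          by_contra h
          have h2 : z ∈ Function.support b := h
          rw [b.support_eq] at h2
          exact hz (Metric.ball_subset_closedBall h2)
        rw [this, zero_smul]
      exact contDiffAt_const.congr_of_eventuallyEq this
  · filter_upwards [b.eventuallyEq_one] with x hx
    simp [hx]

variable {W Z : Type} [NormedAddCommGroup W] [NormedSpace ℝ W] [FiniteDimensional ℝ W]
  [NormedAddCommGroup Z] [NormedSpace ℝ Z] [FiniteDimensional ℝ Z]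

/-- Smooth dependence on parameters and initial conditions for `γ' = L(γ, t w) w`, `t ∈ [0, 1]`,
near `w = 0`. -/
theorem exists_smooth_solution {Ω : Set (Z × W)} (hΩ : IsOpen Ω) (L : Z × W → W →L[ℝ] Z)
    (hL : ContDiffOn ℝ ∞ L Ω) {z₀ : Z} (hz₀ : (z₀, (0 : W)) ∈ Ω) :
    ∃ (γ : W × Z → ℝ → Z) (B : Set (W × Z)), IsOpen B ∧ ((0 : W), z₀) ∈ B ∧
      ContDiffOn ℝ ∞ (fun p => γ p 1) B ∧
      (∀ p ∈ B, γ p 0 = p.2 ∧ ∀ t ∈ Icc (0 : ℝ) 1, (γ p t, t • p.1) ∈ Ω ∧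
        HasDerivAt (γ p) (L (γ p t, t • p.1) p.1) t) ∧
      ∀ z, ((0 : W), z) ∈ B → ∀ V ∈ 𝓝 z, ∀ᶠ p in 𝓝 ((0 : W), z), ∀ t ∈ Icc (0 : ℝ) 1,
        γ p t ∈ V := by
  have : CompleteSpace W := FiniteDimensional.complete ℝ W
  have : CompleteSpace Z := FiniteDimensional.complete ℝ Z
  obtain ⟨g, hg, hgL⟩ := exists_contDiff_eventuallyEq hΩ hL hz₀
  obtain ⟨Γ, B, hB, hB₀, hΓ, hint⟩ := exists_smooth_integral_solution
    (⟨g, hg.continuous⟩ : C(Z × W, W →L[ℝ] Z)) hg z₀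
  simp only [ContinuousMap.coe_mk] at hint
  let η : W × Z → I → Z := fun p τ => g (Γ p τ, (τ : ℝ) • p.1) p.1
  have hη : ∀ p, Continuous (η p) := fun p =>
    (hg.continuous.comp (by fun_prop)).clm_apply continuous_const
  -- The clamped integrand extends the path to all real times, which makes the derivatives at `0`
  -- and `1` two-sided.
  let γ : W × Z → ℝ → Z := fun p t => p.2 + ∫ τ in (0 : ℝ)..t, IccExtend zero_le_one (η p) τ
  have hγΓ : ∀ p ∈ B, ∀ t : I, γ p t = Γ p t := fun p hp t => (hint p hp t).symm
  have hγ0 : ∀ p, γ p 0 = p.2 := fun p => by simp [γ]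
  have hγd : ∀ p ∈ B, ∀ t ∈ Icc (0 : ℝ) 1, HasDerivAt (γ p) (g (γ p t, t • p.1) p.1) t := by
    intro p hp t ht
    have hc : Continuous (IccExtend zero_le_one (η p)) := (hη p).Icc_extend'
    have h1 := (intervalIntegral.integral_hasDerivAt_right (hc.intervalIntegrable 0 t)
      hc.aestronglyMeasurable.stronglyMeasurableAtFilter hc.continuousAt).const_add p.2
    rw [IccExtend_of_mem _ _ ht] at h1
    have h2 := hγΓ p hp ⟨t, ht⟩
    change HasDerivAt (γ p) (g (γ p (⟨t, ht⟩ : I), t • p.1) p.1) t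
    rw [h2]
    exact h1
  have hclose : ∀ z, ((0 : W), z) ∈ B → ∀ V ∈ 𝓝 z, ∀ᶠ p in 𝓝 ((0 : W), z),
      ∀ t ∈ Icc (0 : ℝ) 1, γ p t ∈ V := by
    intro z hz V hV
    obtain ⟨ε, hε, hεV⟩ := Metric.mem_nhds_iff.1 hV
    -- For `w = 0` the right-hand side vanishes and the solution is constant; continuity of `Γ` in
    -- the sup norm then controls nearby paths uniformly in time.
    have hrest : Γ (0, z) = ContinuousMap.const I z := by
      ext t
      rw [hint _ hz t]
      simp [IccExtend]
    have hcont : ContinuousAt Γ (0, z) := hΓ.continuousOn.continuousAt (hB.mem_nhds hz)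
    filter_upwards [hcont (Metric.ball_mem_nhds _ hε), hB.mem_nhds hz] with p hp hpB t ht
    apply hεV
    rw [hγΓ p hpB ⟨t, ht⟩]
    rw [mem_preimage, hrest, Metric.mem_ball] at hp
    exact (ContinuousMap.dist_apply_le_dist (g := ContinuousMap.const I z) ⟨t, ht⟩).trans_lt hp
  -- The cut-off `g` agrees with `L` only near `(z₀, 0)`, so parameters are restricted to those
  -- whose entire path stays there.
  have hnear : ∀ᶠ p in 𝓝 ((0 : W), z₀), ∀ t ∈ Icc (0 : ℝ) 1,
      (γ p t, t • p.1) ∈ Ω ∧ g (γ p t, t • p.1) = L (γ p t, t • p.1) := by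
    obtain ⟨V₁, hV₁, V₂, hV₂, hV⟩ := mem_nhds_prod_iff.1
      (Filter.inter_mem (hΩ.mem_nhds hz₀) hgL)
    obtain ⟨ε, hε, hεV⟩ := Metric.mem_nhds_iff.1 hV₂
    have h2 : ∀ᶠ p in 𝓝 ((0 : W), z₀), p.1 ∈ Metric.ball (0 : W) ε :=
      continuous_fst.continuousAt (Metric.ball_mem_nhds _ hε)
    filter_upwards [hclose z₀ hB₀ V₁ hV₁, h2] with p hp hp2 t ht
    refine hV (mk_mem_prod (hp t ht) (hεV ?_))
    rw [mem_ball_zero_iff] at hp2 ⊢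
    rw [norm_smul, Real.norm_of_nonneg ht.1]
    exact (mul_le_of_le_one_left (norm_nonneg _) ht.2).trans_lt hp2
  obtain ⟨B', hB'sub, hB', hB'₀⟩ := mem_nhds_iff.1 hnear
  refine ⟨γ, B ∩ B', hB.inter hB', ⟨hB₀, hB'₀⟩, ?_, ?_, fun z hz => hclose z hz.1⟩
  · have h1 : ContDiffOn ℝ ∞ (fun p => Γ p 1) B :=
      (ContinuousLinearMap.contDiff (𝕜 := ℝ) (E := C(I, Z)) (F := Z)
        (ContinuousMap.evalCLM ℝ (1 : I))).comp_contDiffOn hΓ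
    exact (h1.congr fun p hp => hγΓ p hp 1).mono inter_subset_left
  · intro p hp
    refine ⟨hγ0 p, fun t ht => ⟨(hB'sub hp.2 t ht).1, ?_⟩⟩
    rw [← (hB'sub hp.2 t ht).2]
    exact hγd p hp.1 t ht

/-- Two solutions of a smooth autonomous equation that stay near a given point agree. -/
theorem exists_nhds_solution_unique {V : Type*} [NormedAddCommGroup V] [NormedSpace ℝ V]
    {X : V → V} {a : V} (hX : ContDiffAt ℝ 1 X a) :
    ∃ N ∈ 𝓝 a, ∀ α β : ℝ → V, ContinuousOn α (Icc 0 1) → ContinuousOn β (Icc 0 1) →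
      (∀ t ∈ Icc (0 : ℝ) 1, α t ∈ N) → (∀ t ∈ Icc (0 : ℝ) 1, β t ∈ N) →
      (∀ t ∈ Ioo (0 : ℝ) 1, HasDerivAt α (X (α t)) t) →
      (∀ t ∈ Ioo (0 : ℝ) 1, HasDerivAt β (X (β t)) t) → α 0 = β 0 → α 1 = β 1 := by
  obtain ⟨K, N, hN, hK⟩ := hX.exists_lipschitzOnWith
  refine ⟨N, hN, ?_⟩
  -- The equation is assumed only on the open interval, since the curves compared later are obtained
  -- after division by `t`. The right derivative at `0` is recovered as the limit of the
  -- derivatives.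
  have key : ∀ α : ℝ → V, ContinuousOn α (Icc 0 1) → (∀ t ∈ Icc (0 : ℝ) 1, α t ∈ N) →
      (∀ t ∈ Ioo (0 : ℝ) 1, HasDerivAt α (X (α t)) t) →
      ∀ t ∈ Ico (0 : ℝ) 1, HasDerivWithinAt α (X (α t)) (Ici t) t := by
    intro α hα hαN hαd t ht
    rcases ht.1.eq_or_lt with rfl | h0
    · refine hasDerivWithinAt_Ici_of_tendsto_deriv (s := Ioo 0 1)
        (fun t ht => (hαd t ht).differentiableAt.differentiableWithinAt)
        ((hα 0 (by simp)).mono Ioo_subset_Icc_self) (Ioo_mem_nhdsGT zero_lt_one) ?_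
      have h1 : ContinuousOn (fun t => X (α t)) (Icc 0 1) :=
        hK.continuousOn.comp hα hαN
      have h2 : Filter.Tendsto (fun t => X (α t)) (𝓝[>] 0) (𝓝 (X (α 0))) := by
        have h3 := (h1 0 (by simp)).mono_left (nhdsWithin_mono (0 : ℝ) Ioo_subset_Icc_self)
        rwa [nhdsWithin_Ioo_eq_nhdsGT zero_lt_one] at h3
      refine h2.congr' ?_
      filter_upwards [Ioo_mem_nhdsGT (zero_lt_one' ℝ)] with t ht
      exact (hαd t ht).deriv.symm
    · exact (hαd t ⟨h0, ht.2⟩).hasDerivWithinAt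
  intro α β hα hβ hαN hβN hαd hβd h0
  exact ODE_solution_unique_of_mem_Icc_right (v := fun _ => X) (s := fun _ => N)
    (fun _ _ => hK) hα (key α hα hαN hαd) (fun t ht => hαN t (Ico_subset_Icc_self ht))
    hβ (key β hβ hβN hβd) (fun t ht => hβN t (Ico_subset_Icc_self ht)) h0
    (right_mem_Icc.2 zero_le_one)

end ODE

end

/-! ### Conformal and infinitesimally conformal operators. -/

section Conformal

variable {V : Type*} [NormedAddCommGroup V] [InnerProductSpace ℝ V]

/-- The operator `k` preserves the subspace `E` and is conformal on it; the conformal factor is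
read off at `e₀`. -/
def IsConformalOn (E : Submodule ℝ V) (e₀ : V) (k : V →L[ℝ] V) : Prop :=
  ∀ e ∈ E, k e ∈ E ∧ ‖k e‖ ^ 2 = ‖k e₀‖ ^ 2 * ‖e‖ ^ 2

/-- The operator `A` preserves the subspace `E` and is an infinitesimal conformal map on it. -/
def IsInfConformalOn (E : Submodule ℝ V) (e₀ : V) (A : V →L[ℝ] V) : Prop :=
  ∀ e ∈ E, A e ∈ E ∧ inner ℝ (A e) e = inner ℝ (A e₀) e₀ * ‖e‖ ^ 2

variable {E : Submodule ℝ V} {e₀ : V}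

/-- Infinitesimal conformality is linear in the operator because the factor is written as the linear
functional `A ↦ ⟪A e₀, e₀⟫`. This and the next three lemmas allow averaging with a partition of
unity. -/
lemma IsInfConformalOn.zero : IsInfConformalOn E e₀ (0 : V →L[ℝ] V) :=
  fun e _ => ⟨by simp, by simp⟩

lemma IsInfConformalOn.add {A B : V →L[ℝ] V} (hA : IsInfConformalOn E e₀ A)
    (hB : IsInfConformalOn E e₀ B) : IsInfConformalOn E e₀ (A + B) := fun e he =>
  ⟨by simpa using E.add_mem (hA e he).1 (hB e he).1, by
    simp [inner_add_left, (hA e he).2, (hB e he).2, add_mul]⟩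

lemma IsInfConformalOn.smul {A : V →L[ℝ] V} (hA : IsInfConformalOn E e₀ A) (a : ℝ) :
    IsInfConformalOn E e₀ (a • A) := fun e he =>
  ⟨by simpa using E.smul_mem a (hA e he).1, by
    simp [inner_smul_left, (hA e he).2, mul_assoc]⟩

lemma IsInfConformalOn.sum {ι' : Type*} {A : ι' → V →L[ℝ] V} (s : Finset ι')
    (hA : ∀ i ∈ s, IsInfConformalOn E e₀ (A i)) : IsInfConformalOn E e₀ (∑ i ∈ s, A i) := by
  classical
  induction s using Finset.induction_on with
  | empty => simpa using IsInfConformalOn.zero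
  | insert i s hi ih =>
    rw [Finset.sum_insert hi]
    exact (hA i (by simp)).add (ih fun j hj => hA j (by simp [hj]))

/-- A linear equation on `[0, 1]` with bounded coefficients has no nonzero solution vanishing at
`0`. -/
lemma linear_ode_eq_zero {F : Type*} [NormedAddCommGroup F] [NormedSpace ℝ F]
    {B : ℝ → F →L[ℝ] F} (hB : ContinuousOn B (Icc 0 1)) {x : ℝ → F}
    (hx : ∀ t ∈ Icc (0 : ℝ) 1, HasDerivAt x (B t (x t)) t) (h0 : x 0 = 0) : x 1 = 0 := by
  obtain ⟨C, hC⟩ := isCompact_Icc.exists_bound_of_continuousOn hB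
  refine eq_zero_of_abs_deriv_le_mul_abs_self_of_eq_zero_right (K := C)
    (fun t ht => (hx t ht).continuousAt.continuousWithinAt)
    (fun t ht => (hx t (Ico_subset_Icc_self ht)).hasDerivWithinAt) h0 (fun t ht => ?_) 1
    (right_mem_Icc.2 zero_le_one)
  exact ((B t).le_opNorm _).trans
    (mul_le_mul_of_nonneg_right (hC t (Ico_subset_Icc_self ht)) (norm_nonneg _))

variable [FiniteDimensional ℝ V]

/-- The solution operators of linear equations with infinitesimally conformal coefficients are
conformal. -/
theorem isConformalOn_of_ode (he₀ : e₀ ∈ E) (he₀' : ‖e₀‖ = 1) {A κ : ℝ → V →L[ℝ] V}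
    (hA : ContinuousOn A (Icc 0 1)) (hAE : ∀ t ∈ Icc (0 : ℝ) 1, IsInfConformalOn E e₀ (A t))
    (hκ : ∀ t ∈ Icc (0 : ℝ) 1, HasDerivAt κ (A t ∘L κ t) t) (h0 : κ 0 = 1) :
    IsConformalOn E e₀ (κ 1) := by
  have hmem : ∀ e ∈ E, ∀ T ∈ Icc (0 : ℝ) 1, κ T e ∈ E := by
    intro e he T hT
    let P : V →L[ℝ] V := E.starProjection
    -- `Q` measures the departure from `E`. As `A` maps `E` to itself, `Q A = Q A Q`, so `Q κ e`
    -- solves a homogeneous linear equation with initial value `0`.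
    let Q : V →L[ℝ] V := 1 - P
    have hQ : ∀ v, Q v = 0 ↔ v ∈ E := fun v => by
      change v - E.starProjection v = 0 ↔ _
      rw [sub_eq_zero, eq_comm, Submodule.starProjection_eq_self_iff]
    have hd : ∀ t ∈ Icc (0 : ℝ) 1, HasDerivAt (fun t => Q (κ t e)) (Q (A t (κ t e))) t := by
      intro t ht
      have h1 : HasDerivAt (fun t => κ t e) (A t (κ t e)) t :=
        ((ContinuousLinearMap.apply ℝ V e).hasFDerivAt.comp_hasDerivAt t (hκ t ht))
      exact Q.hasFDerivAt.comp_hasDerivAt t h1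
    -- `linear_ode_eq_zero` speaks of time `1` only; rescaling time by `T` gives the other times.
    have hTt : ∀ t ∈ Icc (0 : ℝ) 1, T * t ∈ Icc (0 : ℝ) 1 := fun t ht =>
      ⟨mul_nonneg hT.1 ht.1, mul_le_one₀ hT.2 ht.1 ht.2⟩
    have := linear_ode_eq_zero (B := fun t => T • (Q ∘L A (T * t)))
      (x := fun t => Q (κ (T * t) e)) ?_ ?_ ?_
    · rw [mul_one] at this
      exact (hQ _).1 this
    · have h1 : ContinuousOn (fun t => A (T * t)) (Icc 0 1) := hA.comp (by fun_prop) hTt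
      have h2 : ContinuousOn (fun t => Q ∘L A (T * t)) (Icc 0 1) :=
        ((ContinuousLinearMap.compL ℝ V V V Q).continuous).comp_continuousOn h1
      exact h2.const_smul T
    · intro t ht
      have h2 := (hd (T * t) (hTt t ht)).scomp t ((hasDerivAt_id t).const_mul T)
      refine h2.congr_deriv ?_
      have h3 : Q (A (T * t) (P (κ (T * t) e))) = 0 :=
        (hQ _).2 (hAE _ (hTt t ht) _ (E.starProjection_apply_mem _)).1
      have h4 : κ (T * t) e = Q (κ (T * t) e) + P (κ (T * t) e) := by simp [Q]
      conv_lhs => rw [h4, map_add, map_add, h3, add_zero]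
      simp
    · simp [h0, hQ, he]
  intro e he
  refine ⟨hmem e he 1 (right_mem_Icc.2 zero_le_one), ?_⟩
  have hd : ∀ v ∈ E, ∀ t ∈ Icc (0 : ℝ) 1, HasDerivAt (fun t => ‖κ t v‖ ^ 2)
      (2 * (inner ℝ (A t e₀) e₀ * ‖κ t v‖ ^ 2)) t := by
    intro v hv t ht
    have h1 : HasDerivAt (fun t => κ t v) (A t (κ t v)) t :=
      ((ContinuousLinearMap.apply ℝ V v).hasFDerivAt.comp_hasDerivAt t (hκ t ht))
    refine h1.norm_sq.congr_deriv ?_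
    rw [real_inner_comm, (hAE t ht _ (hmem v hv t ht)).2]
  -- The functions `‖κ e‖²` and `‖κ e₀‖² ‖e‖²` solve the same scalar linear equation and agree at
  -- time `0`, where `κ = 1` and `‖e₀‖ = 1`.
  have := linear_ode_eq_zero (F := ℝ)
    (B := fun t => (2 * inner ℝ (A t e₀) e₀) • (1 : ℝ →L[ℝ] ℝ))
    (x := fun t => ‖κ t e‖ ^ 2 - ‖κ t e₀‖ ^ 2 * ‖e‖ ^ 2) ?_ ?_ ?_
  · simpa [sub_eq_zero] using this
  · have h1 : ContinuousOn (fun t => inner ℝ (A t e₀) e₀) (Icc 0 1) :=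
      ContinuousOn.inner (hA.clm_apply continuousOn_const) continuousOn_const
    have h2 : ContinuousOn (fun t => 2 * inner ℝ (A t e₀) e₀) (Icc 0 1) :=
      continuousOn_const.mul h1
    exact h2.smul (continuousOn_const (c := (1 : ℝ →L[ℝ] ℝ)))
  · intro t ht
    refine ((hd e he t ht).sub ((hd e₀ he₀ t ht).mul_const _)).congr_deriv ?_
    simp
    ring
  · simp [h0, he₀']

end Conformal

/-! ### The desingularized radial equation and its time-one map. -/

section Linearization

variable {c m : ℕ}

/-- Solutions of the equations `κ' = Θ(tκw, ς)(κw) ∘ κ`, `ς' = q(tκw, ς)(κw)`, `t ∈ [0, 1]`, with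
`κ(0) = 1`, `ς(0) = s`, for initial values `(w, s)` in an open set on which the time one map
`(w, s) ↦ (κ(1)w, ς(1))` is a diffeomorphism onto its image. -/
structure RadialFlow (Ω : Set (Euc c × Euc m))
    (Θ : Euc c × Euc m → Euc c →L[ℝ] Euc c →L[ℝ] Euc c) (q : Euc c × Euc m → Euc c →L[ℝ] Euc m) where
  κ : Euc c × Euc m → ℝ → Euc c →L[ℝ] Euc c
  ς : Euc c × Euc m → ℝ → Euc m
  D : OpenPartialHomeomorph (Euc c × Euc m) (Euc c × Euc m)
  contDiffOn : ContDiffOn ℝ ∞ D D.source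
  contDiffOn_symm : ContDiffOn ℝ ∞ D.symm D.target
  contDiffOn_κ : ContDiffOn ℝ ∞ (fun p => κ p 1) D.source
  apply_eq : ∀ p ∈ D.source, D p = (κ p 1 p.1, ς p 1)
  κ_zero : ∀ p ∈ D.source, κ p 0 = 1
  ς_zero : ∀ p ∈ D.source, ς p 0 = p.2
  isUnit : ∀ p ∈ D.source, ∀ t ∈ Icc (0 : ℝ) 1, IsUnit (κ p t)
  mem : ∀ p ∈ D.source, ∀ t ∈ Icc (0 : ℝ) 1, (t • κ p t p.1, ς p t) ∈ Ω
  hasDerivAt_κ : ∀ p ∈ D.source, ∀ t ∈ Icc (0 : ℝ) 1,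
    HasDerivAt (κ p) (Θ (t • κ p t p.1, ς p t) (κ p t p.1) ∘L κ p t) t
  hasDerivAt_ς : ∀ p ∈ D.source, ∀ t ∈ Icc (0 : ℝ) 1,
    HasDerivAt (ς p) (q (t • κ p t p.1, ς p t) (κ p t p.1)) t
  eventually_mem : ∀ s, ((0 : Euc c), s) ∈ D.source → ∀ V ∈ 𝓝 ((1 : Euc c →L[ℝ] Euc c), s),
    ∀ᶠ p in 𝓝 ((0 : Euc c), s), ∀ t ∈ Icc (0 : ℝ) 1, (κ p t, ς p t) ∈ V

variable {Ω : Set (Euc c × Euc m)}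
    {Θ : Euc c × Euc m → Euc c →L[ℝ] Euc c →L[ℝ] Euc c} {q : Euc c × Euc m → Euc c →L[ℝ] Euc m}

-- Take `(κ, ς)` as the unknown and `w` as the parameter. Since `t κ w = κ (t w)`, the system has
-- the form `z' = L(z, t w) w` of `exists_smooth_solution`.
set_option synthInstance.maxHeartbeats 200000 in
set_option maxHeartbeats 1000000 in
theorem exists_radialFlow (hΩ : IsOpen Ω) (hΘ : ContDiffOn ℝ ∞ Θ Ω) (hq : ContDiffOn ℝ ∞ q Ω)
    {s₀ : Euc m} (hs₀ : (0, s₀) ∈ Ω) :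
    ∃ R : RadialFlow Ω Θ q, (0, s₀) ∈ R.D.source := by
  let j : ((Euc c →L[ℝ] Euc c) × Euc m) × Euc c → Euc c × Euc m := fun a => (a.1.1 a.2, a.1.2)
  have hj : ContDiff ℝ ∞ j :=
    ((contDiff_fst.fst).clm_apply contDiff_snd).prodMk contDiff_fst.snd
  -- Requiring `κ` to be a unit in the domain of the equation makes invertibility at all times part
  -- of the existence statement.
  let Ω' : Set (((Euc c →L[ℝ] Euc c) × Euc m) × Euc c) := j ⁻¹' Ω ∩ (fun a : ((Euc c →L[ℝ] Euc c) × Euc m) × Euc c => a.1.1) ⁻¹' {k | IsUnit k}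
  have hΩ' : IsOpen Ω' := (hΩ.preimage hj.continuous).inter
    (Units.isOpen.preimage (by fun_prop))
  let L : ((Euc c →L[ℝ] Euc c) × Euc m) × Euc c → Euc c →L[ℝ] ((Euc c →L[ℝ] Euc c) × Euc m) := fun a =>
    ((((ContinuousLinearMap.compL ℝ (Euc c) (Euc c) (Euc c)).flip a.1.1) ∘L Θ (j a)) ∘L a.1.1).prod
      (q (j a) ∘L a.1.1)
  have hL : ContDiffOn ℝ ∞ L Ω' := by
    rw [contDiffOn_clm_apply]
    intro w
    have hΘ' : ContDiffOn ℝ ∞ (fun a => Θ (j a)) Ω' := hΘ.comp hj.contDiffOn fun a ha => ha.1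
    have hq' : ContDiffOn ℝ ∞ (fun a => q (j a)) Ω' := hq.comp hj.contDiffOn fun a ha => ha.1
    have hk : ContDiffOn ℝ ∞
        (fun a : ((Euc c →L[ℝ] Euc c) × Euc m) × Euc c => a.1.1) Ω' := contDiff_fst.fst.contDiffOn
    have hkw := hk.clm_apply (contDiffOn_const (c := w))
    exact ((hΘ'.clm_apply hkw).clm_comp hk).prodMk (hq'.clm_apply hkw)
  have hz₀ : (((1 : Euc c →L[ℝ] Euc c), s₀), (0 : Euc c)) ∈ Ω' := by
    refine ⟨?_, isUnit_one⟩
    simpa [j] using hs₀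
  obtain ⟨γ, B, hB, hB₀, hγ, hsol, hclose⟩ := exists_smooth_solution hΩ' L hL hz₀
  let i : Euc c × Euc m → Euc c × ((Euc c →L[ℝ] Euc c) × Euc m) := fun p => (p.1, (1, p.2))
  have hi : ContDiff ℝ ∞ i := contDiff_fst.prodMk (contDiff_const.prodMk contDiff_snd)
  have hγi : ContDiffOn ℝ ∞ (fun p => γ (i p) 1) (i ⁻¹' B) := hγ.comp hi.contDiffOn fun _ h => h
  let f : Euc c × Euc m → Euc c × Euc m := fun p => ((γ (i p) 1).1 p.1, (γ (i p) 1).2)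
  have hf : ContDiffOn ℝ ∞ f (i ⁻¹' B) :=
    (hγi.fst.clm_apply contDiff_fst.contDiffOn).prodMk hγi.snd
  have hB' : IsOpen (i ⁻¹' B) := hB.preimage hi.continuous
  have hclose' : ∀ s, ((0 : Euc c), s) ∈ i ⁻¹' B → ∀ V ∈ 𝓝 ((1 : Euc c →L[ℝ] Euc c), s),
      ∀ᶠ p in 𝓝 ((0 : Euc c), s), ∀ t ∈ Icc (0 : ℝ) 1, γ (i p) t ∈ V := fun s hs V hV =>
    (hi.continuous.tendsto ((0 : Euc c), s)).eventually (hclose (1, s) hs V hV)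
  -- Solutions near `w = 0` stay in any given neighborhood of `(1, s)`; the complement of a
  -- different end value would be such a neighborhood.
  have hrest : ∀ s, ((0 : Euc c), s) ∈ i ⁻¹' B → γ (i (0, s)) 1 = (1, s) := by
    intro s hs
    by_contra h
    exact (hclose' s hs {γ (i (0, s)) 1}ᶜ (isOpen_compl_singleton.mem_nhds (Ne.symm h))).self_of_nhds
      1 (right_mem_Icc.2 zero_le_one) rfl
  have hmem₀ : ((0 : Euc c), s₀) ∈ i ⁻¹' B := hB₀
  let g' : Euc c × Euc m →L[ℝ] ((Euc c →L[ℝ] Euc c) × Euc m) := fderiv ℝ (fun p => γ (i p) 1) (0, s₀)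
  have hg' : HasFDerivAt (fun p => γ (i p) 1) g' (0, s₀) :=
    ((hγi.contDiffAt (hB'.mem_nhds hmem₀)).differentiableAt (by simp)).hasFDerivAt
  let σ' : Euc c × Euc m →L[ℝ] Euc m := (ContinuousLinearMap.snd ℝ _ _).comp g'
  have hσ' : HasFDerivAt (fun p => (γ (i p) 1).2) σ' (0, s₀) := hg'.snd
  have hσ'inr : ∀ s, σ' (0, s) = s := by
    intro s
    have h1 : HasFDerivAt (fun s : Euc m => ((0 : Euc c), s)) (ContinuousLinearMap.inr ℝ (Euc c) (Euc m))
        s₀ := (ContinuousLinearMap.inr ℝ (Euc c) (Euc m)).hasFDerivAt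
    have h2 := HasFDerivAt.comp s₀ (f := fun s : Euc m => ((0 : Euc c), s)) hσ' h1
    have h3 : (fun s : Euc m => (γ (i (0, s)) 1).2) =ᶠ[𝓝 s₀] id := by
      have : Continuous fun s : Euc m => ((0 : Euc c), s) := by fun_prop
      filter_upwards [this.continuousAt (hB'.mem_nhds hmem₀)] with s hs
      simp [hrest s hs]
    have h4 := (hasFDerivAt_id (𝕜 := ℝ) s₀).congr_of_eventuallyEq h3
    exact DFunLike.congr_fun (h2.unique h4) s
  let T : Euc c →L[ℝ] Euc m := σ'.comp (ContinuousLinearMap.inl ℝ _ _)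
  have hσ'T : ∀ p, σ' p = T p.1 + p.2 := fun p => by
    have : p = (p.1, 0) + (0, p.2) := by simp
    conv_lhs => rw [this, map_add, hσ'inr]
    rfl
  -- At `w = 0` the derivative of `κ` is applied to `0` and `κ = 1`, so the time-one map has
  -- derivative `(w, s) ↦ (w, T w + s)`, a shear.
  let F' : (Euc c × Euc m) ≃L[ℝ] (Euc c × Euc m) :=
    ContinuousLinearEquiv.equivOfInverse
      ((ContinuousLinearMap.fst ℝ _ _).prod
        (T.comp (ContinuousLinearMap.fst ℝ _ _) + ContinuousLinearMap.snd ℝ _ _))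
      ((ContinuousLinearMap.fst ℝ _ _).prod
        (ContinuousLinearMap.snd ℝ _ _ - T.comp (ContinuousLinearMap.fst ℝ _ _)))
      (fun q => by simp) (fun q => by simp)
  have hd : HasFDerivAt f (F' : _ →L[ℝ] _) (0, s₀) := by
    have h1 := (hg'.fst.clm_apply (hasFDerivAt_fst (𝕜 := ℝ) (p := ((0 : Euc c), s₀)))).prodMk hσ'
    refine h1.congr_fderiv ?_
    refine ContinuousLinearMap.ext fun p => ?_
    have h2 := hσ'T p
    refine Prod.ext ?_ h2
    simp [hrest s₀ hmem₀, F']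
  obtain ⟨e, he, hmem, hsub, hsymm⟩ := exists_smooth_openPartialHomeomorph hB' hf hmem₀ F' hd
  have hef : (e : Euc c × Euc m → Euc c × Euc m) = f := funext he
  have hmemΩ : ∀ p ∈ e.source, ∀ t ∈ Icc (0 : ℝ) 1,
      ((γ (i p) t).1 (t • p.1), (γ (i p) t).2) = (t • (γ (i p) t).1 p.1, (γ (i p) t).2) :=
    fun p _ t _ => by rw [map_smul]
  refine ⟨⟨fun p t => (γ (i p) t).1, fun p t => (γ (i p) t).2, e, ?_, hsymm, ?_, ?_, ?_, ?_, ?_,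
    ?_, ?_, ?_, ?_⟩, hmem⟩
  · rw [hef]; exact hf.mono hsub
  · exact hγi.fst.mono hsub
  · intro p _; exact he p
  · intro p hp; exact congrArg Prod.fst (hsol _ (hsub hp)).1
  · intro p hp; exact congrArg Prod.snd (hsol _ (hsub hp)).1
  · intro p hp t ht; exact ((hsol _ (hsub hp)).2 t ht).1.2
  · intro p hp t ht
    rw [← hmemΩ p hp t ht]
    exact ((hsol _ (hsub hp)).2 t ht).1.1
  · intro p hp t ht
    have := ((hsol _ (hsub hp)).2 t ht).2.fst
    rw [← hmemΩ p hp t ht]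
    exact this
  · intro p hp t ht
    have := ((hsol _ (hsub hp)).2 t ht).2.snd
    rw [← hmemΩ p hp t ht]
    exact this
  · intro s hs V hV
    exact hclose' s (hsub hs) V hV

end Linearization

/-! ### Gluing germs along a closed set, and injectivity near it. -/

section Topology

variable {X T : Type*} [TopologicalSpace X]

/-- Maps defined near the points of a closed set whose germs along this set agree have a common
extension to a neighbourhood. -/
theorem exists_glue_germs [T2Space X] [ParacompactSpace X] [Nonempty T] {J : Type*} {Z : Set X}
    (hZ : IsClosed Z) (A : J → Set X) (hA : ∀ i, IsOpen (A i)) (hZA : Z ⊆ ⋃ i, A i) (f : J → X → T)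
    (hf : ∀ i j, ∀ z ∈ Z, z ∈ A i → z ∈ A j → f i =ᶠ[𝓝 z] f j) :
    ∃ F : X → T, ∀ i, ∀ z ∈ Z, z ∈ A i → F =ᶠ[𝓝 z] f i := by
  classical
  obtain ⟨v, hvo, hZv, hvf, hvA⟩ := precise_refinement_set hZ A hA hZA
  obtain ⟨v', hZv', hvo', hcl⟩ := exists_subset_iUnion_closure_subset hZ hvo
    (fun x _ => hvf.point_finite x) hZv
  have hlf : LocallyFinite fun i => closure (v' i) := hvf.subset hcl
  -- By local finiteness, any index available at a point near `z` is among the finitely many whose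
  -- closed set contains `z`, and the maps with those indices agree near `z`. Thus the choice of
  -- index, and the arbitrary value off the cover, do not affect the germ.
  refine ⟨fun x => if h : ∃ i, x ∈ closure (v' i) then f h.choose x
    else Classical.arbitrary T, ?_⟩
  intro i z hz hzi
  obtain ⟨i₁, hi₁⟩ := mem_iUnion.1 (hZv' hz)
  have h1 := hlf.eventually_subset (fun i => isClosed_closure) z
  have h2 : ∀ᶠ x in 𝓝 z, ∀ k ∈ {k | z ∈ closure (v' k)}, f k x = f i x := by
    rw [Filter.eventually_all_finite (hlf.point_finite z)]
    intro k hk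
    exact hf k i z hz (hvA k (hcl k hk)) hzi
  filter_upwards [h1, h2, (hvo' i₁).mem_nhds hi₁] with x hx1 hx2 hx3
  have hx : ∃ i, x ∈ closure (v' i) := ⟨i₁, subset_closure hx3⟩
  simp only [dif_pos hx]
  exact hx2 _ (hx1 hx.choose_spec)

/-- A map which is injective near each point of the image of `ι` and which remembers the point of
`Y` is injective near the image of `ι`. -/
theorem exists_isOpen_injOn [TopologicalSpace.MetrizableSpace X] {Y : Type*} [TopologicalSpace Y]
    {ι : Y → X} (hι : Continuous ι) (G : X → T) (pr : T → Y) (hπ : ∀ y, pr (G (ι y)) = y)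
    (hc : ∀ y, ContinuousAt (fun x => pr (G x)) (ι y)) (hinj : ∀ y, ∃ N ∈ 𝓝 (ι y), InjOn G N) :
    ∃ O : Set X, IsOpen O ∧ range ι ⊆ O ∧ InjOn G O := by
  let := TopologicalSpace.metrizableSpaceMetric X
  -- Points with the same value of `G` share the foot `ι (pr (G x))`. Both then lie in the larger of
  -- the two balls about this foot, on which `G` is injective.
  let O : Set X := {x | ∃ ρ : ℝ, InjOn G (Metric.ball (ι (pr (G x))) ρ) ∧
    dist x (ι (pr (G x))) < ρ}
  refine ⟨interior O, isOpen_interior, ?_, ?_⟩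
  · rintro _ ⟨y, rfl⟩
    rw [mem_interior_iff_mem_nhds]
    obtain ⟨N, hN, hGN⟩ := hinj y
    obtain ⟨ρ, hρ, hρN⟩ := Metric.mem_nhds_iff.1 hN
    have h1 : ContinuousAt (fun x => ι (pr (G x))) (ι y) := hι.continuousAt.comp (hc y)
    have h2 : ∀ᶠ x in 𝓝 (ι y), dist (ι (pr (G x))) (ι y) < ρ / 4 := by
      have := h1 (Metric.ball_mem_nhds _ (show 0 < ρ / 4 by linarith))
      simp only [hπ] at this
      exact this
    filter_upwards [h2, Metric.ball_mem_nhds (ι y) (show 0 < ρ / 4 by linarith)] with x hx1 hx2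
    refine ⟨ρ / 2, hGN.mono fun z hz => hρN ?_, ?_⟩
    · rw [Metric.mem_ball] at hz ⊢
      have := dist_triangle z (ι (pr (G x))) (ι y)
      linarith
    · rw [Metric.mem_ball] at hx2
      have := dist_triangle_right x (ι (pr (G x))) (ι y)
      linarith
  · intro x hx x' hx' h
    obtain ⟨ρ, hρ, hxρ⟩ := interior_subset hx
    obtain ⟨ρ', hρ', hxρ'⟩ := interior_subset hx'
    rw [← h] at hρ' hxρ'
    rcases le_total ρ ρ' with hle | hle
    · exact hρ' (Metric.mem_ball.2 (hxρ.trans_le hle)) (Metric.mem_ball.2 hxρ') h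
    · exact hρ (Metric.mem_ball.2 hxρ) (Metric.mem_ball.2 (hxρ'.trans_le hle)) h

end Topology

/-! ### Coordinates on the normal bundle induced by a chart. -/

section ChartTrivialization

variable {c m : ℕ} {X Y : Type*}
  [TopologicalSpace X] [ChartedSpace (Euc (c + m)) X]
  [TopologicalSpace Y] [ChartedSpace (Euc m) Y] {ι : Y → X}
  [IsManifold (𝓡 m) ∞ Y] [IsManifold (𝓡 (c + m)) ∞ X] [hι : IsClosedSubmanifold c m ι]
  {φ φ' : OpenPartialHomeomorph X (Euc c × Euc m)}

/-- The local trivialization of the normal bundle induced by a chart. -/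
def chartTrivialization (φ : OpenPartialHomeomorph X (Euc c × Euc m)) (hφ : IsChartFor c m ι φ) :
    Trivialization (Euc c) (π (Euc c) (NormalFiber c m ι)) :=
  (normalPrebundle c m ι).trivializationOfMemPretrivializationAtlas
    (e := chartPretriv φ hφ) ⟨φ, hφ, rfl⟩

instance (hφ : IsChartFor c m ι φ) : MemTrivializationAtlas (chartTrivialization φ hφ) :=
  ⟨chartPretriv φ hφ, ⟨φ, hφ, rfl⟩, rfl⟩

lemma contMDiffWithinAt_normal_iff {EM HM M : Type*} [NormedAddCommGroup EM] [NormedSpace ℝ EM]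
    [TopologicalSpace HM] {IM : ModelWithCorners ℝ EM HM} [TopologicalSpace M] [ChartedSpace HM M]
    (hφ : IsChartFor c m ι φ) {f : M → TotalSpace (Euc c) (NormalFiber c m ι)} {s : Set M} {x : M}
    (hx : ι (f x).1 ∈ φ.source) :
    ContMDiffWithinAt IM ((𝓡 m).prod 𝓘(ℝ, Euc c)) ∞ f s x ↔
      ContMDiffWithinAt IM (𝓡 m) ∞ (fun z => (f z).1) s x ∧
        ContMDiffWithinAt IM 𝓘(ℝ, Euc c) ∞ (fun z => normalCoord φ (f z).1 (f z).2) s x :=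
  (chartTrivialization φ hφ).contMDiffWithinAt_iff (x₀ := x) (f := f) hx

lemma contMDiffOn_normalCoord (hφ : IsChartFor c m ι φ) :
    ContMDiffOn ((𝓡 m).prod 𝓘(ℝ, Euc c)) 𝓘(ℝ, Euc c) ∞
      (fun v : TotalSpace (Euc c) (NormalFiber c m ι) => normalCoord φ v.1 v.2)
      (π (Euc c) (NormalFiber c m ι) ⁻¹' (ι ⁻¹' φ.source)) := fun _ hv =>
  ((contMDiffWithinAt_normal_iff (f := id) hφ hv).1 contMDiffWithinAt_id).2

lemma chart_symm_mem_range (hφ : IsChartFor c m ι φ) {s : Euc m} (hs : (0, s) ∈ φ.target) :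
    φ.symm (0, s) ∈ range ι := by
  rw [hφ.mem_iff _ (φ.map_target hs), φ.right_inv hs]

lemma chart_fst_eq_zero (hφ : IsChartFor c m ι φ) {y : Y} (hy : ι y ∈ φ.source) :
    (φ (ι y)).1 = 0 := (hφ.mem_iff _ hy).1 ⟨y, rfl⟩

lemma chart_eq (hφ : IsChartFor c m ι φ) {y : Y} (hy : ι y ∈ φ.source) :
    φ (ι y) = (0, (φ (ι y)).2) := Prod.ext (chart_fst_eq_zero hφ hy) rfl

lemma IsClosedSubmanifold.contMDiff : ContMDiff (𝓡 m) (𝓡 (c + m)) ∞ ι :=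
  (IsClosedSubmanifold.isSmoothEmbedding (c := c) (m := m) (ι := ι)).contMDiff

lemma normalCoord_add (hφ : IsChartFor c m ι φ) {y : Y} (hy : ι y ∈ φ.source)
    (w w' : NormalFiber c m ι y) :
    normalCoord φ y (w + w') = normalCoord φ y w + normalCoord φ y w' :=
  (((normalPrebundle c m ι).pretrivialization_linear' _ ⟨φ, hφ, rfl⟩).linear y hy).map_add w w'

lemma normalCoord_smul (hφ : IsChartFor c m ι φ) {y : Y} (hy : ι y ∈ φ.source)
    (a : ℝ) (w : NormalFiber c m ι y) :
    normalCoord φ y (a • w) = a • normalCoord φ y w :=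
  (((normalPrebundle c m ι).pretrivialization_linear' _ ⟨φ, hφ, rfl⟩).linear y hy).map_smul a w

/-- The normal coordinates of a chart at a point of its domain, as a linear isomorphism. -/
def normalCoordEquiv (hφ : IsChartFor c m ι φ) {y : Y} (hy : ι y ∈ φ.source) :
    NormalFiber c m ι y ≃ₗ[ℝ] Euc c where
  toFun := normalCoord φ y
  invFun := chartFrame c m ι φ y
  map_add' := normalCoord_add hφ hy
  map_smul' := normalCoord_smul hφ hy
  left_inv := chartFrame_normalCoord hφ hy
  right_inv := normalCoord_chartFrame hφ hy

lemma normalCoord_zero (hφ : IsChartFor c m ι φ) {y : Y} (hy : ι y ∈ φ.source) :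
    normalCoord φ y (0 : NormalFiber c m ι y) = 0 := map_zero (normalCoordEquiv hφ hy)

variable [Nonempty Y]

variable (ι) in
/-- The point of `Y` with coordinates `(0, s)` in the chart `φ`. -/
def footPoint (φ : OpenPartialHomeomorph X (Euc c × Euc m)) (s : Euc m) : Y :=
  Function.invFun ι (φ.symm (0, s))

lemma ι_footPoint (hφ : IsChartFor c m ι φ) {s : Euc m} (hs : (0, s) ∈ φ.target) :
    ι (footPoint ι φ s) = φ.symm (0, s) :=
  Function.invFun_eq (chart_symm_mem_range hφ hs)

lemma footPoint_chart (hφ : IsChartFor c m ι φ) {y : Y} (hy : ι y ∈ φ.source) :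
    footPoint ι φ (φ (ι y)).2 = y := by
  rw [footPoint, ← chart_eq hφ hy, φ.left_inv hy]
  exact Function.leftInverse_invFun hι.isSmoothEmbedding.isEmbedding.injective y

/-- Smoothness of a continuous map into `Y` can be tested after composition with the immersion `ι`,
where the map is `s ↦ φ.symm (0, s)`. Continuity follows since `ι` is an embedding. -/
lemma contMDiffAt_footPoint (hφ : IsChartFor c m ι φ) {s : Euc m} (hs : (0, s) ∈ φ.target) :
    ContMDiffAt 𝓘(ℝ, Euc m) (𝓡 m) ∞ (footPoint ι φ) s := by
  have hO : IsOpen {s : Euc m | ((0 : Euc c), s) ∈ φ.target} :=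
    φ.open_target.preimage (by fun_prop)
  have h1 : ContMDiffAt 𝓘(ℝ, Euc m) (𝓡 (c + m)) ∞ (fun s => ι (footPoint ι φ s)) s := by
    have h2 : ContMDiffOn 𝓘(ℝ, Euc m) (𝓡 (c + m)) ∞ (fun s : Euc m => φ.symm ((0 : Euc c), s))
        {s : Euc m | ((0 : Euc c), s) ∈ φ.target} :=
      hφ.contMDiffOn_symm.comp
        (contDiff_const.prodMk contDiff_id).contMDiff.contMDiffOn fun _ h => h
    refine (h2.contMDiffAt (hO.mem_nhds hs)).congr_of_eventuallyEq ?_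
    filter_upwards [hO.mem_nhds hs] with s hs using ι_footPoint hφ hs
  refine (ContMDiffAt.iff_comp_isImmersionAt (f := footPoint ι φ)
    (hι.isSmoothEmbedding.isImmersion.isImmersionAt _)).2 ⟨?_, h1⟩
  exact hι.isSmoothEmbedding.isEmbedding.isInducing.continuousAt_iff.2 h1.continuousAt

/-- The trivialization of the normal bundle induced by a chart `φ` for `Y`, with values in
`ℝᶜ × ℝᵐ`. -/
def normalChart (φ : OpenPartialHomeomorph X (Euc c × Euc m)) (hφ : IsChartFor c m ι φ) :
    OpenPartialHomeomorph (TotalSpace (Euc c) (NormalFiber c m ι)) (Euc c × Euc m) where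
  toFun v := (normalCoord φ v.1 v.2, (φ (ι v.1)).2)
  invFun p := ⟨footPoint ι φ p.2, chartFrame c m ι φ (footPoint ι φ p.2) p.1⟩
  source := π (Euc c) (NormalFiber c m ι) ⁻¹' (ι ⁻¹' φ.source)
  target := {p | (0, p.2) ∈ φ.target}
  map_source' v hv := by
    change (0, (φ (ι v.1)).2) ∈ φ.target
    rw [← chart_eq hφ hv]
    exact φ.map_source hv
  map_target' p hp := by
    change ι (footPoint ι φ p.2) ∈ φ.source
    rw [ι_footPoint hφ hp]
    exact φ.map_target hp
  left_inv' := by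
    rintro ⟨y, w⟩ hv
    change (⟨footPoint ι φ (φ (ι y)).2, chartFrame c m ι φ (footPoint ι φ (φ (ι y)).2)
      (normalCoord φ y w)⟩ : TotalSpace (Euc c) (NormalFiber c m ι)) = ⟨y, w⟩
    rw [footPoint_chart hφ hv]
    exact congrArg (TotalSpace.mk y) (chartFrame_normalCoord hφ hv w)
  right_inv' p hp := by
    have hp' : ι (footPoint ι φ p.2) ∈ φ.source := by
      rw [ι_footPoint hφ hp]
      exact φ.map_target hp
    refine Prod.ext (normalCoord_chartFrame hφ hp' p.1) ?_
    change (φ (ι (footPoint ι φ p.2))).2 = p.2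
    rw [ι_footPoint hφ hp, φ.right_inv hp]
  open_source := (φ.open_source.preimage hι.mdifferentiable.continuous).preimage
    (FiberBundle.continuous_proj (Euc c) (NormalFiber c m ι))
  open_target := φ.open_target.preimage (by fun_prop)
  continuousOn_toFun := by
    refine (contMDiffOn_normalCoord hφ).continuousOn.prodMk ?_
    refine continuous_snd.comp_continuousOn (φ.continuousOn.comp ?_ fun v hv => hv)
    exact (hι.mdifferentiable.continuous.comp
      (FiberBundle.continuous_proj (Euc c) (NormalFiber c m ι))).continuousOn
  continuousOn_invFun p hp := by
    refine ContMDiffWithinAt.continuousWithinAt (I := 𝓘(ℝ, Euc c × Euc m))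
      (I' := (𝓡 m).prod 𝓘(ℝ, Euc c)) (n := ∞) ?_
    have hp' : ∀ p : Euc c × Euc m, (0, p.2) ∈ φ.target → ι (footPoint ι φ p.2) ∈ φ.source := by
      intro p hp
      rw [ι_footPoint hφ hp]
      exact φ.map_target hp
    rw [contMDiffWithinAt_normal_iff hφ (hp' p hp)]
    constructor
    · exact ((contMDiffAt_footPoint hφ hp).comp p
        (contDiff_snd.contMDiff (𝕜 := ℝ) p)).contMDiffWithinAt
    · refine (contDiff_fst.contMDiff (𝕜 := ℝ) p).contMDiffWithinAt.congr (fun q hq => ?_) ?_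
      · exact normalCoord_chartFrame hφ (hp' q hq) q.1
      · exact normalCoord_chartFrame hφ (hp' p hp) p.1

lemma normalChart_apply (hφ : IsChartFor c m ι φ)
    (v : TotalSpace (Euc c) (NormalFiber c m ι)) :
    normalChart φ hφ v = (normalCoord φ v.1 v.2, (φ (ι v.1)).2) := rfl

lemma contMDiffOn_normalChart (hφ : IsChartFor c m ι φ) :
    ContMDiffOn ((𝓡 m).prod 𝓘(ℝ, Euc c)) 𝓘(ℝ, Euc c × Euc m) ∞
      (normalChart φ hφ) (normalChart φ hφ).source := by
  have h1 : ContMDiffOn ((𝓡 m).prod 𝓘(ℝ, Euc c)) 𝓘(ℝ, Euc m) ∞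
      (fun v : TotalSpace (Euc c) (NormalFiber c m ι) => (φ (ι v.1)).2)
      (normalChart φ hφ).source :=
    contDiff_snd.contMDiff.comp_contMDiffOn (hφ.contMDiffOn.comp
      ((IsClosedSubmanifold.contMDiff.comp (contMDiff_proj (NormalFiber c m ι))).contMDiffOn)
        fun v hv => hv)
  rw [← modelWithCornersSelf_prod, ← chartedSpaceSelf_prod]
  exact (contMDiffOn_normalCoord hφ).prodMk h1

lemma contMDiffOn_normalChart_symm (hφ : IsChartFor c m ι φ) :
    ContMDiffOn 𝓘(ℝ, Euc c × Euc m) ((𝓡 m).prod 𝓘(ℝ, Euc c)) ∞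
      (normalChart φ hφ).symm (normalChart φ hφ).target := by
  intro p hp
  rw [contMDiffWithinAt_normal_iff hφ ((normalChart φ hφ).map_target hp)]
  constructor
  · exact ((contMDiffAt_footPoint hφ hp).comp p
      (contDiff_snd.contMDiff (𝕜 := ℝ) p)).contMDiffWithinAt
  · refine (contDiff_fst.contMDiff (𝕜 := ℝ) p).contMDiffWithinAt.congr (fun q hq => ?_) ?_
    · exact (congrArg Prod.fst ((normalChart φ hφ).right_inv hq) :
        ((normalChart φ hφ) ((normalChart φ hφ).symm q)).1 = q.1)
    · exact (congrArg Prod.fst ((normalChart φ hφ).right_inv hp) :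
        ((normalChart φ hφ) ((normalChart φ hφ).symm p)).1 = p.1)

end ChartTrivialization

/-! ### The radial field of one chart seen in another. -/

section RadialPair

variable {c m : ℕ} {X Y : Type*}
  [TopologicalSpace X] [ChartedSpace (Euc (c + m)) X]
  [TopologicalSpace Y] [ChartedSpace (Euc m) Y] {ι : Y → X}
  [IsManifold (𝓡 m) ∞ Y] [IsManifold (𝓡 (c + m)) ∞ X] [hι : IsClosedSubmanifold c m ι]
  {α β : OpenPartialHomeomorph X (Euc c × Euc m)} {h : Euc c × Euc m → Euc c →L[ℝ] Euc c}

lemma contDiffOn_transition (hα : IsChartFor c m ι α) (hβ : IsChartFor c m ι β) :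
    ContDiffOn ℝ ∞ (β ∘ α.symm) (α.symm.trans β).source := by
  rw [← contMDiffOn_iff_contDiffOn]
  exact hβ.contMDiffOn.comp (hα.contMDiffOn_symm.mono fun p hp => hp.1) fun p hp => hp.2

lemma fderiv_transition_fst (hα : IsChartFor c m ι α) (hβ : IsChartFor c m ι β)
    (hh : ContDiffOn ℝ ∞ h (α.symm.trans β).source)
    (heq : ∀ p ∈ (α.symm.trans β).source, (β (α.symm p)).1 = h p p.1)
    {p : Euc c × Euc m} (hp : p ∈ (α.symm.trans β).source) (v : Euc c × Euc m) :
    (fderiv ℝ (β ∘ α.symm) p v).1 = fderiv ℝ h p v p.1 + h p v.1 := by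
  have hO := (α.symm.trans β).open_source.mem_nhds hp
  have h1 : HasFDerivAt (β ∘ α.symm) (fderiv ℝ (β ∘ α.symm) p) p :=
    (((contDiffOn_transition hα hβ).contDiffAt hO).differentiableAt (by simp)).hasFDerivAt
  have h2 : HasFDerivAt h (fderiv ℝ h p) p :=
    ((hh.contDiffAt hO).differentiableAt (by simp)).hasFDerivAt
  have h3 := h2.clm_apply (hasFDerivAt_fst (𝕜 := ℝ) (p := p))
  have h4 : (fun p => ((β ∘ α.symm) p).1) =ᶠ[𝓝 p] fun p => h p p.1 := by
    filter_upwards [hO] with q hq using heq q hq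
  have h5 := (h3.congr_of_eventuallyEq h4).unique h1.fst
  have h6 := DFunLike.congr_fun h5 v
  simp only [ContinuousLinearMap.coe_comp, Function.comp_apply, add_apply,
    ContinuousLinearMap.flip_apply, ContinuousLinearMap.coe_fst'] at h6
  rw [← h6, add_comm]

/-- Off `Y` the map `h` is not determined by the overlap map. On `Y` the term of the product rule
containing `Dh` is applied to `r = 0`, so `h` must be the transition map of the normal bundle. -/
lemma transition_eq_normalTransition (hα : IsChartFor c m ι α) (hβ : IsChartFor c m ι β)
    (hh : ContDiffOn ℝ ∞ h (α.symm.trans β).source)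
    (heq : ∀ p ∈ (α.symm.trans β).source, (β (α.symm p)).1 = h p p.1)
    {y : Y} (hyα : ι y ∈ α.source) (hyβ : ι y ∈ β.source) (r : Euc c) :
    h (α (ι y)) r = normalCoord β y (chartFrame c m ι α y r) := by
  rw [← normalTransition_apply hα hβ hyα hyβ]
  have hp : α (ι y) ∈ (α.symm.trans β).source := by
    refine ⟨α.map_source hyα, ?_⟩
    change α.symm (α (ι y)) ∈ β.source
    rwa [α.left_inv hyα]
  have := fderiv_transition_fst hα hβ hh heq hp (r, 0)
  rw [chart_fst_eq_zero hα hyα, map_zero, zero_add] at this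
  exact this.symm

/-- Compatibility of charts does not ask for `h` to be invertible. It is so on `Y`, being a
transition map there, and hence near `Y`; `unitSet` records where. -/
lemma isUnit_transition (hα : IsChartFor c m ι α) (hβ : IsChartFor c m ι β)
    (hh : ContDiffOn ℝ ∞ h (α.symm.trans β).source)
    (heq : ∀ p ∈ (α.symm.trans β).source, (β (α.symm p)).1 = h p p.1)
    {y : Y} (hyα : ι y ∈ α.source) (hyβ : ι y ∈ β.source) : IsUnit (h (α (ι y))) := by
  rw [ContinuousLinearMap.isUnit_iff_bijective]
  have : (h (α (ι y)) : Euc c → Euc c) =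
      (normalCoordEquiv hα hyα).symm.trans (normalCoordEquiv hβ hyβ) :=
    funext fun r => transition_eq_normalTransition hα hβ hh heq hyα hyβ r
  rw [this]
  exact LinearEquiv.bijective _

/-- The points of the domain of `β⁻¹` over the domain of `α` where the linear part `h` of the
overlap map `β ∘ α⁻¹` is invertible. -/
def unitSet (α β : OpenPartialHomeomorph X (Euc c × Euc m))
    (h : Euc c × Euc m → Euc c →L[ℝ] Euc c) : Set (Euc c × Euc m) :=
  (β.symm.trans α).source ∩ {p | IsUnit (h (α (β.symm p)))}

lemma transition_mem {p : Euc c × Euc m} (hp : p ∈ (β.symm.trans α).source) :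
    α (β.symm p) ∈ (α.symm.trans β).source := by
  refine ⟨α.map_source hp.2, ?_⟩
  change α.symm (α (β.symm p)) ∈ β.source
  rw [α.left_inv (x := β.symm p) hp.2]
  exact β.map_target hp.1

lemma isOpen_unitSet (hα : IsChartFor c m ι α) (hβ : IsChartFor c m ι β)
    (hh : ContDiffOn ℝ ∞ h (α.symm.trans β).source) : IsOpen (unitSet α β h) := by
  have h1 : ContinuousOn (fun p => h (α (β.symm p))) (β.symm.trans α).source :=
    hh.continuousOn.comp (contDiffOn_transition hβ hα).continuousOn fun p hp => transition_mem hp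
  exact h1.isOpen_inter_preimage (β.symm.trans α).open_source Units.isOpen

/-- The quadratic part of the normal component, in the chart `β`, of the radial vector field of the
chart `α`. -/
def pairTheta (α β : OpenPartialHomeomorph X (Euc c × Euc m))
    (h : Euc c × Euc m → Euc c →L[ℝ] Euc c) (p : Euc c × Euc m) : Euc c →L[ℝ] Euc c →L[ℝ] Euc c :=
  (ContinuousLinearMap.compL ℝ (Euc c) (Euc c) (Euc c)).flip (Ring.inverse (h (α (β.symm p)))) ∘L
    (fderiv ℝ h (α (β.symm p)) ∘L
      (ContinuousLinearMap.inl ℝ (Euc c) (Euc m) ∘L Ring.inverse (h (α (β.symm p)))))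

/-- The linear part of the tangential component, in the chart `β`, of the radial vector field of the
chart `α`. -/
def pairTangent (α β : OpenPartialHomeomorph X (Euc c × Euc m))
    (h : Euc c × Euc m → Euc c →L[ℝ] Euc c) (p : Euc c × Euc m) : Euc c →L[ℝ] Euc m :=
  ContinuousLinearMap.snd ℝ (Euc c) (Euc m) ∘L (fderiv ℝ (β ∘ α.symm) (α (β.symm p)) ∘L
      (ContinuousLinearMap.inl ℝ (Euc c) (Euc m) ∘L Ring.inverse (h (α (β.symm p)))))

lemma contDiffOn_inverse_transition (hα : IsChartFor c m ι α) (hβ : IsChartFor c m ι β)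
    (hh : ContDiffOn ℝ ∞ h (α.symm.trans β).source) :
    ContDiffOn ℝ ∞ (fun p => Ring.inverse (h (α (β.symm p)))) (unitSet α β h) := by
  have h1 : ContDiffOn ℝ ∞ (fun p => h (α (β.symm p))) (unitSet α β h) :=
    hh.comp ((contDiffOn_transition hβ hα).mono inter_subset_left) fun p hp => transition_mem hp.1
  intro p hp
  obtain ⟨u, hu⟩ := hp.2
  have h2 : ContDiffAt ℝ ∞ (Ring.inverse : (Euc c →L[ℝ] Euc c) → _) (h (α (β.symm p))) := by
    rw [← hu]
    exact contDiffAt_ringInverse ℝ u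
  exact h2.comp_contDiffWithinAt p (h1 p hp)

lemma contDiffOn_pairTheta (hα : IsChartFor c m ι α) (hβ : IsChartFor c m ι β)
    (hh : ContDiffOn ℝ ∞ h (α.symm.trans β).source) :
    ContDiffOn ℝ ∞ (pairTheta α β h) (unitSet α β h) := by
  have hi := contDiffOn_inverse_transition hα hβ hh
  have hd : ContDiffOn ℝ ∞ (fun p => fderiv ℝ h (α (β.symm p))) (unitSet α β h) :=
    (hh.fderiv_of_isOpen (m := ∞) (α.symm.trans β).open_source (by simp)).comp
      ((contDiffOn_transition hβ hα).mono inter_subset_left) fun p hp => transition_mem hp.1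
  rw [contDiffOn_clm_apply]
  intro u
  have h1 : ContDiffOn ℝ ∞ (fun p => ((Ring.inverse (h (α (β.symm p))) u, (0 : Euc m))))
      (unitSet α β h) := (hi.clm_apply contDiffOn_const).prodMk contDiffOn_const
  exact (hd.clm_apply h1).clm_comp hi

lemma contDiffOn_pairTangent (hα : IsChartFor c m ι α) (hβ : IsChartFor c m ι β)
    (hh : ContDiffOn ℝ ∞ h (α.symm.trans β).source) :
    ContDiffOn ℝ ∞ (pairTangent α β h) (unitSet α β h) := by
  have hi := contDiffOn_inverse_transition hα hβ hh
  have hd : ContDiffOn ℝ ∞ (fun p => fderiv ℝ (β ∘ α.symm) (α (β.symm p))) (unitSet α β h) :=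
    ((contDiffOn_transition hα hβ).fderiv_of_isOpen (m := ∞) (α.symm.trans β).open_source
      (by simp)).comp
      ((contDiffOn_transition hβ hα).mono inter_subset_left) fun p hp => transition_mem hp.1
  rw [contDiffOn_clm_apply]
  intro u
  have h1 : ContDiffOn ℝ ∞ (fun p => ((Ring.inverse (h (α (β.symm p))) u, (0 : Euc m))))
      (unitSet α β h) := (hi.clm_apply contDiffOn_const).prodMk contDiffOn_const
  exact (hd.clm_apply h1).snd

/-- The radial vector field of the chart `α` in the chart `β`. -/
lemma fderiv_transition_radial (hα : IsChartFor c m ι α) (hβ : IsChartFor c m ι β)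
    (hh : ContDiffOn ℝ ∞ h (α.symm.trans β).source)
    (heq : ∀ p ∈ (α.symm.trans β).source, (β (α.symm p)).1 = h p p.1)
    {p : Euc c × Euc m} (hp : p ∈ unitSet α β h) :
    fderiv ℝ (β ∘ α.symm) (α (β.symm p)) ((α (β.symm p)).1, 0) =
      (p.1 + pairTheta α β h p p.1 p.1, pairTangent α β h p p.1) := by
  have hpα := transition_mem hp.1
  -- The inverse of `h` recovers the normal coordinates in `α` from those in `β`, which expresses
  -- the field of `α` through `p.1`.
  have h1 : p.1 = h (α (β.symm p)) (α (β.symm p)).1 := by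
    rw [← heq _ hpα, α.left_inv (x := β.symm p) hp.1.2, β.right_inv hp.1.1]
  have h2 : Ring.inverse (h (α (β.symm p))) p.1 = (α (β.symm p)).1 := by
    have h3 := Ring.inverse_mul_cancel _ hp.2
    conv_lhs => rw [h1]
    exact DFunLike.congr_fun h3 _
  refine Prod.ext ?_ ?_
  · rw [fderiv_transition_fst hα hβ hh heq hpα, ← h1, add_comm]
    simp [pairTheta, h2]
  · simp [pairTangent, h2]

/-- Differentiate the conditions `h e ∈ E` and `‖h e‖² = ‖h e₀‖² ‖e‖²` in the direction `(h⁻¹u, 0)`,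
and then replace `e` by `h⁻¹ e`. -/
lemma isInfConformalOn_pairTheta {E : Submodule ℝ (Euc c)} {e₀ : Euc c} (he₀ : e₀ ∈ E)
    (he₀' : ‖e₀‖ = 1) (hh : ContDiffOn ℝ ∞ h (α.symm.trans β).source)
    (hconf : ∀ p ∈ (α.symm.trans β).source, IsConformalOn E e₀ (h p))
    {p : Euc c × Euc m} (hp : p ∈ unitSet α β h) (u : Euc c) :
    IsInfConformalOn E e₀ (pairTheta α β h p u) := by
  have hpα := transition_mem hp.1
  have hO := (α.symm.trans β).open_source.mem_nhds hpα
  set a := α (β.symm p) with ha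
  set Hi := Ring.inverse (h a) with hHi
  have hHiH : ∀ v, h a (Hi v) = v := fun v =>
    DFunLike.congr_fun (Ring.mul_inverse_cancel _ hp.2) v
  have hHHi : ∀ v, Hi (h a v) = v := fun v =>
    DFunLike.congr_fun (Ring.inverse_mul_cancel _ hp.2) v
  have hinj : Function.Injective (h a) := fun v w hvw => by rw [← hHHi v, hvw, hHHi]
  have hHiE : ∀ e ∈ E, Hi e ∈ E := by
    intro e he
    -- An injective operator mapping the finite-dimensional space `E` into itself maps it onto
    -- itself, so the inverse preserves `E` too.
    have h1 : E.map (h a).toLinearMap = E := by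
      refine Submodule.eq_of_le_of_finrank_eq ?_ ?_
      · rintro _ ⟨v, hv, rfl⟩
        exact (hconf a hpα v hv).1
      · exact (Submodule.equivMapOfInjective _ hinj E).finrank_eq.symm
    rw [← h1] at he
    obtain ⟨v, hv, rfl⟩ := he
    change Hi (h a v) ∈ E
    rwa [hHHi]
  set v : Euc c × Euc m := (Hi u, 0) with hv
  have hd : HasFDerivAt h (fderiv ℝ h a) a :=
    ((hh.contDiffAt hO).differentiableAt (by simp)).hasFDerivAt
  have hde : ∀ e, HasFDerivAt (fun p => h p e) ((fderiv ℝ h a).flip e) a := fun e => by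
    simpa using hd.clm_apply (hasFDerivAt_const e a)
  have hdE : ∀ e ∈ E, fderiv ℝ h a v e ∈ E := by
    intro e he
    have hP : ∀ w : Euc c, w - E.starProjection w = 0 ↔ w ∈ E := fun w => by
      rw [sub_eq_zero, eq_comm, Submodule.starProjection_eq_self_iff]
    have h1 := ((1 : Euc c →L[ℝ] Euc c) - E.starProjection).hasFDerivAt.comp a (hde e)
    have h2 : (((1 : Euc c →L[ℝ] Euc c) - E.starProjection) ∘ fun p => h p e) =ᶠ[𝓝 a]
        fun _ => 0 := by
      filter_upwards [hO] with q hq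
      exact (hP _).2 (hconf q hq e he).1
    have h3 := ((hasFDerivAt_const (0 : Euc c) a).congr_of_eventuallyEq h2).unique h1
    exact (hP _).1 (DFunLike.congr_fun h3 v).symm
  have hsq : ∀ e ∈ E, inner ℝ (h a e) (fderiv ℝ h a v e) =
      inner ℝ (h a e₀) (fderiv ℝ h a v e₀) * ‖e‖ ^ 2 := by
    intro e he
    have h1 := (hde e).norm_sq
    have h2 := ((hde e₀).norm_sq).mul_const (‖e‖ ^ 2)
    have h3 : (fun p => ‖h p e‖ ^ 2) =ᶠ[𝓝 a] fun p => ‖h p e₀‖ ^ 2 * ‖e‖ ^ 2 := by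
      filter_upwards [hO] with q hq using (hconf q hq e he).2
    have h4 := DFunLike.congr_fun ((h2.congr_of_eventuallyEq h3).unique h1) v
    simp at h4
    linarith
  have hn : ∀ e ∈ E, ‖e‖ ^ 2 = ‖h a e₀‖ ^ 2 * ‖Hi e‖ ^ 2 := fun e he => by
    rw [← (hconf a hpα _ (hHiE e he)).2, hHiH]
  have hval : ∀ e, pairTheta α β h p u e = fderiv ℝ h a v (Hi e) := fun e => rfl
  have hin : ∀ e ∈ E, inner ℝ (fderiv ℝ h a v (Hi e)) e =
      inner ℝ (h a e₀) (fderiv ℝ h a v e₀) * ‖Hi e‖ ^ 2 := fun e he => by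
    rw [← hsq _ (hHiE e he), hHiH, real_inner_comm]
  intro e he
  refine ⟨hdE _ (hHiE e he), ?_⟩
  rw [hval, hval, hin e he, hin e₀ he₀, hn e he]
  have h0 := hn e₀ he₀
  rw [he₀', one_pow] at h0
  linear_combination (-inner ℝ (h a e₀) (fderiv ℝ h a v e₀) * ‖Hi e‖ ^ 2) * (-1) * h0

end RadialPair

/-! ### The averaged radial field and its normal form. -/

section RadialField

variable {c m : ℕ} {X Y : Type*}
  [TopologicalSpace X] [ChartedSpace (Euc (c + m)) X]
  [TopologicalSpace Y] [ChartedSpace (Euc m) Y]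

/-- A choice of linear parts `h` of the overlap maps of a family of charts, conformal on `E`, and a
partition of unity near the submanifold subordinate to these charts. -/
structure AugData (ι : Y → X) (E : Submodule ℝ (Euc c)) (e₀ : Euc c)
    (𝒜 : Set (OpenPartialHomeomorph X (Euc c × Euc m))) where
  h : OpenPartialHomeomorph X (Euc c × Euc m) → OpenPartialHomeomorph X (Euc c × Euc m) →
    Euc c × Euc m → Euc c →L[ℝ] Euc c
  N : Set X
  χ : SmoothPartitionOfUnity 𝒜 (𝓡 (c + m)) X N
  e₀_mem : e₀ ∈ E
  norm_e₀ : ‖e₀‖ = 1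
  isChartFor : ∀ φ ∈ 𝒜, IsChartFor c m ι φ
  contDiffOn_h : ∀ φ ∈ 𝒜, ∀ φ' ∈ 𝒜, ContDiffOn ℝ ∞ (h φ φ') (φ'.symm.trans φ).source
  h_eq : ∀ φ ∈ 𝒜, ∀ φ' ∈ 𝒜, ∀ p ∈ (φ'.symm.trans φ).source, (φ (φ'.symm p)).1 = h φ φ' p p.1
  h_conf : ∀ φ ∈ 𝒜, ∀ φ' ∈ 𝒜, ∀ p ∈ (φ'.symm.trans φ).source, IsConformalOn E e₀ (h φ φ' p)
  mem_nhds : ∀ y, N ∈ 𝓝 (ι y)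
  subordinate : χ.IsSubordinate fun α => α.1.source

variable {ι : Y → X} {E : Submodule ℝ (Euc c)} {e₀ : Euc c}
  {𝒜 : Set (OpenPartialHomeomorph X (Euc c × Euc m))} (d : AugData ι E e₀ 𝒜)
  {β β' : OpenPartialHomeomorph X (Euc c × Euc m)}

namespace AugData

/-- The average of the quadratic parts of the radial vector fields, in the chart `β`. -/
def theta (β : OpenPartialHomeomorph X (Euc c × Euc m)) (p : Euc c × Euc m) :
    Euc c →L[ℝ] Euc c →L[ℝ] Euc c :=
  ∑ᶠ α : 𝒜, d.χ α (β.symm p) • pairTheta α.1 β (d.h β α) p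

/-- The average of the tangential parts of the radial vector fields, in the chart `β`. -/
def tangent (β : OpenPartialHomeomorph X (Euc c × Euc m)) (p : Euc c × Euc m) :
    Euc c →L[ℝ] Euc m :=
  ∑ᶠ α : 𝒜, d.χ α (β.symm p) • pairTangent α.1 β (d.h β α) p

/-- The average of the radial vector fields, in the chart `β`. -/
def field (β : OpenPartialHomeomorph X (Euc c × Euc m)) (p : Euc c × Euc m) : Euc c × Euc m :=
  ∑ᶠ α : 𝒜, d.χ α (β.symm p) •
    fderiv ℝ (β ∘ α.1.symm) (α.1 (β.symm p)) ((α.1 (β.symm p)).1, 0)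

lemma mem_source_of_ne_zero {α : 𝒜} {x : X} (hx : d.χ α x ≠ 0) : x ∈ α.1.source :=
  d.subordinate α (subset_tsupport _ hx)

lemma finite_support {F : Type*} [AddCommGroup F] [Module ℝ F] (x : X) (v : 𝒜 → F) :
    Function.HasFiniteSupport fun α => d.χ α x • v α :=
  (d.χ.locallyFinite.point_finite x).subset fun α hα h0 => hα (by simp [h0])

variable [IsManifold (𝓡 m) ∞ Y] [IsManifold (𝓡 (c + m)) ∞ X] [hι : IsClosedSubmanifold c m ι]

/-- The chain rule applies to each summand with nonzero weight, that is, with the point in the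
domain of `α`: the local expressions describe a single vector field on `X`. -/
lemma field_transform (hβ : β ∈ 𝒜) (hβ' : β' ∈ 𝒜) {p : Euc c × Euc m}
    (hp : p ∈ (β.symm.trans β').source) :
    d.field β' (β' (β.symm p)) = fderiv ℝ (β' ∘ β.symm) p (d.field β p) := by
  have hx : β'.symm (β' (β.symm p)) = β.symm p := β'.left_inv (x := β.symm p) hp.2
  rw [field, field, map_finsum _ (d.finite_support _ _), hx]
  refine finsum_congr fun α => ?_
  rw [map_smul]
  by_cases h0 : d.χ α (β.symm p) = 0
  · rw [h0, zero_smul, zero_smul]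
  congr 1
  have hα := d.isChartFor α.1 α.2
  have hxα : β.symm p ∈ α.1.source := d.mem_source_of_ne_zero h0
  set a := α.1 (β.symm p) with ha
  have hasymm : α.1.symm a = β.symm p := α.1.left_inv (x := β.symm p) hxα
  have haβ : a ∈ (α.1.symm.trans β).source := transition_mem ⟨hp.1, hxα⟩
  have hβa : (β ∘ α.1.symm) a = p := by
    change β (α.1.symm a) = p
    rw [hasymm, β.right_inv hp.1]
  have h1 : DifferentiableAt ℝ (β ∘ α.1.symm) a :=
    ((contDiffOn_transition hα (d.isChartFor β hβ)).contDiffAt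
      ((α.1.symm.trans β).open_source.mem_nhds haβ)).differentiableAt (by simp)
  have h2 : DifferentiableAt ℝ (β' ∘ β.symm) ((β ∘ α.1.symm) a) := by
    rw [hβa]
    exact ((contDiffOn_transition (d.isChartFor β hβ) (d.isChartFor β' hβ')).contDiffAt
      ((β.symm.trans β').open_source.mem_nhds hp)).differentiableAt (by simp)
  have h3 := fderiv_comp a h2 h1
  have h4 : (β' ∘ β.symm) ∘ (β ∘ α.1.symm) =ᶠ[𝓝 a] β' ∘ α.1.symm := by
    filter_upwards [(α.1.symm.trans β).open_source.mem_nhds haβ] with q hq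
    change β' (β.symm (β (α.1.symm q))) = _
    rw [β.left_inv (x := α.1.symm q) hq.2]
    rfl
  rw [← h4.fderiv_eq, h3, hβa]
  rfl

/-- The points near which the averaged radial vector field has its normal form. -/
def good (β : OpenPartialHomeomorph X (Euc c × Euc m)) : Set (Euc c × Euc m) :=
  interior {p | p ∈ β.target ∧ ContDiffAt ℝ ∞ (d.theta β) p ∧ ContDiffAt ℝ ∞ (d.tangent β) p ∧
    d.field β p = (p.1 + d.theta β p p.1 p.1, d.tangent β p p.1) ∧
    ∀ u, IsInfConformalOn E e₀ (d.theta β p u)}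

lemma isOpen_good : IsOpen (d.good β) := isOpen_interior

lemma contDiffOn_theta : ContDiffOn ℝ ∞ (d.theta β) (d.good β) := fun _ hp =>
  (interior_subset hp).2.1.contDiffWithinAt

lemma contDiffOn_tangent : ContDiffOn ℝ ∞ (d.tangent β) (d.good β) := fun _ hp =>
  (interior_subset hp).2.2.1.contDiffWithinAt

lemma field_eq {p : Euc c × Euc m} (hp : p ∈ d.good β) :
    d.field β p = (p.1 + d.theta β p p.1 p.1, d.tangent β p p.1) := (interior_subset hp).2.2.2.1

lemma isInfConformalOn_theta {p : Euc c × Euc m} (hp : p ∈ d.good β) (u : Euc c) :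
    IsInfConformalOn E e₀ (d.theta β p u) := (interior_subset hp).2.2.2.2 u

/-- Near `ι y` only the finitely many `α` whose closed support contains `ι y` contribute, and their
`h` are invertible there. The sums are then finite and smooth. The weights add up to `1`, which
keeps the leading term `p.1`. -/
lemma mem_good (hβ : β ∈ 𝒜) {y : Y} (hy : ι y ∈ β.source) : β (ι y) ∈ d.good β := by
  classical
  have hβc := d.isChartFor β hβ
  rw [good, mem_interior_iff_mem_nhds]
  let s := d.χ.fintsupport (ι y)
  have hc : Filter.Tendsto β.symm (𝓝 (β (ι y))) (𝓝 (ι y)) := by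
    have := (β.symm.continuousAt (β.map_source hy)).tendsto
    rwa [β.left_inv hy] at this
  have h1 : ∀ᶠ p in 𝓝 (β (ι y)), d.χ.finsupport (β.symm p) ⊆ s :=
    hc.eventually (d.χ.eventually_finsupport_subset (ι y))
  have h2 : ∀ᶠ p in 𝓝 (β (ι y)), ∀ α ∈ s, p ∈ unitSet α.1 β (d.h β α) := by
    rw [Filter.eventually_all_finset]
    intro α hα
    have hα' := d.isChartFor α.1 α.2
    have hyα : ι y ∈ α.1.source :=
      d.subordinate α ((d.χ.mem_fintsupport_iff (ι y) α).1 hα)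
    refine (isOpen_unitSet hα' hβc (d.contDiffOn_h β hβ α.1 α.2)).mem_nhds ⟨⟨β.map_source hy, ?_⟩, ?_⟩
    · change β.symm (β (ι y)) ∈ α.1.source
      rwa [β.left_inv hy]
    · change IsUnit (d.h β α.1 (α.1 (β.symm (β (ι y)))))
      rw [β.left_inv hy]
      exact isUnit_transition hα' hβc (d.contDiffOn_h β hβ α.1 α.2) (d.h_eq β hβ α.1 α.2) hyα hy
  have h3 : ∀ᶠ p in 𝓝 (β (ι y)), β.symm p ∈ d.N := hc.eventually (d.mem_nhds y)
  have h4 : ∀ᶠ p in 𝓝 (β (ι y)), p ∈ β.target := β.open_target.mem_nhds (β.map_source hy)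
  have hsum : ∀ {F : Type} [NormedAddCommGroup F] [NormedSpace ℝ F]
      (v : 𝒜 → Euc c × Euc m → F) (p : Euc c × Euc m), d.χ.finsupport (β.symm p) ⊆ s →
      ∑ᶠ α : 𝒜, d.χ α (β.symm p) • v α p = ∑ α ∈ s, d.χ α (β.symm p) • v α p := by
    intro F _ _ v p hp
    refine finsum_eq_sum_of_support_subset _ fun α hα => hp ?_
    rw [d.χ.mem_finsupport]
    intro h0
    exact hα (by simp [h0])
  have hχ : ∀ α : 𝒜, ContDiffOn ℝ ∞ (fun p => d.χ α (β.symm p)) β.target := fun α => by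
    rw [← contMDiffOn_iff_contDiffOn]
    exact (d.χ α).contMDiff.comp_contMDiffOn hβc.contMDiffOn_symm
  have hcd : ∀ {F : Type} [NormedAddCommGroup F] [NormedSpace ℝ F]
      (v : 𝒜 → Euc c × Euc m → F), (∀ α ∈ s, ContDiffOn ℝ ∞ (v α) (unitSet α.1 β (d.h β α))) →
      ∀ᶠ p in 𝓝 (β (ι y)),
        ContDiffAt ℝ ∞ (fun p => ∑ᶠ α : 𝒜, d.χ α (β.symm p) • v α p) p := by
    intro F _ _ v hv
    filter_upwards [h1.eventually_nhds, h2, h4] with p hp1 hp2 hp4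
    have h5 : (fun p => ∑ᶠ α : 𝒜, d.χ α (β.symm p) • v α p) =ᶠ[𝓝 p]
        fun p => ∑ α ∈ s, d.χ α (β.symm p) • v α p := by
      filter_upwards [hp1] with q hq using hsum v q hq
    refine ContDiffAt.congr_of_eventuallyEq (ContDiffAt.sum fun α hα => ?_) h5
    exact ((hχ α).contDiffAt (β.open_target.mem_nhds hp4)).smul ((hv α hα).contDiffAt
      ((isOpen_unitSet (d.isChartFor α.1 α.2) hβc (d.contDiffOn_h β hβ α.1 α.2)).mem_nhds
        (hp2 α hα)))
  have h6 := hcd (fun α p => pairTheta α.1 β (d.h β α) p) fun α _ =>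
    contDiffOn_pairTheta (d.isChartFor α.1 α.2) hβc (d.contDiffOn_h β hβ α.1 α.2)
  have h7 := hcd (fun α p => pairTangent α.1 β (d.h β α) p) fun α _ =>
    contDiffOn_pairTangent (d.isChartFor α.1 α.2) hβc (d.contDiffOn_h β hβ α.1 α.2)
  filter_upwards [h1, h2, h3, h4, h6, h7] with p hp1 hp2 hp3 hp4 hp6 hp7
  have hθ : d.theta β p = ∑ α ∈ s, d.χ α (β.symm p) • pairTheta α.1 β (d.h β α) p :=
    hsum (fun α p => pairTheta α.1 β (d.h β α) p) p hp1
  have hτ : d.tangent β p = ∑ α ∈ s, d.χ α (β.symm p) • pairTangent α.1 β (d.h β α) p :=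
    hsum (fun α p => pairTangent α.1 β (d.h β α) p) p hp1
  refine ⟨hp4, hp6, hp7, ?_, ?_⟩
  · have hf : d.field β p = ∑ α ∈ s, d.χ α (β.symm p) •
        fderiv ℝ (β ∘ α.1.symm) (α.1 (β.symm p)) ((α.1 (β.symm p)).1, 0) :=
      hsum (fun α p => fderiv ℝ (β ∘ α.1.symm) (α.1 (β.symm p)) ((α.1 (β.symm p)).1, 0)) p hp1
    have hone : ∑ α ∈ s, d.χ α (β.symm p) = 1 := d.χ.sum_finsupport' (β.symm p) hp3 hp1
    rw [hf, hθ, hτ]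
    have : ∀ α ∈ s, d.χ α (β.symm p) •
        fderiv ℝ (β ∘ α.1.symm) (α.1 (β.symm p)) ((α.1 (β.symm p)).1, 0) =
        (d.χ α (β.symm p) • p.1 + d.χ α (β.symm p) • pairTheta α.1 β (d.h β α) p p.1 p.1,
          d.χ α (β.symm p) • pairTangent α.1 β (d.h β α) p p.1) := by
      intro α hα
      rw [fderiv_transition_radial (d.isChartFor α.1 α.2) hβc (d.contDiffOn_h β hβ α.1 α.2)
        (d.h_eq β hβ α.1 α.2) (hp2 α hα)]
      simp [smul_add]
    rw [Finset.sum_congr rfl this]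
    refine Prod.ext ?_ ?_
    · rw [Prod.fst_sum]
      simp only [Finset.sum_add_distrib, ← Finset.sum_smul, hone, one_smul]
      simp
    · rw [Prod.snd_sum]
      simp
  · intro u
    rw [hθ]
    have : (∑ α ∈ s, d.χ α (β.symm p) • pairTheta α.1 β (d.h β α) p) u =
        ∑ α ∈ s, d.χ α (β.symm p) • pairTheta α.1 β (d.h β α) p u := by
      simp
    rw [this]
    exact IsInfConformalOn.sum s fun α hα => (isInfConformalOn_pairTheta d.e₀_mem d.norm_e₀
      (d.contDiffOn_h β hβ α.1 α.2) (d.h_conf β hβ α.1 α.2) (hp2 α hα) u).smul _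

end AugData

/-- A `c₁`-augmented atlas has transition data and a subordinate partition of unity. -/
theorem IsAugmentedAtlas.exists_augData [T2Space X] [SecondCountableTopology X]
    [IsManifold (𝓡 m) ∞ Y] [IsManifold (𝓡 (c + m)) ∞ X] [hι : IsClosedSubmanifold c m ι]
    {c₁ : ℕ} (hc : c₁ < c) (h𝒜 : IsAugmentedAtlas ι c₁ 𝒜) :
    ∃ e₀, Nonempty (AugData ι (coordSubspace c c₁) e₀ 𝒜) := by
  classical
  have : LocallyCompactSpace X := Manifold.locallyCompact_of_finiteDimensional (𝓡 (c + m))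
  -- The last basis vector lies in the distinguished subspace because `c₁ ≤ c - 1`.
  let e₀ : Euc c := EuclideanSpace.single ⟨c - 1, by omega⟩ 1
  have he₀ : e₀ ∈ coordSubspace c c₁ := by
    intro i hi
    have : i ≠ ⟨c - 1, by omega⟩ := by
      intro h
      have h' := congrArg Fin.val h
      simp at h'
      omega
    simp [e₀, this]
  have he₀' : ‖e₀‖ = 1 := by simp [e₀]
  choose! h f hh hf hhf using h𝒜.compatible
  have hcov : IsOpen (⋃ φ ∈ 𝒜, φ.source) := isOpen_biUnion fun φ _ => φ.open_source
  -- The weights must add up to `1` on a neighborhood of `Y`, not just on `Y`, while partitions of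
  -- unity are taken over closed sets; `closure O` serves both needs.
  obtain ⟨O, hO, hYO, hOcl⟩ := normal_exists_closure_subset hι.isClosed_range hcov h𝒜.covers
  obtain ⟨χ, hχ⟩ := SmoothPartitionOfUnity.exists_isSubordinate (𝓡 (c + m))
    (isClosed_closure (s := O)) (fun α : 𝒜 => α.1.source) (fun α => α.1.open_source) (by
      intro x hx
      obtain ⟨φ, hφ, hxφ⟩ := mem_iUnion₂.1 (hOcl hx)
      exact mem_iUnion.2 ⟨⟨φ, hφ⟩, hxφ⟩)
  refine ⟨e₀, ⟨⟨h, closure O, χ, he₀, he₀', h𝒜.isChartFor, hh, ?_, ?_, ?_, hχ⟩⟩⟩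
  · intro φ hφ φ' hφ' p hp
    exact (hhf φ hφ φ' hφ' p hp).1
  · intro φ hφ φ' hφ' p hp e he
    have h1 := (hhf φ hφ φ' hφ' p hp).2.2
    refine ⟨(h1 e he).1, ?_⟩
    -- As `‖e₀‖ = 1`, the conformal factor `f` equals `‖h e₀‖²`.
    have h2 := (h1 e₀ he₀).2
    rw [he₀', one_pow, mul_one] at h2
    rw [(h1 e he).2, h2]
  · intro y
    exact Filter.mem_of_superset (hO.mem_nhds (hYO ⟨y, rfl⟩)) subset_closure

end RadialField

lemma hasDerivAt_prod_prod {E₁ E₂ E₃ E₄ : Type*} [NormedAddCommGroup E₁] [NormedSpace ℝ E₁]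
    [NormedAddCommGroup E₂] [NormedSpace ℝ E₂] [NormedAddCommGroup E₃] [NormedSpace ℝ E₃]
    [NormedAddCommGroup E₄] [NormedSpace ℝ E₄] {f₁ : ℝ → E₁} {f₂ : ℝ → E₂} {f₃ : ℝ → E₃}
    {f₄ : ℝ → E₄} {f₁' : E₁} {f₂' : E₂} {f₃' : E₃} {f₄' : E₄} {t : ℝ} (h₁ : HasDerivAt f₁ f₁' t)
    (h₂ : HasDerivAt f₂ f₂' t) (h₃ : HasDerivAt f₃ f₃' t) (h₄ : HasDerivAt f₄ f₄' t) :
    HasDerivAt (fun t => ((f₁ t, f₂ t), (f₃ t, f₄ t))) ((f₁', f₂'), (f₃', f₄')) t :=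
  (h₁.prodMk h₂).prodMk (h₃.prodMk h₄)

/-! ### Uniqueness for radial flows. -/

section FlowUniqueness

variable {c m : ℕ} {Ω : Set (Euc c × Euc m)}
  {Θ : Euc c × Euc m → Euc c →L[ℝ] Euc c →L[ℝ] Euc c} {q : Euc c × Euc m → Euc c →L[ℝ] Euc m}

namespace RadialFlow

variable (R R' : RadialFlow Ω Θ q) {s : Euc m}

/-- By `eventually_mem` the path starting at `w = 0` lies in every neighborhood of `(1, s)`, hence
is constant. -/
lemma apply_zero (hs : ((0 : Euc c), s) ∈ R.D.source) {t : ℝ} (ht : t ∈ Icc (0 : ℝ) 1) :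
    (R.κ (0, s) t, R.ς (0, s) t) = ((1 : Euc c →L[ℝ] Euc c), s) := by
  by_contra hne
  have h1 : {(R.κ (0, s) t, R.ς (0, s) t)}ᶜ ∈ 𝓝 ((1 : Euc c →L[ℝ] Euc c), s) :=
    isOpen_compl_singleton.mem_nhds fun h => hne (by rw [h])
  exact (R.eventually_mem s hs _ h1).self_of_nhds t ht rfl

lemma D_zero (hs : ((0 : Euc c), s) ∈ R.D.source) : R.D (0, s) = (0, s) := by
  have h := R.apply_zero hs (right_mem_Icc.2 zero_le_one)
  rw [R.apply_eq _ hs]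
  exact Prod.ext (map_zero _) (Prod.ext_iff.1 h).2

lemma zero_mem_target (hs : ((0 : Euc c), s) ∈ R.D.source) : ((0 : Euc c), s) ∈ R.D.target := by
  have := R.D.map_source hs
  rwa [R.D_zero hs] at this

lemma D_symm_zero (hs : ((0 : Euc c), s) ∈ R.D.source) : R.D.symm (0, s) = (0, s) := by
  have := R.D.left_inv hs
  rwa [R.D_zero hs] at this

/-- Compactness of `[0, 1]` turns a condition valid near the constant path at each time into one
valid at all times for small initial values. -/
lemma eventually_forall (hs : ((0 : Euc c), s) ∈ R.D.source)
    {P : (((Euc c →L[ℝ] Euc c) × Euc m) × Euc c) × ℝ → Prop}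
    (hP : ∀ t ∈ Icc (0 : ℝ) 1, ∀ᶠ z in 𝓝 (((((1 : Euc c →L[ℝ] Euc c), s), (0 : Euc c)), t)), P z) :
    ∀ᶠ p in 𝓝 ((0 : Euc c), s), ∀ t ∈ Icc (0 : ℝ) 1, P (((R.κ p t, R.ς p t), p.1), t) := by
  have h1 := isCompact_Icc.eventually_forall_of_forall_eventually (P := fun x t => P (x, t)) hP
  rw [nhds_prod_eq, Filter.eventually_prod_iff] at h1
  obtain ⟨A, hA, B, hB, hAB⟩ := h1
  filter_upwards [R.eventually_mem s hs _ hA, (continuous_fst.tendsto ((0 : Euc c), s)).eventually hB]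
    with p hp1 hp2 t ht
  exact hAB (hp1 t ht) hp2 t ht

lemma hasDerivAt_fst {p : Euc c × Euc m} (hp : p ∈ R.D.source) {t : ℝ} (ht : t ∈ Icc (0 : ℝ) 1) :
    HasDerivAt (fun t => R.κ p t p.1)
      (Θ (t • R.κ p t p.1, R.ς p t) (R.κ p t p.1) (R.κ p t p.1)) t :=
  (ContinuousLinearMap.apply ℝ (Euc c) p.1).hasFDerivAt.comp_hasDerivAt t (R.hasDerivAt_κ p hp t ht)

/-- The curve traced by a point under the radial flow. -/
def curve (p : Euc c × Euc m) (t : ℝ) : Euc c × Euc m := (t • R.κ p t p.1, R.ς p t)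

lemma hasDerivAt_curve {p : Euc c × Euc m} (hp : p ∈ R.D.source) {t : ℝ}
    (ht : t ∈ Icc (0 : ℝ) 1) :
    HasDerivAt (R.curve p) (R.κ p t p.1 + t • Θ (R.curve p t) (R.κ p t p.1) (R.κ p t p.1),
      q (R.curve p t) (R.κ p t p.1)) t := by
  refine HasDerivAt.prodMk ?_ (R.hasDerivAt_ς p hp t ht)
  refine ((hasDerivAt_id t).smul (R.hasDerivAt_fst hp ht)).congr_deriv ?_
  simp [curve, add_comm]

lemma curve_zero {p : Euc c × Euc m} (hp : p ∈ R.D.source) : R.curve p 0 = (0, p.2) := by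
  simp [curve, R.ς_zero p hp]

lemma curve_one {p : Euc c × Euc m} (hp : p ∈ R.D.source) : R.curve p 1 = R.D p := by
  simp [curve, R.apply_eq p hp]

/-- Two radial flows with the same data have the same linear part near the points where both are
defined. -/
theorem eventually_kappa_eq (hΩ : IsOpen Ω) (hΘ : ContDiffOn ℝ ∞ Θ Ω) (hq : ContDiffOn ℝ ∞ q Ω)
    (hs : ((0 : Euc c), s) ∈ R.D.source) (hs' : ((0 : Euc c), s) ∈ R'.D.source) :
    ∀ᶠ p in 𝓝 ((0 : Euc c), s), R.κ p 1 = R'.κ p 1 := by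
  -- Carrying `t w` and `w` along as state variables makes the equation autonomous and smooth at `w
  -- = 0`.
  let Xf : (Euc c × Euc c) × ((Euc c →L[ℝ] Euc c) × Euc m) → (Euc c × Euc c) × ((Euc c →L[ℝ] Euc c) × Euc m) := fun z =>
    ((z.1.2, 0), ((Θ (z.2.1 z.1.1, z.2.2) (z.2.1 z.1.2)) ∘L z.2.1,
      q (z.2.1 z.1.1, z.2.2) (z.2.1 z.1.2)))
  let a : (Euc c × Euc c) × ((Euc c →L[ℝ] Euc c) × Euc m) := ((0, 0), (1, s))
  have hsΩ : ((0 : Euc c), s) ∈ Ω := by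
    have := R.mem _ hs 0 (left_mem_Icc.2 zero_le_one)
    simpa [R.ς_zero _ hs] using this
  have hX : ContDiffAt ℝ 1 Xf a := by
    have hW : ContDiffAt ℝ 1 (fun z : (Euc c × Euc c) × ((Euc c →L[ℝ] Euc c) × Euc m) => (z.2.1 z.1.1, z.2.2)) a :=
      (contDiffAt_snd.fst.clm_apply contDiffAt_fst.fst).prodMk contDiffAt_snd.snd
    have ha : (a.2.1 a.1.1, a.2.2) = ((0 : Euc c), s) := by simp [a]
    have h1 : ContDiffAt ℝ 1 (fun z : (Euc c × Euc c) × ((Euc c →L[ℝ] Euc c) × Euc m) => Θ (z.2.1 z.1.1, z.2.2)) a := by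
      refine ContDiffAt.comp a (g := Θ) ?_ hW
      rw [ha]
      exact (hΘ.contDiffAt (hΩ.mem_nhds hsΩ)).of_le (by simp)
    have h2 : ContDiffAt ℝ 1 (fun z : (Euc c × Euc c) × ((Euc c →L[ℝ] Euc c) × Euc m) => q (z.2.1 z.1.1, z.2.2)) a := by
      refine ContDiffAt.comp a (g := q) ?_ hW
      rw [ha]
      exact (hq.contDiffAt (hΩ.mem_nhds hsΩ)).of_le (by simp)
    have h3 : ContDiffAt ℝ 1 (fun z : (Euc c × Euc c) × ((Euc c →L[ℝ] Euc c) × Euc m) => z.2.1 z.1.2) a :=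
      contDiffAt_snd.fst.clm_apply contDiffAt_fst.snd
    exact (contDiffAt_fst.snd.prodMk contDiffAt_const).prodMk
      (((h1.clm_apply h3).clm_comp contDiffAt_snd.fst).prodMk (h2.clm_apply h3))
  obtain ⟨N, hN, huniq⟩ := exists_nhds_solution_unique hX
  have hev : ∀ S : RadialFlow Ω Θ q, ((0 : Euc c), s) ∈ S.D.source →
      ∀ᶠ p in 𝓝 ((0 : Euc c), s), ∀ t ∈ Icc (0 : ℝ) 1,
        (((t • p.1, p.1), (S.κ p t, S.ς p t)) : (Euc c × Euc c) × ((Euc c →L[ℝ] Euc c) × Euc m)) ∈ N := by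
    intro S hS
    refine S.eventually_forall hS
      (P := fun z => (((z.2 • z.1.2, z.1.2), z.1.1) : (Euc c × Euc c) × ((Euc c →L[ℝ] Euc c) × Euc m)) ∈ N) fun t ht => ?_
    have hc : Continuous fun z : (((Euc c →L[ℝ] Euc c) × Euc m) × Euc c) × ℝ =>
        (((z.2 • z.1.2, z.1.2), z.1.1) : (Euc c × Euc c) × ((Euc c →L[ℝ] Euc c) × Euc m)) := by fun_prop
    refine (hc.tendsto _).eventually ?_
    simpa [a] using hN
  have hcurve : ∀ S : RadialFlow Ω Θ q, ∀ p ∈ S.D.source, ∀ t ∈ Icc (0 : ℝ) 1,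
      HasDerivAt (fun t => (((t • p.1, p.1), (S.κ p t, S.ς p t)) : (Euc c × Euc c) × ((Euc c →L[ℝ] Euc c) × Euc m)))
        (Xf ((t • p.1, p.1), (S.κ p t, S.ς p t))) t := by
    intro S p hp t ht
    have h1 := S.hasDerivAt_κ p hp t ht
    have h2 := S.hasDerivAt_ς p hp t ht
    have h3 : HasDerivAt (fun t : ℝ => t • p.1) p.1 t := by
      simpa using (hasDerivAt_id t).smul_const p.1
    have h4 := hasDerivAt_prod_prod h3 (hasDerivAt_const t p.1) h1 h2
    refine h4.congr_deriv ?_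
    simp only [Xf, map_smul]
  filter_upwards [hev R hs, hev R' hs', R.D.open_source.mem_nhds hs,
    R'.D.open_source.mem_nhds hs'] with p h1 h2 h3 h4
  have := huniq (fun t => ((t • p.1, p.1), (R.κ p t, R.ς p t)))
    (fun t => ((t • p.1, p.1), (R'.κ p t, R'.ς p t)))
    (fun t ht => (hcurve R p h3 t ht).continuousAt.continuousWithinAt)
    (fun t ht => (hcurve R' p h4 t ht).continuousAt.continuousWithinAt) h1 h2
    (fun t ht => hcurve R p h3 t (Ioo_subset_Icc_self ht))
    (fun t ht => hcurve R' p h4 t (Ioo_subset_Icc_self ht))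
    (by simp [R.κ_zero p h3, R'.κ_zero p h4, R.ς_zero p h3, R'.ς_zero p h4])
  exact congrArg (fun z => z.2.1) this

/-- A curve in the normal form of the radial vector field is traced by the radial flow. -/
theorem exists_nhds_curve_eq (hΩ : IsOpen Ω) (hΘ : ContDiffOn ℝ ∞ Θ Ω) (hq : ContDiffOn ℝ ∞ q Ω)
    (hs : ((0 : Euc c), s) ∈ R.D.source) :
    ∃ N ∈ 𝓝 (((0 : Euc c), (0 : Euc c)), s), ∀ᶠ p in 𝓝 ((0 : Euc c), s),
      ∀ (u : ℝ → Euc c) (γ : ℝ → Euc c × Euc m), ContinuousOn u (Icc 0 1) →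
        ContinuousOn γ (Icc 0 1) → (∀ t ∈ Icc (0 : ℝ) 1, (((γ t).1, u t), (γ t).2) ∈ N) →
        (∀ t ∈ Icc (0 : ℝ) 1, (γ t).1 = t • u t) → u 0 = p.1 → (γ 0).2 = p.2 →
        (∀ t ∈ Ioo (0 : ℝ) 1, HasDerivAt γ (u t + t • Θ (γ t) (u t) (u t), q (γ t) (u t)) t) →
        γ 1 = R.D p := by
  -- The state is `(x, u, s)` with `x = t u`. Writing `t Θ(u)u` as `Θ(u)x` removes the time from the
  -- equation.
  let Xf : (Euc c × Euc c) × Euc m → (Euc c × Euc c) × Euc m := fun z =>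
    ((z.1.2 + Θ (z.1.1, z.2) z.1.2 z.1.1, Θ (z.1.1, z.2) z.1.2 z.1.2), q (z.1.1, z.2) z.1.2)
  let a : (Euc c × Euc c) × Euc m := ((0, 0), s)
  have hsΩ : ((0 : Euc c), s) ∈ Ω := by
    have := R.mem _ hs 0 (left_mem_Icc.2 zero_le_one)
    simpa [R.ς_zero _ hs] using this
  have hX : ContDiffAt ℝ 1 Xf a := by
    have hW : ContDiffAt ℝ 1 (fun z : (Euc c × Euc c) × Euc m => (z.1.1, z.2)) a :=
      contDiffAt_fst.fst.prodMk contDiffAt_snd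
    have h1 : ContDiffAt ℝ 1 (fun z : (Euc c × Euc c) × Euc m => Θ (z.1.1, z.2)) a :=
      ContDiffAt.comp a (g := Θ) ((hΘ.contDiffAt (hΩ.mem_nhds hsΩ)).of_le (by simp)) hW
    have h2 : ContDiffAt ℝ 1 (fun z : (Euc c × Euc c) × Euc m => q (z.1.1, z.2)) a :=
      ContDiffAt.comp a (g := q) ((hq.contDiffAt (hΩ.mem_nhds hsΩ)).of_le (by simp)) hW
    have h3 : ContDiffAt ℝ 1 (fun z : (Euc c × Euc c) × Euc m => z.1.2) a := contDiffAt_fst.snd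
    exact ((h3.add ((h1.clm_apply h3).clm_apply contDiffAt_fst.fst)).prodMk
      ((h1.clm_apply h3).clm_apply h3)).prodMk (h2.clm_apply h3)
  obtain ⟨N, hN, huniq⟩ := exists_nhds_solution_unique hX
  refine ⟨N, hN, ?_⟩
  have hev : ∀ᶠ p in 𝓝 ((0 : Euc c), s), ∀ t ∈ Icc (0 : ℝ) 1,
        (((t • R.κ p t p.1, R.κ p t p.1), R.ς p t) : (Euc c × Euc c) × Euc m) ∈ N := by
    refine R.eventually_forall hs (P := fun z =>
      (((z.2 • z.1.1.1 z.1.2, z.1.1.1 z.1.2), z.1.1.2) : (Euc c × Euc c) × Euc m) ∈ N)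
        fun t ht => ?_
    have hc : Continuous fun z : (((Euc c →L[ℝ] Euc c) × Euc m) × Euc c) × ℝ =>
        (((z.2 • z.1.1.1 z.1.2, z.1.1.1 z.1.2), z.1.1.2) : (Euc c × Euc c) × Euc m) := by
      fun_prop
    refine (hc.tendsto _).eventually ?_
    simpa [a] using hN
  filter_upwards [hev, R.D.open_source.mem_nhds hs] with p h1 h3 u γ hu hγ hmem hγu hu0 hγ0 hd
  have hderiv : ∀ t ∈ Icc (0 : ℝ) 1, HasDerivAt
      (fun t => (((t • R.κ p t p.1, R.κ p t p.1), R.ς p t) : (Euc c × Euc c) × Euc m))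
      (Xf ((t • R.κ p t p.1, R.κ p t p.1), R.ς p t)) t := by
    intro t ht
    have h4 : HasDerivAt (fun t => t • R.κ p t p.1)
        (R.κ p t p.1 + t • Θ (R.curve p t) (R.κ p t p.1) (R.κ p t p.1)) t :=
      (ContinuousLinearMap.fst ℝ (Euc c) (Euc m)).hasFDerivAt.comp_hasDerivAt t (R.hasDerivAt_curve h3 ht)
    refine HasDerivAt.congr_deriv (HasDerivAt.prodMk (HasDerivAt.prodMk h4 (R.hasDerivAt_fst h3 ht))
      (R.hasDerivAt_ς p h3 t ht)) ?_
    simp [Xf, curve]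
  have hderiv' : ∀ t ∈ Ioo (0 : ℝ) 1, HasDerivAt
      (fun t => ((((γ t).1, u t), (γ t).2) : (Euc c × Euc c) × Euc m))
      (Xf (((γ t).1, u t), (γ t).2)) t := by
    intro t ht
    have hγt := hd t ht
    have hγ1 : HasDerivAt (fun t => (γ t).1) (u t + t • Θ (γ t) (u t) (u t)) t :=
      (ContinuousLinearMap.fst ℝ (Euc c) (Euc m)).hasFDerivAt.comp_hasDerivAt t hγt
    have hγ2 : HasDerivAt (fun t => (γ t).2) (q (γ t) (u t)) t :=
      (ContinuousLinearMap.snd ℝ (Euc c) (Euc m)).hasFDerivAt.comp_hasDerivAt t hγt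
    -- The curve `u` is only assumed continuous. For `t > 0` it equals `x / t`, and the equation for
    -- `x` then gives `u' = Θ(u)u`.
    have h5 : HasDerivAt u (Θ (γ t) (u t) (u t)) t := by
      have h6 : HasDerivAt (fun t => t⁻¹ • (γ t).1) (Θ (γ t) (u t) (u t)) t := by
        refine ((hasDerivAt_inv ht.1.ne').smul hγ1).congr_deriv ?_
        have ht0 := ht.1.ne'
        rw [hγu t (Ioo_subset_Icc_self ht), smul_add, smul_smul, smul_smul, inv_mul_cancel₀ ht0,
          one_smul, show -(t ^ 2)⁻¹ * t = -t⁻¹ by field_simp, neg_smul]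
        abel
      refine h6.congr_of_eventuallyEq ?_
      filter_upwards [isOpen_Ioo.mem_nhds ht] with r hr
      rw [hγu r (Ioo_subset_Icc_self hr), smul_smul, inv_mul_cancel₀ hr.1.ne', one_smul]
    refine HasDerivAt.congr_deriv (HasDerivAt.prodMk (HasDerivAt.prodMk hγ1 h5) hγ2) ?_
    have h8 : t • Θ (γ t) (u t) (u t) = Θ (γ t) (u t) (γ t).1 := by
      rw [hγu t (Ioo_subset_Icc_self ht), map_smul]
    rw [h8]
  have hγ10 : (γ 0).1 = 0 := by simpa using hγu 0 (left_mem_Icc.2 zero_le_one)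
  have := huniq (fun t => (((γ t).1, u t), (γ t).2))
    (fun t => ((t • R.κ p t p.1, R.κ p t p.1), R.ς p t))
    ((hγ.fst.prodMk hu).prodMk hγ.snd)
    (fun t ht => (hderiv t ht).continuousAt.continuousWithinAt) hmem h1 hderiv'
    (fun t ht => hderiv t (Ioo_subset_Icc_self ht))
    (by simp [R.κ_zero p h3, R.ς_zero p h3, hu0, hγ0, hγ10])
  simp only [one_smul, Prod.mk.injEq] at this
  rw [R.apply_eq p h3]
  exact Prod.ext this.1.1 this.2

end RadialFlow

end FlowUniqueness

/-! ### Independence of the linearization from the chart. -/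

section NormalForm

variable {c m : ℕ} {X Y : Type*}
  [TopologicalSpace X] [ChartedSpace (Euc (c + m)) X]
  [TopologicalSpace Y] [ChartedSpace (Euc m) Y] {ι : Y → X}
  [IsManifold (𝓡 m) ∞ Y] [IsManifold (𝓡 (c + m)) ∞ X] [hι : IsClosedSubmanifold c m ι]
  {E : Submodule ℝ (Euc c)} {e₀ : Euc c}
  {𝒜 : Set (OpenPartialHomeomorph X (Euc c × Euc m))} (d : AugData ι E e₀ 𝒜)
  {β β' : OpenPartialHomeomorph X (Euc c × Euc m)}

lemma mem_transition_source {y : Y} (hy : ι y ∈ β.source) (hy' : ι y ∈ β'.source) :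
    β (ι y) ∈ (β.symm.trans β').source := by
  refine ⟨β.map_source hy, ?_⟩
  change β.symm (β (ι y)) ∈ β'.source
  rwa [β.left_inv hy]

namespace AugData

/-- A radial flow in the chart `β`. -/
abbrev Flow (β : OpenPartialHomeomorph X (Euc c × Euc m)) : Type :=
  RadialFlow (d.good β) (d.theta β) (d.tangent β)

variable {d}

lemma exists_flow (hβ : β ∈ 𝒜) {y : Y} (hy : ι y ∈ β.source) :
    ∃ R : d.Flow β, β (ι y) ∈ R.D.source := by
  have h := d.mem_good hβ hy
  rw [chart_eq (d.isChartFor β hβ) hy] at h ⊢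
  exact exists_radialFlow d.isOpen_good d.contDiffOn_theta d.contDiffOn_tangent h

/-- The radial flows in two charts correspond to each other under the overlap map and its normal
derivative. -/
theorem flow_transition (hβ : β ∈ 𝒜) (hβ' : β' ∈ 𝒜) (R : d.Flow β) (R' : d.Flow β') {y : Y}
    (hy : ι y ∈ β.source) (hy' : ι y ∈ β'.source) (hs : β (ι y) ∈ R.D.source)
    (hs' : β' (ι y) ∈ R'.D.source) :
    ∀ᶠ p in 𝓝 (β (ι y)), β' (β.symm (R.D p)) =
      R'.D (d.h β' β (0, p.2) p.1, (β' (β.symm (0, p.2))).2) := by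
  have hβc := d.isChartFor β hβ
  have hβc' := d.isChartFor β' hβ'
  have hT := mem_transition_source hy hy'
  have hτy : (β' ∘ β.symm) (β (ι y)) = β' (ι y) := congrArg β' (β.left_inv hy)
  rw [chart_eq hβc hy] at hs hT hτy ⊢
  rw [chart_eq hβc' hy'] at hs' hτy
  set s := (β (ι y)).2
  set s' := (β' (ι y)).2
  set T := (β.symm.trans β').source
  have hTo : IsOpen T := (β.symm.trans β').open_source
  set τ : Euc c × Euc m → Euc c × Euc m := β' ∘ β.symm with hτ
  have hτs := contDiffOn_transition hβc hβc'
  set h := d.h β' β with hh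
  have hhs : ContDiffOn ℝ ∞ h T := d.contDiffOn_h β' hβ' β hβ
  obtain ⟨N, hN, hcurve⟩ := R'.exists_nhds_curve_eq d.isOpen_good d.contDiffOn_theta
    d.contDiffOn_tangent hs'
  have hτc : ContinuousAt τ (0, s) := (hτs.contDiffAt (hTo.mem_nhds hT)).continuousAt
  have hhc : ContinuousAt h (0, s) := (hhs.contDiffAt (hTo.mem_nhds hT)).continuousAt
  have hzero : Filter.Tendsto (fun p : Euc c × Euc m => ((0 : Euc c), p.2)) (𝓝 (0, s))
      (𝓝 (0, s)) := (by fun_prop : Continuous fun p : Euc c × Euc m => ((0 : Euc c), p.2)).tendsto _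
  have hhat : Filter.Tendsto (fun p : Euc c × Euc m => (h (0, p.2) p.1, (τ (0, p.2)).2))
      (𝓝 (0, s)) (𝓝 (0, s')) := by
    have h1 : Filter.Tendsto (fun p : Euc c × Euc m => h (0, p.2) p.1) (𝓝 (0, s))
        (𝓝 (h (0, s) 0)) :=
      (isBoundedBilinearMap_apply.continuous.tendsto (h (0, s), (0 : Euc c))).comp
        ((hhc.tendsto.comp hzero).prodMk_nhds (continuous_fst.tendsto _))
    have h2 : Filter.Tendsto (fun p : Euc c × Euc m => (τ (0, p.2)).2) (𝓝 (0, s))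
        (𝓝 (τ (0, s)).2) :=
      (continuous_snd.tendsto _).comp (hτc.tendsto.comp hzero)
    rw [map_zero] at h1
    rw [hτy] at h2
    exact h1.prodMk_nhds h2
  have hev := R.eventually_forall hs (P := fun z =>
    (z.2 • z.1.1.1 z.1.2, z.1.1.2) ∈ T ∧ τ (z.2 • z.1.1.1 z.1.2, z.1.1.2) ∈ d.good β' ∧
      (((τ (z.2 • z.1.1.1 z.1.2, z.1.1.2)).1, h (z.2 • z.1.1.1 z.1.2, z.1.1.2) (z.1.1.1 z.1.2)),
        (τ (z.2 • z.1.1.1 z.1.2, z.1.1.2)).2) ∈ N) (by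
    intro t ht
    have h1 : Filter.Tendsto (fun z : (((Euc c →L[ℝ] Euc c) × Euc m) × Euc c) × ℝ =>
        (z.2 • z.1.1.1 z.1.2, z.1.1.2)) (𝓝 ((((1, s), 0), t))) (𝓝 (0, s)) := by
      have h2 : Continuous (fun z : (((Euc c →L[ℝ] Euc c) × Euc m) × Euc c) × ℝ =>
        (z.2 • z.1.1.1 z.1.2, z.1.1.2)) := by fun_prop
      simpa using h2.tendsto (((1, s), 0), t)
    have h3 : Filter.Tendsto (fun z : (((Euc c →L[ℝ] Euc c) × Euc m) × Euc c) × ℝ =>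
        z.1.1.1 z.1.2) (𝓝 ((((1, s), 0), t))) (𝓝 0) := by
      have h2 : Continuous (fun z : (((Euc c →L[ℝ] Euc c) × Euc m) × Euc c) × ℝ =>
        z.1.1.1 z.1.2) := by fun_prop
      simpa using h2.tendsto (((1, s), 0), t)
    have h4 := hτc.tendsto.comp h1
    rw [hτy] at h4
    have h5 := (isBoundedBilinearMap_apply.continuous.tendsto (h (0, s), (0 : Euc c))).comp
      ((hhc.tendsto.comp h1).prodMk_nhds h3)
    change Filter.Tendsto _ _ (𝓝 (h (0, s) 0)) at h5
    rw [map_zero] at h5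
    have h6 := (((continuous_fst.tendsto _).comp h4).prodMk_nhds h5).prodMk_nhds
      ((continuous_snd.tendsto _).comp h4)
    have hg : ((0 : Euc c), s') ∈ d.good β' := by
      rw [← chart_eq hβc' hy']
      exact d.mem_good hβ' hy'
    filter_upwards [h1.eventually (hTo.mem_nhds hT), h4.eventually (d.isOpen_good.mem_nhds hg),
      h6.eventually hN] with z hz1 hz2 hz3
    exact ⟨hz1, hz2, hz3⟩)
  filter_upwards [hev, hhat.eventually hcurve, R.D.open_source.mem_nhds hs] with p h1 h2 hp
  have hRc : ∀ t ∈ Icc (0 : ℝ) 1, R.curve p t ∈ T ∧ τ (R.curve p t) ∈ d.good β' ∧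
      (((τ (R.curve p t)).1, h (R.curve p t) (R.κ p t p.1)), (τ (R.curve p t)).2) ∈ N := h1
  have hRcont : ContinuousOn (R.curve p) (Icc 0 1) := fun t ht =>
    (R.hasDerivAt_curve hp ht).continuousAt.continuousWithinAt
  have hκcont : ContinuousOn (fun t => R.κ p t p.1) (Icc 0 1) := fun t ht =>
    (R.hasDerivAt_fst hp ht).continuousAt.continuousWithinAt
  -- The image of a radial curve under the overlap map has normal part `h(γ)(t κ w) = t u` with `u =
  -- h(γ)(κ w)`. It is compared with the flow in `β'` having initial data `(h(0, s) w, s')`, where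
  -- `s'` is the tangential coordinate in `β'` of the point `(0, s)`.
  have h3 := h2 (fun t => h (R.curve p t) (R.κ p t p.1)) (fun t => τ (R.curve p t))
    ((hhs.continuousOn.comp hRcont fun t ht => (hRc t ht).1).clm_apply hκcont)
    (hτs.continuousOn.comp hRcont fun t ht => (hRc t ht).1) (fun t ht => (hRc t ht).2.2)
    ?_ ?_ ?_ ?_
  · simp only [R.curve_one hp] at h3
    exact h3
  · intro t ht
    have h4 := d.h_eq β' hβ' β hβ _ (hRc t ht).1
    change (β' (β.symm (R.curve p t))).1 = _
    rw [h4, ← map_smul]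
    rfl
  · simp [R.curve_zero hp, R.κ_zero p hp]
  · simp [R.curve_zero hp]
  · intro t ht
    have ht' := Ioo_subset_Icc_self ht
    obtain ⟨hT', hgood, -⟩ := hRc t ht'
    have h4 := R.hasDerivAt_curve hp ht'
    have h5 : HasFDerivAt τ (fderiv ℝ τ (R.curve p t)) (R.curve p t) :=
      ((hτs.contDiffAt (hTo.mem_nhds hT')).differentiableAt (by simp)).hasFDerivAt
    refine (h5.comp_hasDerivAt t h4).congr_deriv ?_
    have h6 : d.field β (R.curve p t) = t • (R.κ p t p.1 + t • d.theta β (R.curve p t)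
        (R.κ p t p.1) (R.κ p t p.1), d.tangent β (R.curve p t) (R.κ p t p.1)) := by
      rw [d.field_eq (p := R.curve p t) (R.mem p hp t ht')]
      simp [RadialFlow.curve]
    have h7 := d.field_transform hβ hβ' hT'
    change d.field β' (τ (R.curve p t)) = fderiv ℝ τ (R.curve p t) _ at h7
    rw [h6, map_smul, d.field_eq hgood] at h7
    have h8 : (τ (R.curve p t)).1 = t • h (R.curve p t) (R.κ p t p.1) := by
      have h4 := d.h_eq β' hβ' β hβ _ hT'
      change (β' (β.symm (R.curve p t))).1 = _
      rw [h4, ← map_smul]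
      rfl
    have h9 : ∀ u : Euc c, (t • u + d.theta β' (τ (R.curve p t)) (t • u) (t • u),
        d.tangent β' (τ (R.curve p t)) (t • u)) =
        t • (u + t • d.theta β' (τ (R.curve p t)) u u, d.tangent β' (τ (R.curve p t)) u) := by
      intro u
      simp
    rw [h8, h9] at h7
    -- Invariance of the averaged field gives the required equation multiplied by `t`, which is
    -- cancelled as `t > 0`.
    exact (smul_right_injective _ ht.1.ne' h7).symm

end AugData

/-- The formula matches the initial data in `AugData.flow_transition`, so the flows are intertwined
by the change of coordinates on the normal bundle. -/
lemma normalChart_transition [Nonempty Y] (hβ : IsChartFor c m ι β) (hβ' : IsChartFor c m ι β')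
    {h : Euc c × Euc m → Euc c →L[ℝ] Euc c}
    (hh : ContDiffOn ℝ ∞ h (β.symm.trans β').source)
    (heq : ∀ p ∈ (β.symm.trans β').source, (β' (β.symm p)).1 = h p p.1) {p : Euc c × Euc m}
    (hp : (0, p.2) ∈ (β.symm.trans β').source) :
    normalChart β' hβ' ((normalChart β hβ).symm p) =
      (h (0, p.2) p.1, (β' (β.symm (0, p.2))).2) := by
  have h1 : ι (footPoint ι β p.2) = β.symm (0, p.2) := ι_footPoint hβ hp.1
  have h2 : ι (footPoint ι β p.2) ∈ β.source := by
    rw [h1]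
    exact β.map_target hp.1
  have h3 : ι (footPoint ι β p.2) ∈ β'.source := by
    rw [h1]
    exact hp.2
  have h4 := transition_eq_normalTransition hβ hβ' hh heq h2 h3 p.1
  rw [h1, β.right_inv hp.1] at h4
  rw [h4, ← h1]
  rfl

/-! ### Local identifications of `X` with the normal bundle. -/

section ToNormal

variable [Nonempty Y]

/-- The local identification of `X` with the normal bundle determined by a radial flow. -/
def toNormal (hβ : IsChartFor c m ι β) (R : d.Flow β) :
    OpenPartialHomeomorph X (TotalSpace (Euc c) (NormalFiber c m ι)) :=
  (β.trans R.D.symm).trans (normalChart β hβ).symm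

variable {d} (hβ : IsChartFor c m ι β) (R : d.Flow β)

lemma toNormal_apply (x : X) :
    toNormal d hβ R x = (normalChart β hβ).symm (R.D.symm (β x)) := rfl

lemma mem_toNormal_source {x : X} (hx : x ∈ (toNormal d hβ R).source) :
    x ∈ β.source ∧ β x ∈ R.D.target ∧ R.D.symm (β x) ∈ (normalChart β hβ).target := by
  simpa [toNormal, and_assoc] using hx

lemma mem_toNormal_target {v : TotalSpace (Euc c) (NormalFiber c m ι)}
    (hv : v ∈ (toNormal d hβ R).target) :
    v ∈ (normalChart β hβ).source ∧ normalChart β hβ v ∈ R.D.source ∧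
      R.D (normalChart β hβ v) ∈ β.target := by
  simpa [toNormal, and_assoc] using hv

lemma toNormal_mem_source {y : Y} (hy : ι y ∈ β.source) (hs : β (ι y) ∈ R.D.source) :
    ι y ∈ (toNormal d hβ R).source := by
  have h0 : R.D.symm (β (ι y)) = β (ι y) := by
    rw [chart_eq hβ hy] at hs ⊢
    exact R.D_symm_zero hs
  have h1 : β (ι y) ∈ R.D.target := by
    rw [chart_eq hβ hy] at hs ⊢
    exact R.zero_mem_target hs
  have h2 : R.D.symm (β (ι y)) ∈ (normalChart β hβ).target := by
    rw [h0]
    change (0, (β (ι y)).2) ∈ β.target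
    rw [← chart_eq hβ hy]
    exact β.map_source hy
  simpa [toNormal, and_assoc] using ⟨hy, h1, h2⟩

lemma toNormal_ι {y : Y} (hy : ι y ∈ β.source) (hs : β (ι y) ∈ R.D.source) :
    toNormal d hβ R (ι y) = TotalSpace.mk' (Euc c) y 0 := by
  have h0 : R.D.symm (β (ι y)) = β (ι y) := by
    rw [chart_eq hβ hy] at hs ⊢
    exact R.D_symm_zero hs
  rw [toNormal_apply, h0]
  have h1 : normalChart β hβ (TotalSpace.mk' (Euc c) y 0) = β (ι y) := by
    rw [normalChart_apply, chart_eq hβ hy]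
    exact Prod.ext (normalCoord_zero hβ hy) rfl
  rw [← h1]
  exact (normalChart β hβ).left_inv hy

lemma contMDiffOn_toNormal : ContMDiffOn (𝓡 (c + m)) ((𝓡 m).prod 𝓘(ℝ, Euc c)) ∞
    (toNormal d hβ R) (toNormal d hβ R).source := by
  refine (contMDiffOn_normalChart_symm hβ).comp (R.contDiffOn_symm.contMDiffOn.comp
    (hβ.contMDiffOn.mono ?_) ?_) ?_
  · exact fun x hx => (mem_toNormal_source hβ R hx).1
  · exact fun x hx => (mem_toNormal_source hβ R hx).2.1
  · exact fun x hx => (mem_toNormal_source hβ R hx).2.2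

lemma contMDiffOn_toNormal_symm : ContMDiffOn ((𝓡 m).prod 𝓘(ℝ, Euc c)) (𝓡 (c + m)) ∞
    (toNormal d hβ R).symm (toNormal d hβ R).target := by
  refine hβ.contMDiffOn_symm.comp (R.contDiffOn.contMDiffOn.comp
    ((contMDiffOn_normalChart hβ).mono ?_) ?_) ?_
  · exact fun x hx => (mem_toNormal_target hβ R hx).1
  · exact fun x hx => (mem_toNormal_target hβ R hx).2.1
  · exact fun x hx => (mem_toNormal_target hβ R hx).2.2

lemma ι_toNormal_mem {x : X} (hx : x ∈ (toNormal d hβ R).source) :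
    ι (toNormal d hβ R x).1 ∈ β.source :=
  (normalChart β hβ).map_target (mem_toNormal_source hβ R hx).2.2

/-- The linear part of the normal coordinates in terms of a radial flow. -/
def linearPart (R : d.Flow β) (x : X) : Euc c →L[ℝ] Euc c := R.κ (R.D.symm (β x)) 1

/-- The normal part of the time-one map is `κ(1) w` by construction, with `w` the normal coordinate
of the image in the normal bundle. -/
lemma chart_fst_eq_linearPart {x : X} (hx : x ∈ (toNormal d hβ R).source) :
    (β x).1 = linearPart R x
      (normalCoord β (toNormal d hβ R x).1 (toNormal d hβ R x).2) := by
  obtain ⟨h1, h2, h3⟩ := mem_toNormal_source hβ R hx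
  have h4 : normalCoord β (toNormal d hβ R x).1 (toNormal d hβ R x).2 = (R.D.symm (β x)).1 :=
    (congrArg Prod.fst ((normalChart β hβ).right_inv h3) :
      (normalChart β hβ ((normalChart β hβ).symm (R.D.symm (β x)))).1 = _)
  rw [h4]
  have h5 := R.apply_eq _ (R.D.map_target h2)
  rw [R.D.right_inv h2] at h5
  exact congrArg Prod.fst h5

lemma contMDiffOn_linearPart : ContMDiffOn (𝓡 (c + m)) 𝓘(ℝ, Euc c →L[ℝ] Euc c) ∞
    (linearPart R) (toNormal d hβ R).source := by
  refine R.contDiffOn_κ.contMDiffOn.comp (R.contDiffOn_symm.contMDiffOn.comp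
    (hβ.contMDiffOn.mono ?_) ?_) ?_
  · exact fun x hx => (mem_toNormal_source hβ R hx).1
  · exact fun x hx => (mem_toNormal_source hβ R hx).2.1
  · exact fun x hx => R.D.map_target (mem_toNormal_source hβ R hx).2.1

lemma isUnit_linearPart {x : X} (hx : x ∈ (toNormal d hβ R).source) : IsUnit (linearPart R x) :=
  R.isUnit _ (R.D.map_target (mem_toNormal_source hβ R hx).2.1) 1 (right_mem_Icc.2 zero_le_one)

/-- Along a radial curve `κ` solves a linear equation whose coefficient is a value of `theta`, hence
infinitesimally conformal on `E`. -/
lemma isConformalOn_linearPart {x : X} (hx : x ∈ (toNormal d hβ R).source) :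
    IsConformalOn E e₀ (linearPart R x) := by
  have hp := R.D.map_target (mem_toNormal_source hβ R hx).2.1
  set p := R.D.symm (β x)
  have hRcont : ContinuousOn (R.curve p) (Icc 0 1) := fun t ht =>
    (R.hasDerivAt_curve hp ht).continuousAt.continuousWithinAt
  have hκcont : ContinuousOn (fun t => R.κ p t p.1) (Icc 0 1) := fun t ht =>
    (R.hasDerivAt_fst hp ht).continuousAt.continuousWithinAt
  exact isConformalOn_of_ode d.e₀_mem d.norm_e₀
    ((d.contDiffOn_theta.continuousOn.comp hRcont fun t ht => R.mem p hp t ht).clm_apply hκcont)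
    (fun t ht => d.isInfConformalOn_theta (R.mem p hp t ht) _)
    (fun t ht => R.hasDerivAt_κ p hp t ht) (R.κ_zero p hp)

/-- The differential of the local identification along the submanifold is the identity on normal
vectors. -/
lemma normalProj_mfderiv_toNormal_symm {y : Y} (hy : ι y ∈ β.source)
    (hs : β (ι y) ∈ R.D.source) (w : NormalFiber c m ι y) :
    normalProj c m ι y (mfderiv 𝓘(ℝ, ℝ) (𝓡 (c + m))
      (fun t : ℝ => (toNormal d hβ R).symm (TotalSpace.mk' (Euc c) y (t • w))) 0 (1 : ℝ)) = w := by
  set p := β (ι y) with hp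
  set r := normalCoord β y w with hr
  have hpβ : p ∈ β.target := β.map_source hy
  have hp0 : p = (0, p.2) := chart_eq hβ hy
  have hDp : R.D p = p := by
    rw [hp0] at hs ⊢
    exact R.D_zero hs
  have hNc : ∀ t : ℝ, normalChart β hβ (TotalSpace.mk' (Euc c) y (t • w)) = p + t • (r, 0) := by
    intro t
    rw [normalChart_apply]
    refine Prod.ext ?_ ?_
    · have h1 : p.1 = 0 := chart_fst_eq_zero hβ hy
      simp only [Prod.fst_add, Prod.smul_fst, h1, zero_add]
      exact normalCoord_smul hβ hy t w
    · simp [hp]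
  have hline : HasDerivAt (fun t : ℝ => p + t • ((r, 0) : Euc c × Euc m)) (r, 0) 0 := by
    simpa using ((hasDerivAt_id (0 : ℝ)).smul_const ((r, 0) : Euc c × Euc m)).const_add p
  have hD : HasFDerivAt R.D (fderiv ℝ R.D p) p :=
    ((R.contDiffOn.contDiffAt (R.D.open_source.mem_nhds hs)).differentiableAt
      (by simp)).hasFDerivAt
  have hDl : HasDerivAt (fun t : ℝ => R.D (p + t • (r, 0))) (fderiv ℝ R.D p (r, 0)) 0 := by
    refine HasFDerivAt.comp_hasDerivAt (l := R.D) 0 ?_ hline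
    simpa using hD
  -- Differentiating `κ(w, s) w` at `w = 0` leaves only `κ = 1` applied to `r`.
  have hfst : (fderiv ℝ R.D p (r, 0)).1 = r := by
    have hκ : HasFDerivAt (fun p => R.κ p 1) (fderiv ℝ (fun p => R.κ p 1) p) p :=
      ((R.contDiffOn_κ.contDiffAt (R.D.open_source.mem_nhds hs)).differentiableAt
        (by simp)).hasFDerivAt
    have h1 := hκ.clm_apply (hasFDerivAt_fst (𝕜 := ℝ) (p := p))
    have h2 : (fun p => (R.D p).1) =ᶠ[𝓝 p] fun p => R.κ p 1 p.1 := by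
      filter_upwards [R.D.open_source.mem_nhds hs] with z hz
      rw [R.apply_eq z hz]
    have h3 := DFunLike.congr_fun ((h1.congr_of_eventuallyEq h2).unique hD.fst) (r, 0)
    have h4 : R.κ p 1 = 1 := by
      rw [hp0] at hs ⊢
      exact congrArg Prod.fst (R.apply_zero hs (right_mem_Icc.2 zero_le_one))
    have h5 : p.1 = 0 := chart_fst_eq_zero hβ hy
    simp [h4, h5] at h3
    exact h3.symm
  have heq : (fun t : ℝ => (toNormal d hβ R).symm (TotalSpace.mk' (Euc c) y (t • w))) =
      fun t : ℝ => β.symm (R.D (p + t • (r, 0))) := by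
    funext t
    rw [← hNc t]
    rfl
  have hβs : MDifferentiableAt 𝓘(ℝ, Euc c × Euc m) (𝓡 (c + m)) β.symm p :=
    hβ.mdifferentiable.symm.mdifferentiableAt hpβ
  have hβ0 : HasMFDerivAt 𝓘(ℝ, Euc c × Euc m) (𝓡 (c + m)) β.symm
      (R.D (p + (0 : ℝ) • (r, 0)))
      (mfderiv 𝓘(ℝ, Euc c × Euc m) (𝓡 (c + m)) β.symm (R.D (p + (0 : ℝ) • (r, 0)))) := by
    rw [zero_smul, add_zero, hDp]
    exact hβs.hasMFDerivAt
  have hcomp := hβ0.comp (0 : ℝ) hDl.hasFDerivAt.hasMFDerivAt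
  have hm : (mfderiv 𝓘(ℝ, ℝ) (𝓡 (c + m))
      (fun t : ℝ => (toNormal d hβ R).symm (TotalSpace.mk' (Euc c) y (t • w))) 0 (1 : ℝ)) =
      (mfderiv 𝓘(ℝ, Euc c × Euc m) (𝓡 (c + m)) β.symm p (fderiv ℝ R.D p (r, 0)) :
        Euc (c + m)) := by
    rw [heq]
    have h1 : ∀ q, q = p → ∀ v, (mfderiv 𝓘(ℝ, Euc c × Euc m) (𝓡 (c + m)) β.symm q v :
        Euc (c + m)) = mfderiv 𝓘(ℝ, Euc c × Euc m) (𝓡 (c + m)) β.symm p v := by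
      rintro _ rfl _
      rfl
    refine (DFunLike.congr_fun hcomp.mfderiv (1 : ℝ)).trans ?_
    refine (h1 (R.D (p + (0 : ℝ) • (r, 0))) (by rw [zero_smul, add_zero, hDp]) _).trans ?_
    exact congrArg (mfderiv 𝓘(ℝ, Euc c × Euc m) (𝓡 (c + m)) β.symm p)
      (one_smul ℝ (fderiv ℝ R.D p (r, 0)))
  refine (normalCoordEquiv hβ hy).injective ((normalCoord_normalProj hβ hy _).trans ?_)
  refine (congrArg (fun v => (mfderiv (𝓡 (c + m)) 𝓘(ℝ, Euc c × Euc m) β (ι y) v :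
    Euc c × Euc m).1) hm).trans ?_
  refine (congrArg Prod.fst (mfderiv_apply_symm hβ hy _)).trans ?_
  exact hfst

lemma flow_symm_tendsto (hβ : IsChartFor c m ι β) (R : d.Flow β) {y : Y} (hy : ι y ∈ β.source) (hs : β (ι y) ∈ R.D.source) :
    Filter.Tendsto (fun x => R.D.symm (β x)) (𝓝 (ι y)) (𝓝 (β (ι y))) := by
  have h0 : R.D.symm (β (ι y)) = β (ι y) ∧ β (ι y) ∈ R.D.target := by
    rw [chart_eq hβ hy] at hs ⊢
    exact ⟨R.D_symm_zero hs, R.zero_mem_target hs⟩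
  have h2 := (R.D.symm.continuousAt h0.2).tendsto.comp (β.continuousAt hy).tendsto
  rw [h0.1] at h2
  exact h2

/-- The local identifications of `X` with the normal bundle given by two charts agree near the
submanifold. -/
theorem toNormal_eventuallyEq (hβ : β ∈ 𝒜) (hβ' : β' ∈ 𝒜) (R : d.Flow β) (R' : d.Flow β') {y : Y}
    (hy : ι y ∈ β.source) (hy' : ι y ∈ β'.source) (hs : β (ι y) ∈ R.D.source)
    (hs' : β' (ι y) ∈ R'.D.source) :
    toNormal d (d.isChartFor β hβ) R =ᶠ[𝓝 (ι y)] toNormal d (d.isChartFor β' hβ') R' := by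
  have hβc := d.isChartFor β hβ
  have hβc' := d.isChartFor β' hβ'
  have hsrc := toNormal_mem_source hβc R hy hs
  have hto := flow_symm_tendsto hβc R hy hs
  have hT : ∀ᶠ p in 𝓝 (β (ι y)), ((0 : Euc c), p.2) ∈ (β.symm.trans β').source := by
    have h1 : Continuous fun p : Euc c × Euc m => ((0 : Euc c), p.2) := by fun_prop
    refine (h1.tendsto _).eventually ((β.symm.trans β').open_source.mem_nhds ?_)
    rw [← chart_eq hβc hy]
    exact mem_transition_source hy hy'
  have hR' : ∀ᶠ p in 𝓝 (β (ι y)), normalChart β' hβc' ((normalChart β hβc).symm p) ∈ R'.D.source := by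
    have h1 : β (ι y) ∈ (normalChart β hβc).target := by
      change (0, (β (ι y)).2) ∈ β.target
      rw [← chart_eq hβc hy]
      exact β.map_source hy
    have h2 : (normalChart β hβc).symm (β (ι y)) = TotalSpace.mk' (Euc c) y 0 := by
      have h1 : normalChart β hβc (TotalSpace.mk' (Euc c) y 0) = β (ι y) := by
        rw [normalChart_apply, chart_eq hβc hy]
        exact Prod.ext (normalCoord_zero hβc hy) rfl
      rw [← h1]
      exact (normalChart β hβc).left_inv hy
    have h3 := ((normalChart β hβc).symm.continuousAt h1).tendsto
    rw [h2] at h3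
    have h4 := ((normalChart β' hβc').continuousAt (x := TotalSpace.mk' (Euc c) y 0) hy').tendsto
    have h5 : normalChart β' hβc' (TotalSpace.mk' (Euc c) y 0) = β' (ι y) := by
      rw [normalChart_apply, chart_eq hβc' hy']
      exact Prod.ext (normalCoord_zero hβc' hy') rfl
    rw [h5] at h4
    exact (h4.comp h3).eventually (R'.D.open_source.mem_nhds hs')
  filter_upwards [hto.eventually (AugData.flow_transition hβ hβ' R R' hy hy' hs hs'), hto.eventually hT,
    hto.eventually hR', (toNormal d hβc R).open_source.mem_nhds hsrc,
    β'.open_source.mem_nhds hy'] with x h1 h2 h3 h4 h5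
  obtain ⟨h6, h7, h8⟩ := mem_toNormal_source hβc R h4
  -- Combined with the transition of flows, this gives `β' x = R'.D (normalChart β' (toNormal x))`,
  -- with `toNormal` formed in `β`; inverting `R'.D` and the normal chart proves the claim.
  have h9 := normalChart_transition hβc hβc' (d.contDiffOn_h β' hβ' β hβ) (d.h_eq β' hβ' β hβ) h2
  rw [← h9, R.D.right_inv h7, β.left_inv h6] at h1
  rw [toNormal_apply, toNormal_apply, h1, R'.D.left_inv h3]
  refine ((normalChart β' hβc').left_inv ?_).symm
  change ι (footPoint ι β (R.D.symm (β x)).2) ∈ β'.source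
  rw [ι_footPoint hβc h2.1]
  exact h2.2

/-- The linear part depends on the chart, unlike `toNormal`, so only flows in the same chart are
compared. This suffices to glue it over each chart separately. -/
theorem linearPart_eventuallyEq (hβ : β ∈ 𝒜) (R R' : d.Flow β) {y : Y}
    (hy : ι y ∈ β.source) (hs : β (ι y) ∈ R.D.source) (hs' : β (ι y) ∈ R'.D.source) :
    linearPart R =ᶠ[𝓝 (ι y)] linearPart R' := by
  have hβc := d.isChartFor β hβ
  have hto := flow_symm_tendsto hβc R hy hs
  have h1 : ∀ᶠ p in 𝓝 (β (ι y)), R.κ p 1 = R'.κ p 1 := by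
    rw [chart_eq hβc hy] at hs hs' ⊢
    exact R.eventually_kappa_eq R' d.isOpen_good d.contDiffOn_theta d.contDiffOn_tangent hs hs'
  filter_upwards [toNormal_eventuallyEq hβ hβ R R' hy hy hs hs', hto.eventually h1,
    (toNormal d hβc R).open_source.mem_nhds (toNormal_mem_source hβc R hy hs),
    (toNormal d hβc R').open_source.mem_nhds (toNormal_mem_source hβc R' hy hs')] with x h2 h3 h4 h5
  have h6 := (normalChart β hβc).symm.injOn (mem_toNormal_source hβc R h4).2.2
    (mem_toNormal_source hβc R' h5).2.2 h2
  rw [linearPart, linearPart, ← h6, h3]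

end ToNormal

end NormalForm

/-! ### Construction of the tubular neighborhood. -/

section Tubular

variable {c m : ℕ} {X Y : Type*}
  [TopologicalSpace X] [ChartedSpace (Euc (c + m)) X]
  [TopologicalSpace Y] [ChartedSpace (Euc m) Y] {ι : Y → X}
  [IsManifold (𝓡 m) ∞ Y] [IsManifold (𝓡 (c + m)) ∞ X] [hι : IsClosedSubmanifold c m ι]
  {E : Submodule ℝ (Euc c)} {e₀ : Euc c}
  {𝒜 : Set (OpenPartialHomeomorph X (Euc c × Euc m))} {d : AugData ι E e₀ 𝒜}
  {β : OpenPartialHomeomorph X (Euc c × Euc m)} [Nonempty Y]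

/-- The local identifications of `X` with the normal bundle glue to a map near the submanifold. -/
lemma exists_glue_toNormal [T2Space X] [ParacompactSpace X]
    (hcov : range ι ⊆ ⋃ φ ∈ 𝒜, φ.source) :
    ∃ G : X → TotalSpace (Euc c) (NormalFiber c m ι), ∀ β (hβ : β ∈ 𝒜) (R : d.Flow β) (y : Y),
      ι y ∈ β.source → β (ι y) ∈ R.D.source →
        G =ᶠ[𝓝 (ι y)] toNormal d (d.isChartFor β hβ) R := by
  have : Nonempty (TotalSpace (Euc c) (NormalFiber c m ι)) :=
    ⟨TotalSpace.mk' (Euc c) (Classical.arbitrary Y) 0⟩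
  obtain ⟨G, hG⟩ := exists_glue_germs (Z := range ι) hι.isClosed_range
    (J := Σ β : 𝒜, d.Flow β.1)
    (fun j => j.1.1.source ∩ j.1.1 ⁻¹' j.2.D.source)
    (fun j => j.1.1.isOpen_inter_preimage j.2.D.open_source) (by
      rintro _ ⟨y, rfl⟩
      obtain ⟨φ, hφ, hy⟩ := mem_iUnion₂.1 (hcov ⟨y, rfl⟩)
      obtain ⟨R, hR⟩ := AugData.exists_flow (d := d) hφ hy
      exact mem_iUnion.2 ⟨⟨⟨φ, hφ⟩, R⟩, hy, hR⟩)
    (fun j => toNormal d (d.isChartFor j.1.1 j.1.2) j.2) (by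
      rintro i j _ ⟨y, rfl⟩ hi hj
      exact toNormal_eventuallyEq i.1.2 j.1.2 i.2 j.2 hi.1 hj.1 hi.2 hj.2)
  exact ⟨G, fun β hβ R y hy hR => hG ⟨⟨β, hβ⟩, R⟩ (ι y) ⟨y, rfl⟩ ⟨hy, hR⟩⟩

/-- The linear parts of the normal coordinates in a chart glue to a map near the submanifold. -/
lemma exists_glue_linearPart [TopologicalSpace.MetrizableSpace X] (hβ : β ∈ 𝒜) :
    ∃ K : X → Euc c →L[ℝ] Euc c, ∀ (R : d.Flow β) (y : Y), ι y ∈ β.source →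
      β (ι y) ∈ R.D.source → K =ᶠ[𝓝 (ι y)] linearPart R := by
  classical
  -- The part of `Y` in the chart is closed only relative to `β.source`, so the germs are glued in
  -- that space; metrizability passes to it and gives paracompactness.
  have : ParacompactSpace β.source := by
    let := TopologicalSpace.metrizableSpaceMetric β.source
    infer_instance
  obtain ⟨F, hF⟩ := exists_glue_germs (X := β.source) (T := Euc c →L[ℝ] Euc c)
    (Z := Subtype.val ⁻¹' range ι) (hι.isClosed_range.preimage continuous_subtype_val)
    (J := d.Flow β) (fun R => Subtype.val ⁻¹' (β.source ∩ β ⁻¹' R.D.source))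
    (fun R => (β.isOpen_inter_preimage R.D.open_source).preimage continuous_subtype_val) (by
      rintro ⟨_, hy⟩ ⟨y, rfl⟩
      obtain ⟨R, hR⟩ := AugData.exists_flow (d := d) hβ hy
      exact mem_iUnion.2 ⟨R, hy, hR⟩)
    (fun R x => linearPart R x) (by
      rintro R R' ⟨_, hy⟩ ⟨y, rfl⟩ hR hR'
      exact (continuous_subtype_val.tendsto (⟨ι y, hy⟩ : β.source)).eventually
        (linearPart_eventuallyEq hβ R R' hy hR.2 hR'.2))
  refine ⟨fun x => if h : x ∈ β.source then F ⟨x, h⟩ else 0, fun R y hy hR => ?_⟩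
  have h1 := hF R ⟨ι y, hy⟩ ⟨y, rfl⟩ ⟨hy, hR⟩
  have h2 := β.open_source.isOpenEmbedding_subtypeVal.map_nhds_eq ⟨ι y, hy⟩
  change ∀ᶠ x in 𝓝 (ι y), _
  rw [← h2, Filter.eventually_map]
  filter_upwards [h1] with x hx
  rw [dif_pos x.2]
  exact hx

/-- There are a tubular neighbourhood identification and, near the submanifold, smooth families of
conformal linear maps which relate it to the charts of an augmented atlas. -/
theorem exists_tubularNbhd [T2Space X] [SecondCountableTopology X] (d : AugData ι E e₀ 𝒜)
    (hcov : range ι ⊆ ⋃ φ ∈ 𝒜, φ.source) :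
    ∃ T : TubularNbhd c m ι, ∀ β ∈ 𝒜, ∃ (U : Set X) (K : X → Euc c →L[ℝ] Euc c),
      IsOpen U ∧ range ι ∩ β.source ⊆ U ∧ U ⊆ β.source ∧ U ⊆ T.Ψ '' T.W ∧
      ContMDiffOn (𝓡 (c + m)) 𝓘(ℝ, Euc c →L[ℝ] Euc c) ∞ K U ∧
      ∀ v ∈ T.W, T.Ψ v ∈ U → IsUnit (K (T.Ψ v)) ∧ IsConformalOn E e₀ (K (T.Ψ v)) ∧
        ι v.1 ∈ β.source ∧ (β (T.Ψ v)).1 = K (T.Ψ v) (normalCoord β v.1 v.2) := by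
  classical
  have : LocallyCompactSpace X := Manifold.locallyCompact_of_finiteDimensional (𝓡 (c + m))
  have : TopologicalSpace.MetrizableSpace X := TopologicalSpace.metrizableSpace_of_t3_secondCountable X
  have : Nonempty X := ⟨ι (Classical.arbitrary Y)⟩
  obtain ⟨G, hG⟩ := exists_glue_toNormal (d := d) hcov
  have hloc : ∀ y, ∃ β, ∃ hβ : β ∈ 𝒜, ∃ R : d.Flow β, ι y ∈ β.source ∧ β (ι y) ∈ R.D.source ∧
      ι y ∈ (toNormal d (d.isChartFor β hβ) R).source := by
    intro y
    obtain ⟨φ, hφ, hy⟩ := mem_iUnion₂.1 (hcov ⟨y, rfl⟩)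
    obtain ⟨R, hR⟩ := AugData.exists_flow (d := d) hφ hy
    exact ⟨φ, hφ, R, hy, hR, toNormal_mem_source _ R hy hR⟩
  have hGι : ∀ y, G (ι y) = TotalSpace.mk' (Euc c) y 0 := by
    intro y
    obtain ⟨β, hβ, R, hy, hR, -⟩ := hloc y
    rw [(hG β hβ R y hy hR).self_of_nhds, toNormal_ι _ R hy hR]
  obtain ⟨O₁, hO₁, hιO₁, hinj⟩ := exists_isOpen_injOn hι.mdifferentiable.continuous G
    (fun v => v.1) (fun y => by rw [hGι y]) (by
      intro y
      obtain ⟨β, hβ, R, hy, hR, hs⟩ := hloc y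
      have h1 : ContinuousAt G (ι y) :=
        ((toNormal d (d.isChartFor β hβ) R).continuousAt hs).congr (hG β hβ R y hy hR).symm
      exact (FiberBundle.continuous_proj (Euc c) (NormalFiber c m ι)).continuousAt.comp h1) (by
      intro y
      obtain ⟨β, hβ, R, hy, hR, hs⟩ := hloc y
      refine ⟨_, Filter.inter_mem (hG β hβ R y hy hR)
        ((toNormal d (d.isChartFor β hβ) R).open_source.mem_nhds hs), ?_⟩
      intro x hx x' hx' hxx'
      refine (toNormal d (d.isChartFor β hβ) R).injOn hx.2 hx'.2 ?_
      rw [← hx.1, ← hx'.1, hxx'])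
  -- Only the germs of `G` along `Y` are known; `A j` is the open set of points near which `G` is
  -- the local diffeomorphism with index `j`.
  let A : (Σ β : 𝒜, d.Flow β.1) → Set X := fun j =>
    (toNormal d (d.isChartFor j.1.1 j.1.2) j.2).source ∩
      {x | G =ᶠ[𝓝 x] toNormal d (d.isChartFor j.1.1 j.1.2) j.2}
  have hA : ∀ j, IsOpen (A j) := fun j =>
    (OpenPartialHomeomorph.open_source _).inter isOpen_setOfPred_eventually_nhds
  have hAmem : ∀ β (hβ : β ∈ 𝒜) (R : d.Flow β) y, ι y ∈ β.source → β (ι y) ∈ R.D.source →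
      ι y ∈ A ⟨⟨β, hβ⟩, R⟩ := fun β hβ R y hy hR =>
    ⟨toNormal_mem_source _ R hy hR, hG β hβ R y hy hR⟩
  let O : Set X := O₁ ∩ ⋃ j, A j
  have hO : IsOpen O := hO₁.inter (isOpen_iUnion hA)
  have hιO : ∀ y, ι y ∈ O := by
    intro y
    obtain ⟨β, hβ, R, hy, hR, hs⟩ := hloc y
    exact ⟨hιO₁ ⟨y, rfl⟩, mem_iUnion.2 ⟨_, hAmem β hβ R y hy hR⟩⟩
  have hinjO : InjOn G O := hinj.mono inter_subset_left
  -- The gluing goes from `X` to the normal bundle, so `Ψ` is the inverse of the glued map.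
  let Ψ := Function.invFunOn G O
  have hΨG : ∀ x ∈ O, Ψ (G x) = x := fun x hx => hinjO.leftInvOn_invFunOn hx
  let e : ∀ j : (Σ β : 𝒜, d.Flow β.1),
      OpenPartialHomeomorph X (TotalSpace (Euc c) (NormalFiber c m ι)) := fun j =>
    (toNormal d (d.isChartFor j.1.1 j.1.2) j.2).restrOpen (O ∩ A j) (hO.inter (hA j))
  have he : ∀ j, ∀ x ∈ (e j).source, x ∈ O ∧ G x = e j x := fun j x hx =>
    ⟨hx.2.1, hx.2.2.2.self_of_nhds⟩
  have hΨe : ∀ j, EqOn Ψ (e j).symm (e j).target := by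
    intro j v hv
    have h1 := he j _ ((e j).map_target hv)
    rw [(e j).right_inv hv] at h1
    rw [← h1.2, hΨG _ h1.1]
    rw [h1.2]
  have hlocal : ∀ x ∈ O, ∃ j, x ∈ (e j).source := by
    rintro x hx
    obtain ⟨j, hj⟩ := mem_iUnion.1 hx.2
    exact ⟨j, hj.1, hx, hj⟩
  let T : TubularNbhd c m ι :=
    { W := G '' O
      Ψ := Ψ
      isOpen_W := by
        rw [isOpen_iff_mem_nhds]
        rintro _ ⟨x, hx, rfl⟩
        obtain ⟨j, hj⟩ := hlocal x hx
        rw [(he j x hj).2]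
        filter_upwards [(e j).open_target.mem_nhds ((e j).map_source hj)] with v hv
        have h1 := he j _ ((e j).map_target hv)
        rw [(e j).right_inv hv] at h1
        exact ⟨_, h1.1, h1.2⟩
      zero_mem := fun y => ⟨ι y, hιO y, hGι y⟩
      injOn := by
        rintro _ ⟨x, hx, rfl⟩ _ ⟨x', hx', rfl⟩ hxx
        rw [hΨG x hx, hΨG x' hx'] at hxx
        rw [hxx]
      isLocalDiffeomorphOn := by
        rintro ⟨_, x, hx, rfl⟩
        obtain ⟨j, hj⟩ := hlocal x hx
        refine ⟨⟨(e j).symm.toPartialEquiv, (e j).open_target, (e j).open_source, ?_, ?_⟩, ?_, ?_⟩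
        · exact (contMDiffOn_toNormal_symm (d.isChartFor j.1.1 j.1.2) j.2).mono
            inter_subset_left
        · exact (contMDiffOn_toNormal (d.isChartFor j.1.1 j.1.2) j.2).mono
            inter_subset_left
        · change G x ∈ (e j).target
          rw [(he j x hj).2]
          exact (e j).map_source hj
        · exact hΨe j
      map_zero := fun y => by rw [← hGι y, hΨG _ (hιO y)]
      normalProj_deriv := by
        intro y w
        obtain ⟨β, hβ, R, hy, hR, hs⟩ := hloc y
        let j : (Σ β : 𝒜, d.Flow β.1) := ⟨⟨β, hβ⟩, R⟩
        have hj : ι y ∈ (e j).source := ⟨hs, hιO y, hAmem β hβ R y hy hR⟩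
        have h1 : (fun t : ℝ => Ψ (TotalSpace.mk' (Euc c) y (t • w))) =ᶠ[𝓝 0]
            fun t : ℝ => (toNormal d (d.isChartFor β hβ) R).symm
              (TotalSpace.mk' (Euc c) y (t • w)) := by
          have h2 : Filter.Tendsto (fun t : ℝ => TotalSpace.mk' (Euc c) y (t • w)) (𝓝 0)
              (𝓝 (TotalSpace.mk' (Euc c) y (0 : NormalFiber c m ι y))) := by
            obtain ⟨u, rfl⟩ := normalProj_surjective y w
            have h3 : Continuous fun t : ℝ => t • normalProj c m ι y u := by
              have h4 : Continuous fun t : ℝ => normalProj c m ι y (t • u) :=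
                (normalProj c m ι y).continuous.comp (continuous_id.smul continuous_const)
              simpa only [map_smul] using h4
            have h5 := ((FiberBundle.continuous_totalSpaceMk (Euc c) (NormalFiber c m ι)
              y).comp h3).tendsto 0
            rw [Function.comp_apply, zero_smul] at h5
            exact h5
          have h3 : TotalSpace.mk' (Euc c) y (0 : NormalFiber c m ι y) ∈ (e j).target := by
            have := (e j).map_source hj
            rwa [← (he j _ hj).2, hGι] at this
          filter_upwards [h2.eventually ((e j).open_target.mem_nhds h3)] with t ht
          exact hΨe j ht
        rw [h1.mfderiv_eq]
        exact normalProj_mfderiv_toNormal_symm (d.isChartFor β hβ) R hy hR w }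
  refine ⟨T, fun β hβ => ?_⟩
  obtain ⟨K, hK⟩ := exists_glue_linearPart (d := d) hβ
  let B : d.Flow β → Set X := fun R => A ⟨⟨β, hβ⟩, R⟩ ∩ {x | K =ᶠ[𝓝 x] linearPart R}
  have hB : ∀ R, IsOpen (B R) := fun R => (hA _).inter isOpen_setOfPred_eventually_nhds
  refine ⟨O ∩ ⋃ R, B R, K, hO.inter (isOpen_iUnion hB), ?_, ?_, ?_, ?_, ?_⟩
  · rintro _ ⟨⟨y, rfl⟩, hy⟩
    obtain ⟨R, hR⟩ := AugData.exists_flow (d := d) hβ hy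
    exact ⟨hιO y, mem_iUnion.2 ⟨R, hAmem β hβ R y hy hR, hK R y hy hR⟩⟩
  · rintro x ⟨-, hx⟩
    obtain ⟨R, hR⟩ := mem_iUnion.1 hx
    exact (mem_toNormal_source _ R hR.1.1).1
  · rintro x ⟨hx, -⟩
    exact ⟨G x, ⟨x, hx, rfl⟩, hΨG x hx⟩
  · rintro x ⟨-, hx⟩
    obtain ⟨R, hR⟩ := mem_iUnion.1 hx
    exact (((contMDiffOn_linearPart (d.isChartFor β hβ) R).contMDiffAt
      ((OpenPartialHomeomorph.open_source _).mem_nhds hR.1.1)).congr_of_eventuallyEq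
        hR.2).contMDiffWithinAt
  · rintro _ ⟨x, hx, rfl⟩ hU
    change Ψ (G x) ∈ _ at hU
    change IsUnit (K (Ψ (G x))) ∧ IsConformalOn E e₀ (K (Ψ (G x))) ∧ ι (G x).1 ∈ β.source ∧
      (β (Ψ (G x))).1 = K (Ψ (G x)) (normalCoord β (G x).1 (G x).2)
    rw [hΨG x hx] at hU ⊢
    obtain ⟨R, hR⟩ := mem_iUnion.1 hU.2
    rw [hR.2.self_of_nhds, hR.1.2.self_of_nhds]
    exact ⟨isUnit_linearPart _ R hR.1.1, isConformalOn_linearPart _ R hR.1.1,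
      ι_toNormal_mem _ R hR.1.1, chart_fst_eq_linearPart _ R hR.1.1⟩

end Tubular

/-! ### The averaged inner product. -/

section InnerProduct

variable {c m : ℕ} {X Y : Type*}
  [TopologicalSpace X] [ChartedSpace (Euc (c + m)) X]
  [TopologicalSpace Y] [ChartedSpace (Euc m) Y] {ι : Y → X}
  [IsManifold (𝓡 m) ∞ Y] [IsManifold (𝓡 (c + m)) ∞ X] [hι : IsClosedSubmanifold c m ι]
  {E : Submodule ℝ (Euc c)} {e₀ : Euc c}
  {𝒜 : Set (OpenPartialHomeomorph X (Euc c × Euc m))} (d : AugData ι E e₀ 𝒜)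
  {β : OpenPartialHomeomorph X (Euc c × Euc m)}

namespace AugData

open scoped Classical in
/-- The pullback of the Euclidean inner product by the normal coordinates of a chart. -/
def coordForm (α : 𝒜) (y : Y) : NormalFiber c m ι y →ₗ[ℝ] NormalFiber c m ι y →ₗ[ℝ] ℝ :=
  if h : ι y ∈ α.1.source then
    (innerₗ (Euc c)).compl₁₂ (normalCoordEquiv (d.isChartFor α.1 α.2) h).toLinearMap
      (normalCoordEquiv (d.isChartFor α.1 α.2) h).toLinearMap
  else 0

/-- The average of the pullbacks of the Euclidean inner product by normal coordinates. -/
def normalForm (y : Y) : NormalFiber c m ι y →ₗ[ℝ] NormalFiber c m ι y →ₗ[ℝ] ℝ :=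
  ∑ᶠ α : 𝒜, d.χ α (ι y) • d.coordForm α y

lemma normalForm_apply (y : Y) (v w : NormalFiber c m ι y) :
    d.normalForm y v w =
      ∑ᶠ α : 𝒜, d.χ α (ι y) • inner ℝ (normalCoord α.1 y v) (normalCoord α.1 y w) := by
  have h := map_finsum ((LinearMap.applyₗ (R := ℝ) (M₂ := ℝ) w) ∘ₗ
    (LinearMap.applyₗ (R := ℝ) (M₂ := NormalFiber c m ι y →ₗ[ℝ] ℝ) v))
      (d.finite_support (ι y) fun α => d.coordForm α y)
  refine h.trans (finsum_congr fun α => ?_)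
  by_cases h0 : d.χ α (ι y) = 0
  · simp [h0]
  have h1 : ι y ∈ α.1.source := d.mem_source_of_ne_zero h0
  simp only [LinearMap.comp_apply, LinearMap.applyₗ_apply_apply, LinearMap.smul_apply, coordForm,
    dif_pos h1]
  rfl

lemma normalForm_pos {y : Y} {v : NormalFiber c m ι y} (hv : v ≠ 0) : 0 < d.normalForm y v v := by
  rw [normalForm_apply]
  obtain ⟨α, hα⟩ := d.χ.exists_pos_of_mem (mem_of_mem_nhds (d.mem_nhds y))
  refine finsum_pos (fun α => ?_) ⟨α, ?_⟩ (d.finite_support _ _)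
  · exact mul_nonneg (d.χ.nonneg α _) real_inner_self_nonneg
  · refine mul_pos hα (real_inner_self_pos.2 fun h0 => hv ?_)
    exact (normalCoordEquiv (d.isChartFor α.1 α.2)
      (d.mem_source_of_ne_zero hα.ne')).injective (h0.trans (map_zero _).symm)

/-- The average over an augmented atlas of the pullbacks of the Euclidean inner product, on a
subbundle of the normal bundle. -/
def subbundleInner (S : ∀ y, Submodule ℝ (NormalFiber c m ι y)) : SubbundleInner ι S where
  inner y := (d.normalForm y).domRestrict₁₂ (S y) (S y)
  symm y v w := by
    change d.normalForm y v w = d.normalForm y w v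
    rw [normalForm_apply, normalForm_apply]
    exact finsum_congr fun α => by rw [real_inner_comm]
  pos y v hv := d.normalForm_pos fun h => hv (Subtype.ext h)
  smooth U s t hU hs ht := by
    intro y hy
    have heq : (fun y => (d.normalForm y).domRestrict₁₂ (S y) (S y) (s y) (t y)) = fun y =>
        ∑ᶠ α : 𝒜, d.χ α (ι y) •
          inner ℝ (normalCoord α.1 y (s y : NormalFiber c m ι y))
            (normalCoord α.1 y (t y : NormalFiber c m ι y)) :=
      funext fun y => d.normalForm_apply y _ _
    rw [heq]
    refine contMDiffWithinAt_finsum ?_ fun α => ?_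
    · refine (d.χ.locallyFinite.preimage_continuous hι.mdifferentiable.continuous).subset ?_
      intro α y hα h0
      exact hα (by simp only [h0, zero_smul])
    · by_cases hyα : ι y ∈ α.1.source
      · have hα := d.isChartFor α.1 α.2
        have h1 : ContMDiffWithinAt (𝓡 m) 𝓘(ℝ, ℝ) ∞ (fun y => d.χ α (ι y)) U y :=
          (((d.χ α).contMDiff.comp IsClosedSubmanifold.contMDiff) y).contMDiffWithinAt
        have h2 := ((contMDiffWithinAt_normal_iff hα hyα).1 (hs y hy)).2
        have h3 := ((contMDiffWithinAt_normal_iff hα hyα).1 (ht y hy)).2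
        have h4 : ContDiff ℝ ∞ fun p : Euc c × Euc c => inner ℝ p.1 p.2 :=
          contDiff_fst.inner ℝ contDiff_snd
        have h5 := (h4.contMDiff _).comp_contMDiffWithinAt y (h2.prodMk_space h3)
        exact h1.smul h5
      · have h1 : ∀ᶠ z in 𝓝 y, d.χ α (ι z) = 0 := by
          have h2 : ι y ∉ tsupport (d.χ α) := fun h => hyα (d.subordinate α h)
          exact hι.mdifferentiable.continuous.continuousAt.eventually
            (notMem_tsupport_iff_eventuallyEq.1 h2)
        refine ((contMDiffAt_const (c := (0 : ℝ))).congr_of_eventuallyEq ?_).contMDiffWithinAt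
        filter_upwards [h1] with z hz
        rw [hz, zero_smul]

/-- The normal coordinates of a chart of an augmented atlas are conformal on the distinguished
subspaces. -/
lemma normalForm_chartFrame (hβ : β ∈ 𝒜) {y : Y} (hy : ι y ∈ β.source) {e : Euc c} (he : e ∈ E) :
    d.normalForm y (chartFrame c m ι β y e) (chartFrame c m ι β y e) =
      d.normalForm y (chartFrame c m ι β y e₀) (chartFrame c m ι β y e₀) * ‖e‖ ^ 2 := by
  rw [normalForm_apply, normalForm_apply, finsum_mul]
  refine finsum_congr fun α => ?_
  by_cases h0 : d.χ α (ι y) = 0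
  · simp [h0]
  have h1 : ι y ∈ α.1.source := d.mem_source_of_ne_zero h0
  -- In the coordinates of `α`, the frame of `β` is the value of `h` on `Y`. Every summand is thus
  -- scaled by `‖e‖²`, and so is the sum.
  have h2 := fun r => transition_eq_normalTransition (d.isChartFor β hβ) (d.isChartFor α.1 α.2)
    (d.contDiffOn_h α.1 α.2 β hβ) (d.h_eq α.1 α.2 β hβ) hy h1 r
  rw [← h2, ← h2, real_inner_self_eq_norm_sq, real_inner_self_eq_norm_sq,
    (d.h_conf α.1 α.2 β hβ _ (mem_transition_source hy h1) e he).2, smul_eq_mul, smul_eq_mul,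
    mul_assoc]

end AugData

end InnerProduct

/-! ### Adapted charts and their compatibility. -/

section Adapted

variable {c m : ℕ} {X Y : Type*}
  [TopologicalSpace X] [ChartedSpace (Euc (c + m)) X]
  [TopologicalSpace Y] [ChartedSpace (Euc m) Y] {ι : Y → X}
  [IsManifold (𝓡 m) ∞ Y] [IsManifold (𝓡 (c + m)) ∞ X] [hι : IsClosedSubmanifold c m ι]
  {S : ∀ y, Submodule ℝ (NormalFiber c m ι y)} {T : TubularNbhd c m ι} {g : SubbundleInner ι S}
  {φ φ' : OpenPartialHomeomorph X (Euc c × Euc m)}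

lemma contMDiffAt_chartFrame (hφ : IsChartFor c m ι φ) (r : Euc c) {y : Y} (hy : ι y ∈ φ.source) :
    ContMDiffAt (𝓡 m) ((𝓡 m).prod 𝓘(ℝ, Euc c)) ∞
      (fun y => TotalSpace.mk' (Euc c) y (chartFrame c m ι φ y r)) y := by
  have h1 := contMDiffWithinAt_normal_iff (IM := 𝓡 m) (s := univ) (x := y) hφ
    (f := fun y => TotalSpace.mk' (Euc c) y (chartFrame c m ι φ y r)) hy
  refine contMDiffWithinAt_univ.1 (h1.2 ⟨contMDiffWithinAt_id, ?_⟩)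
  refine ((contMDiffAt_const (c := r)).congr_of_eventuallyEq ?_).contMDiffWithinAt
  filter_upwards [(φ.open_source.preimage hι.mdifferentiable.continuous).mem_nhds hy] with z hz
  exact normalCoord_chartFrame hφ hz r

namespace TubularNbhd

lemma contMDiffAt {v : TotalSpace (Euc c) (NormalFiber c m ι)} (T : TubularNbhd c m ι)
    (hv : v ∈ T.W) : ContMDiffAt ((𝓡 m).prod 𝓘(ℝ, Euc c)) (𝓡 (c + m)) ∞ T.Ψ v := by
  obtain ⟨e, he, heq⟩ := T.isLocalDiffeomorphOn ⟨v, hv⟩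
  exact (e.contMDiffOn_toFun.contMDiffAt (e.open_source.mem_nhds he)).congr_of_eventuallyEq
    (heq.eventuallyEq_of_mem (e.open_source.mem_nhds he))

variable [Nonempty Y]

/-- The inverse of a tubular neighbourhood identification. -/
def inv (T : TubularNbhd c m ι) : X → TotalSpace (Euc c) (NormalFiber c m ι) :=
  have : Nonempty (TotalSpace (Euc c) (NormalFiber c m ι)) :=
    ⟨TotalSpace.mk' (Euc c) (Classical.arbitrary Y) 0⟩
  Function.invFunOn T.Ψ T.W

variable (T) in
lemma inv_Ψ {v : TotalSpace (Euc c) (NormalFiber c m ι)} (hv : v ∈ T.W) : T.inv (T.Ψ v) = v :=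
  have : Nonempty (TotalSpace (Euc c) (NormalFiber c m ι)) := ⟨v⟩
  T.injOn.leftInvOn_invFunOn hv

variable (T) in
lemma contMDiffAt_inv {v : TotalSpace (Euc c) (NormalFiber c m ι)} (hv : v ∈ T.W) :
    ContMDiffAt (𝓡 (c + m)) ((𝓡 m).prod 𝓘(ℝ, Euc c)) ∞ T.inv (T.Ψ v) := by
  obtain ⟨e, he, heq⟩ := T.isLocalDiffeomorphOn ⟨v, hv⟩
  have hx : T.Ψ v ∈ e.target := by
    rw [heq he]
    exact e.map_source he
  have h1 : ContMDiffAt (𝓡 (c + m)) ((𝓡 m).prod 𝓘(ℝ, Euc c)) ∞ e.invFun (T.Ψ v) :=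
    e.contMDiffOn_invFun.contMDiffAt (e.open_target.mem_nhds hx)
  have h2 : e.invFun (T.Ψ v) = v := by
    rw [heq he]
    exact e.left_inv he
  refine h1.congr_of_eventuallyEq ?_
  have h3 := h1.continuousAt.preimage_mem_nhds (by rw [h2]; exact T.isOpen_W.mem_nhds hv)
  filter_upwards [h3, e.open_target.mem_nhds hx] with x hxW hxe
  have h4 : T.Ψ (e.invFun x) = x := (heq (e.map_target hxe)).trans (e.right_inv hxe)
  conv_lhs => rw [← h4]
  exact T.inv_Ψ hxW

end TubularNbhd

/-- A chart `φ` is adapted to a tubular neighbourhood identification `(W, Ψ)` and an inner product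
`g` on `S` if the normal component of `φ ∘ Ψ` is given by smooth fibrewise linear isomorphisms
which map `S` conformally into `E`. -/
def IsAdapted (E : Submodule ℝ (Euc c)) (T : TubularNbhd c m ι) (g : SubbundleInner ι S)
    (φ : OpenPartialHomeomorph X (Euc c × Euc m)) : Prop :=
  ∃ (M : ∀ v : TotalSpace (Euc c) (NormalFiber c m ι), NormalFiber c m ι v.1 →ₗ[ℝ] Euc c)
    (f : TotalSpace (Euc c) (NormalFiber c m ι) → ℝ),
    φ.source ⊆ T.Ψ '' T.W ∧ ∀ v ∈ T.W, T.Ψ v ∈ φ.source →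
      Function.Bijective (M v) ∧ (φ (T.Ψ v)).1 = M v v.2 ∧ 0 < f v ∧
      (∀ w : S v.1, M v w ∈ E ∧ ‖M v w‖ ^ 2 = f v * g.inner v.1 w w) ∧
      ContMDiffAt ((𝓡 m).prod 𝓘(ℝ, Euc c)) 𝓘(ℝ, ℝ) ∞ f v ∧
      ∀ δ, IsChartFor c m ι δ → ι v.1 ∈ δ.source → ∀ r,
        ContMDiffAt ((𝓡 m).prod 𝓘(ℝ, Euc c)) 𝓘(ℝ, Euc c) ∞
          (fun u => M u (chartFrame c m ι δ u.1 r)) v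

/-- Any two adapted charts are compatible. -/
theorem IsAdapted.augCompatible [Nonempty Y] {c₁ : ℕ}
    (hS : ∀ y, Module.finrank ℝ (S y) = Module.finrank ℝ (coordSubspace c c₁))
    (hφ' : IsChartFor c m ι φ') (h : IsAdapted (coordSubspace c c₁) T g φ)
    (h' : IsAdapted (coordSubspace c c₁) T g φ') : AugCompatible c₁ φ φ' := by
  classical
  obtain ⟨M, f, hsub, hM⟩ := h
  obtain ⟨M', f', hsub', hM'⟩ := h'
  set s := (φ'.symm.trans φ).source with hs
  have hso : IsOpen s := (φ'.symm.trans φ).open_source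
  let v : Euc c × Euc m → TotalSpace (Euc c) (NormalFiber c m ι) := fun p => T.inv (φ'.symm p)
  have hv : ∀ p ∈ s, v p ∈ T.W ∧ T.Ψ (v p) = φ'.symm p ∧
      ContMDiffAt 𝓘(ℝ, Euc c × Euc m) ((𝓡 m).prod 𝓘(ℝ, Euc c)) ∞ v p := by
    intro p hp
    obtain ⟨u, hu, hup⟩ := hsub hp.2
    change T.Ψ u = φ'.symm p at hup
    have h1 : v p = u := by
      change T.inv (φ'.symm p) = u
      rw [← hup, T.inv_Ψ hu]
    refine ⟨h1 ▸ hu, by rw [h1, hup], ?_⟩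
    have h2 := T.contMDiffAt_inv hu
    rw [hup] at h2
    exact h2.comp p (hφ'.contMDiffOn_symm.contMDiffAt (φ'.open_target.mem_nhds hp.1))
  have hD : ∀ p ∈ s, T.Ψ (v p) ∈ φ.source := fun p hp => by
    rw [(hv p hp).2.1]
    exact hp.2
  have hD' : ∀ p ∈ s, T.Ψ (v p) ∈ φ'.source := fun p hp => by
    rw [(hv p hp).2.1]
    exact φ'.map_target hp.1
  -- `H = M ∘ M'⁻¹`, evaluated at the point of the normal bundle over the given coordinates. The
  -- value `0` is never used on the overlap.
  let H : Euc c × Euc m → Euc c →L[ℝ] Euc c := fun p =>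
    if hb : Function.Bijective (M' (v p)) then
      LinearMap.toContinuousLinearMap
        (M (v p) ∘ₗ (LinearEquiv.ofBijective (M' (v p)) hb).symm.toLinearMap)
    else 0
  have hH : ∀ p ∈ s, ∀ w, H p (M' (v p) w) = M (v p) w := by
    intro p hp w
    have hb := (hM' _ (hv p hp).1 (hD' p hp)).1
    simp only [H, dif_pos hb]
    change M (v p) ((LinearEquiv.ofBijective (M' (v p)) hb).symm
      (LinearEquiv.ofBijective (M' (v p)) hb w)) = _
    rw [LinearEquiv.symm_apply_apply]
  refine ⟨H, fun p => f (v p) / f' (v p), ?_, ?_, ?_⟩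
  · intro p₀ hp₀
    obtain ⟨δ, hδ, hyδ⟩ := exists_chartFor (c := c) (m := m) (ι := ι) (v p₀).1
    -- The fibres vary with `p`, so smoothness of `H` is checked in the frame of a chart `δ`: there
    -- `M` and `M'` become matrices `A`, `A'` and `H = A A'⁻¹`.
    let A : Euc c × Euc m → Euc c →L[ℝ] Euc c := fun p =>
      LinearMap.toContinuousLinearMap (M (v p) ∘ₗ (chartFrame c m ι δ (v p).1).toLinearMap)
    let A' : Euc c × Euc m → Euc c →L[ℝ] Euc c := fun p =>
      LinearMap.toContinuousLinearMap (M' (v p) ∘ₗ (chartFrame c m ι δ (v p).1).toLinearMap)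
    have hvc : ContinuousOn (fun p => ι (v p).1) s := fun p hp =>
      (hι.mdifferentiable.continuous.continuousAt.comp
        ((FiberBundle.continuous_proj (Euc c) (NormalFiber c m ι)).continuousAt.comp
          (hv p hp).2.2.continuousAt)).continuousWithinAt
    let s₀ := s ∩ (fun p => ι (v p).1) ⁻¹' δ.source
    have hs₀ : IsOpen s₀ := hvc.isOpen_inter_preimage hso δ.open_source
    have hA : ContDiffOn ℝ ∞ A s₀ := by
      rw [contDiffOn_clm_apply]
      intro r p hp
      have h1 := (hM _ (hv p hp.1).1 (hD p hp.1)).2.2.2.2.2 δ hδ hp.2 r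
      exact (h1.comp p (hv p hp.1).2.2).contDiffAt.contDiffWithinAt
    have hA' : ContDiffOn ℝ ∞ A' s₀ := by
      rw [contDiffOn_clm_apply]
      intro r p hp
      have h1 := (hM' _ (hv p hp.1).1 (hD' p hp.1)).2.2.2.2.2 δ hδ hp.2 r
      exact (h1.comp p (hv p hp.1).2.2).contDiffAt.contDiffWithinAt
    have hunit : ∀ p ∈ s₀, IsUnit (A' p) := by
      intro p hp
      rw [ContinuousLinearMap.isUnit_iff_bijective]
      exact (hM' _ (hv p hp.1).1 (hD' p hp.1)).1.comp (normalCoordEquiv hδ hp.2).symm.bijective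
    have heq : ∀ p ∈ s₀, H p = A p ∘L Ring.inverse (A' p) := by
      intro p hp
      ext1 r
      have h1 : A' p (Ring.inverse (A' p) r) = r :=
        DFunLike.congr_fun (Ring.mul_inverse_cancel _ (hunit p hp)) r
      conv_lhs => rw [← h1]
      exact hH p hp.1 _
    have hinv : ContDiffOn ℝ ∞ (fun p => Ring.inverse (A' p)) s₀ := by
      intro p hp
      obtain ⟨u, hu⟩ := hunit p hp
      have h2 : ContDiffAt ℝ ∞ (Ring.inverse : (Euc c →L[ℝ] Euc c) → _) (A' p) := by
        rw [← hu]
        exact contDiffAt_ringInverse ℝ u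
      exact h2.comp_contDiffWithinAt p (hA' p hp)
    exact (((hA.clm_comp hinv).congr heq).contDiffAt
      (hs₀.mem_nhds ⟨hp₀, hyδ⟩)).contDiffWithinAt
  · intro p hp
    have h1 := ((hM _ (hv p hp).1 (hD p hp)).2.2.2.2.1.comp p (hv p hp).2.2).contDiffAt
    have h2 := ((hM' _ (hv p hp).1 (hD' p hp)).2.2.2.2.1.comp p (hv p hp).2.2).contDiffAt
    exact (h1.div h2 (hM' _ (hv p hp).1 (hD' p hp)).2.2.1.ne').contDiffWithinAt
  · intro p hp
    obtain ⟨-, h1, h2, h3, -⟩ := hM _ (hv p hp).1 (hD p hp)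
    obtain ⟨hb', h1', h2', h3', -⟩ := hM' _ (hv p hp).1 (hD' p hp)
    rw [(hv p hp).2.1] at h1 h1'
    rw [φ'.right_inv hp.1] at h1'
    refine ⟨by rw [h1, h1', hH p hp], div_pos h2 h2', ?_⟩
    intro r hr
    -- By the dimension count `M'` maps the fibre of `S` onto the coordinate subspace, so each `r`
    -- there is `M' w` with `w` in the fibre, and the two conformal factors divide.
    have hmap : (S (v p).1).map (M' (v p)) = coordSubspace c c₁ := by
      refine Submodule.eq_of_le_of_finrank_eq ?_ ?_
      · rintro _ ⟨w, hw, rfl⟩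
        exact (h3' ⟨w, hw⟩).1
      · rw [← hS (v p).1]
        exact (Submodule.equivMapOfInjective _ hb'.1 (S (v p).1)).finrank_eq.symm
    rw [← hmap] at hr
    obtain ⟨w, hw, rfl⟩ := hr
    rw [hH p hp]
    refine ⟨(h3 ⟨w, hw⟩).1, ?_⟩
    rw [(h3 ⟨w, hw⟩).2, (h3' ⟨w, hw⟩).2]
    field_simp

/-- Charts cut out from a tubular neighbourhood identification are charts for the submanifold. -/
lemma IsCutOutChart.isChartFor [Nonempty Y] {c₁ : ℕ} (h : IsCutOutChart c₁ T g φ) :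
    IsChartFor c m ι φ := by
  obtain ⟨Φ, U, hΦ, -, hsrc, heq⟩ := h
  have hsrc' : ∀ x ∈ φ.source, ∃ v ∈ T.W ∩ Φ.source, T.Ψ v = x := fun x hx => by
    rwa [hsrc] at hx
  have hsymm : ∀ p ∈ φ.target, p ∈ Φ.target ∧ Φ.symm p ∈ T.W ∧ φ.symm p = T.Ψ (Φ.symm p) := by
    intro p hp
    obtain ⟨v, hv, hvx⟩ := hsrc' _ (φ.map_target hp)
    have h1 : p = Φ v := by rw [← heq v hv, hvx, φ.right_inv hp]
    have h2 : Φ.symm p = v := by rw [h1, Φ.left_inv hv.2]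
    exact ⟨h1 ▸ Φ.map_source hv.2, h2 ▸ hv.1, by rw [h2, hvx]⟩
  refine ⟨?_, ?_, ?_⟩
  · intro x hx
    obtain ⟨v, hv, rfl⟩ := hsrc' x hx
    have h1 : ContMDiffAt (𝓡 (c + m)) 𝓘(ℝ, Euc c × Euc m) ∞ (fun x => Φ (T.inv x)) (T.Ψ v) := by
      refine ContMDiffAt.comp (g := Φ) (T.Ψ v) ?_ (T.contMDiffAt_inv hv.1)
      rw [T.inv_Ψ hv.1]
      exact hΦ.contMDiffOn.contMDiffAt (Φ.open_source.mem_nhds hv.2)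
    refine h1.contMDiffWithinAt.congr (fun x hx => ?_) ?_
    · obtain ⟨u, hu, rfl⟩ := hsrc' x hx
      rw [heq u hu, T.inv_Ψ hu.1]
    · rw [heq v hv, T.inv_Ψ hv.1]
  · intro p hp
    have h1 : ContMDiffAt 𝓘(ℝ, Euc c × Euc m) (𝓡 (c + m)) ∞ (fun p => T.Ψ (Φ.symm p)) p :=
      (T.contMDiffAt (hsymm p hp).2.1).comp p
        (hΦ.contMDiffOn_symm.contMDiffAt (Φ.open_target.mem_nhds (hsymm p hp).1))
    exact h1.contMDiffWithinAt.congr (fun q hq => (hsymm q hq).2.2) (hsymm p hp).2.2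
  · intro x hx
    obtain ⟨v, hv, rfl⟩ := hsrc' x hx
    rw [heq v hv]
    have hvU : v.1 ∈ U := by
      have := hv.2
      rwa [hΦ.source_eq] at this
    obtain ⟨L, hL⟩ := hΦ.linear v.1 hvU
    have hLv : (Φ v).1 = L v.2 := hL v.2
    -- The normal part vanishes exactly on the zero section, which by injectivity of `Ψ` on `W` is
    -- the part lying over `Y`.
    rw [hLv, LinearEquiv.map_eq_zero_iff]
    constructor
    · rintro ⟨y, hy⟩
      rw [← T.map_zero y] at hy
      rw [← T.injOn (T.zero_mem y) hv.1 hy]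
    · intro h0
      refine ⟨v.1, ?_⟩
      rw [← T.map_zero, ← h0]

/-- Charts cut out from a tubular neighbourhood identification are adapted to it. -/
lemma IsCutOutChart.isAdapted {c₁ : ℕ} (h : IsCutOutChart c₁ T g φ) :
    IsAdapted (coordSubspace c c₁) T g φ := by
  classical
  obtain ⟨Φ, U, hΦ, hconf, hsrc, heq⟩ := h
  -- Adaptedness needs a linear map on every fibre; off `U` any isomorphism will do.
  have hlin : ∀ y, ∃ L : NormalFiber c m ι y ≃ₗ[ℝ] Euc c, y ∈ U → ∀ w, (Φ ⟨y, w⟩).1 = L w := by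
    intro y
    by_cases hy : y ∈ U
    · obtain ⟨L, hL⟩ := hΦ.linear y hy
      exact ⟨L, fun _ => hL⟩
    · obtain ⟨δ, hδ, hyδ⟩ := exists_chartFor (c := c) (m := m) (ι := ι) y
      exact ⟨normalCoordEquiv hδ hyδ, fun h => absurd h hy⟩
  choose L hL using hlin
  have hmem : ∀ v ∈ T.W, T.Ψ v ∈ φ.source → v ∈ T.W ∩ Φ.source := by
    intro v hv hvs
    rw [hsrc] at hvs
    obtain ⟨u, hu, huv⟩ := hvs
    rwa [← T.injOn hu.1 hv huv]
  refine ⟨fun v => (L v.1).toLinearMap, fun _ => 1, ?_, ?_⟩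
  · rw [hsrc]
    exact image_mono inter_subset_left
  · intro v hv hvs
    have hv' := hmem v hv hvs
    have hU : ∀ u : TotalSpace (Euc c) (NormalFiber c m ι), u ∈ Φ.source ↔ u.1 ∈ U := fun u => by
      rw [hΦ.source_eq]
      exact Iff.rfl
    have hvU : v.1 ∈ U := (hU v).1 hv'.2
    refine ⟨(L v.1).bijective, ?_, one_pos, ?_, contMDiffAt_const, ?_⟩
    · rw [heq v hv']
      exact hL v.1 hvU v.2
    · intro w
      have h1 := hconf v.1 hvU w
      rw [hL v.1 hvU] at h1
      exact ⟨h1.1, h1.2.trans (one_mul _).symm⟩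
    · intro δ hδ hyδ r
      have h1 : ContMDiffAt ((𝓡 m).prod 𝓘(ℝ, Euc c)) ((𝓡 m).prod 𝓘(ℝ, Euc c)) ∞
          (fun u : TotalSpace (Euc c) (NormalFiber c m ι) =>
            TotalSpace.mk' (Euc c) u.1 (chartFrame c m ι δ u.1 r)) v :=
        (contMDiffAt_chartFrame hδ r hyδ).comp v (contMDiff_proj (NormalFiber c m ι) v)
      have h2 : TotalSpace.mk' (Euc c) v.1 (chartFrame c m ι δ v.1 r) ∈ Φ.source := (hU _).2 hvU
      have h3 := (hΦ.contMDiffOn.contMDiffAt (Φ.open_source.mem_nhds h2)).comp v h1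
      have h4 := (contDiff_fst.contMDiff (𝕜 := ℝ) (n := ∞) _).comp v h3
      refine h4.congr_of_eventuallyEq ?_
      filter_upwards [Φ.open_source.mem_nhds hv'.2] with u hu
      exact (hL u.1 ((hU u).1 hu) _).symm

/-! ### Charts of the atlas are adapted near the submanifold. -/

section Restrict

variable {E : Submodule ℝ (Euc c)} {e₀ : Euc c}
  {𝒜 : Set (OpenPartialHomeomorph X (Euc c × Euc m))} (d : AugData ι E e₀ 𝒜)
  {β : OpenPartialHomeomorph X (Euc c × Euc m)}

/-- A chart of an augmented atlas is adapted where it is related to the tubular neighbourhood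
identification by conformal linear maps. -/
lemma AugData.isAdapted_restr (hβ : β ∈ 𝒜)
    (hS : ∀ y, ι y ∈ β.source → S y = E.map (chartFrame c m ι β y).toLinearMap)
    {U : Set X} {K : X → Euc c →L[ℝ] Euc c} (hU : IsOpen U) (hUT : U ⊆ T.Ψ '' T.W)
    (hK : ContMDiffOn (𝓡 (c + m)) 𝓘(ℝ, Euc c →L[ℝ] Euc c) ∞ K U)
    (hKU : ∀ v ∈ T.W, T.Ψ v ∈ U → IsUnit (K (T.Ψ v)) ∧ IsConformalOn E e₀ (K (T.Ψ v)) ∧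
        ι v.1 ∈ β.source ∧ (β (T.Ψ v)).1 = K (T.Ψ v) (normalCoord β v.1 v.2)) :
    IsAdapted E T (d.subbundleInner S) (β.restr U) := by
  classical
  have hβc := d.isChartFor β hβ
  have hsrc : (β.restr U).source = β.source ∩ U := by
    rw [β.restr_source, hU.interior_eq]
  let Q : ∀ y : Y, NormalFiber c m ι y →ₗ[ℝ] Euc c := fun y =>
    if hy : ι y ∈ β.source then (normalCoordEquiv hβc hy).toLinearMap else 0
  have hQ : ∀ y, ι y ∈ β.source → ∀ w, Q y w = normalCoord β y w := fun y hy w => by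
    simp only [Q, dif_pos hy]
    rfl
  let q : Y → ℝ := fun y => d.normalForm y (chartFrame c m ι β y e₀) (chartFrame c m ι β y e₀)
  have hq : ContMDiffOn (𝓡 m) 𝓘(ℝ, ℝ) ∞ q (ι ⁻¹' β.source) := by
    have h1 := fun y (hy : y ∈ ι ⁻¹' β.source) =>
      (contMDiffAt_chartFrame hβc e₀ (y := y) hy).contMDiffWithinAt (s := ι ⁻¹' β.source)
    -- The averaged form exists on the whole normal bundle; taking `⊤` as the subbundle gives its
    -- smoothness on arbitrary sections.
    exact (d.subbundleInner fun _ => ⊤).smooth (ι ⁻¹' β.source)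
      (fun y => ⟨chartFrame c m ι β y e₀, trivial⟩) (fun y => ⟨chartFrame c m ι β y e₀, trivial⟩)
      (β.open_source.preimage hι.mdifferentiable.continuous) h1 h1
  have he₀ : e₀ ≠ 0 := fun h => by
    have := d.norm_e₀
    simp [h] at this
  have hqpos : ∀ y, ι y ∈ β.source → 0 < q y := by
    intro y hy
    refine d.normalForm_pos fun h0 => he₀ ?_
    rw [← normalCoord_chartFrame hβc hy e₀, h0, normalCoord_zero hβc hy]
  -- For `w` the frame image of `e ∈ E`, one has `‖K e‖² = ‖K e₀‖² ‖e‖²` and `⟨w, w⟩ = q ‖e‖²`,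
  -- whence the factor `‖K e₀‖² / q`.
  refine ⟨fun v => (K (T.Ψ v)).toLinearMap ∘ₗ Q v.1, fun v => ‖K (T.Ψ v) e₀‖ ^ 2 / q v.1, ?_, ?_⟩
  · rw [hsrc]
    exact inter_subset_right.trans hUT
  · intro v hv hvs
    rw [hsrc] at hvs
    obtain ⟨hunit, hconf, hy, hβv⟩ := hKU v hv hvs.2
    have hbij := (ContinuousLinearMap.isUnit_iff_bijective).1 hunit
    have hKv : ContMDiffAt ((𝓡 m).prod 𝓘(ℝ, Euc c)) 𝓘(ℝ, Euc c →L[ℝ] Euc c) ∞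
        (fun v => K (T.Ψ v)) v :=
      (hK.contMDiffAt (hU.mem_nhds hvs.2)).comp v (T.contMDiffAt hv)
    have hKapp : ∀ e : TotalSpace (Euc c) (NormalFiber c m ι) → Euc c,
        ContMDiffAt ((𝓡 m).prod 𝓘(ℝ, Euc c)) 𝓘(ℝ, Euc c) ∞ e v →
        ContMDiffAt ((𝓡 m).prod 𝓘(ℝ, Euc c)) 𝓘(ℝ, Euc c) ∞ (fun v => K (T.Ψ v) (e v)) v := by
      intro e he
      exact hKv.clm_apply he
    refine ⟨?_, ?_, ?_, ?_, ?_, ?_⟩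
    · have : Function.Bijective (Q v.1) := by
        have h1 : (Q v.1 : NormalFiber c m ι v.1 → Euc c) = normalCoordEquiv hβc hy :=
          funext fun w => hQ v.1 hy w
        rw [h1]
        exact (normalCoordEquiv hβc hy).bijective
      exact hbij.comp this
    · change (β (T.Ψ v)).1 = K (T.Ψ v) (Q v.1 v.2)
      rw [hβv, hQ v.1 hy]
    · refine div_pos (pow_pos (norm_pos_iff.2 fun h0 => he₀ ?_) 2) (hqpos v.1 hy)
      exact hbij.1 (h0.trans (map_zero _).symm)
    · rintro ⟨w, hw⟩
      have hw' := hw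
      rw [hS v.1 hy] at hw'
      obtain ⟨e, he, rfl⟩ := hw'
      change K (T.Ψ v) (Q v.1 (chartFrame c m ι β v.1 e)) ∈ E ∧
        ‖K (T.Ψ v) (Q v.1 (chartFrame c m ι β v.1 e))‖ ^ 2 = ‖K (T.Ψ v) e₀‖ ^ 2 / q v.1 *
          d.normalForm v.1 (chartFrame c m ι β v.1 e) (chartFrame c m ι β v.1 e)
      rw [hQ v.1 hy, normalCoord_chartFrame hβc hy, d.normalForm_chartFrame hβ hy he]
      refine ⟨(hconf e he).1, ?_⟩
      rw [(hconf e he).2]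
      change _ = ‖K (T.Ψ v) e₀‖ ^ 2 / q v.1 * (q v.1 * ‖e‖ ^ 2)
      have := (hqpos v.1 hy).ne'
      field_simp
    · have h1 : ContMDiffAt ((𝓡 m).prod 𝓘(ℝ, Euc c)) 𝓘(ℝ, ℝ) ∞
          (fun v : TotalSpace (Euc c) (NormalFiber c m ι) => q v.1) v :=
        (hq.contMDiffAt ((β.open_source.preimage hι.mdifferentiable.continuous).mem_nhds hy)).comp v
          (contMDiff_proj (NormalFiber c m ι) v)
      have h2 : ContMDiffAt ((𝓡 m).prod 𝓘(ℝ, Euc c)) 𝓘(ℝ, ℝ) ∞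
          (fun v => ‖K (T.Ψ v) e₀‖ ^ 2) v :=
        ((contDiff_norm_sq ℝ).contMDiff (n := ∞) _).comp v (hKapp _ contMDiffAt_const)
      exact h2.div₀ h1 (hqpos v.1 hy).ne'
    · intro δ hδ hyδ r
      have h1 : ContMDiffAt ((𝓡 m).prod 𝓘(ℝ, Euc c)) ((𝓡 m).prod 𝓘(ℝ, Euc c)) ∞
          (fun u : TotalSpace (Euc c) (NormalFiber c m ι) =>
            TotalSpace.mk' (Euc c) u.1 (chartFrame c m ι δ u.1 r)) v :=
        (contMDiffAt_chartFrame hδ r hyδ).comp v (contMDiff_proj (NormalFiber c m ι) v)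
      have h2 := contMDiffWithinAt_univ.1 ((contMDiffWithinAt_normal_iff hβc
        (f := fun u : TotalSpace (Euc c) (NormalFiber c m ι) =>
            TotalSpace.mk' (Euc c) u.1 (chartFrame c m ι δ u.1 r)) hy).1
          (contMDiffWithinAt_univ.2 h1)).2
      refine (hKapp _ h2).congr_of_eventuallyEq ?_
      have hcont : Continuous fun u : TotalSpace (Euc c) (NormalFiber c m ι) => ι u.1 :=
        hι.mdifferentiable.continuous.comp
          (FiberBundle.continuous_proj (Euc c) (NormalFiber c m ι))
      filter_upwards [(β.open_source.preimage hcont).mem_nhds hy] with u hu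
      exact congrArg (K (T.Ψ u)) (hQ u.1 hu _)

end Restrict

/-! ### Restrictions of charts -/

lemma IsChartFor.restr (hφ : IsChartFor c m ι φ) (U : Set X) : IsChartFor c m ι (φ.restr U) where
  contMDiffOn := hφ.contMDiffOn.mono inter_subset_left
  contMDiffOn_symm := hφ.contMDiffOn_symm.mono inter_subset_left
  mem_iff x hx := hφ.mem_iff x hx.1

lemma AugCompatible.restr {c₁ : ℕ} (h : AugCompatible c₁ φ φ') (U U' : Set X) :
    AugCompatible c₁ (φ.restr U) (φ'.restr U') := by
  obtain ⟨k, f, hk, hf, h⟩ := h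
  have hsub : ((φ'.restr U').symm.trans (φ.restr U)).source ⊆ (φ'.symm.trans φ).source :=
    fun p hp => ⟨hp.1.1, hp.2.1⟩
  exact ⟨k, f, hk.mono hsub, hf.mono hsub, fun p hp => h p (hsub hp)⟩

variable {𝒜 : Set (OpenPartialHomeomorph X (Euc c × Euc m))}

lemma IsAugmentedAtlas.augEquivalent_restrictCharts {c₁ : ℕ} (h𝒜 : IsAugmentedAtlas ι c₁ 𝒜)
    {U : OpenPartialHomeomorph X (Euc c × Euc m) → Set X}
    (hU : ∀ φ ∈ 𝒜, IsOpen (U φ) ∧ range ι ∩ φ.source ⊆ U φ) :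
    AugEquivalent ι c₁ 𝒜 (restrictCharts 𝒜 U) := by
  have hrestr : ∀ φ ∈ 𝒜 ∪ restrictCharts 𝒜 U, ∃ β ∈ 𝒜, ∃ V, φ = β.restr V := by
    rintro φ (hφ | ⟨β, hβ, rfl⟩)
    · exact ⟨φ, hφ, univ, φ.restr_univ.symm⟩
    · exact ⟨β, hβ, _, rfl⟩
  have hchart : ∀ φ ∈ 𝒜 ∪ restrictCharts 𝒜 U, IsChartFor c m ι φ := by
    intro φ hφ
    obtain ⟨β, hβ, V, rfl⟩ := hrestr φ hφ
    exact (h𝒜.isChartFor β hβ).restr V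
  have hcompat : ∀ φ ∈ 𝒜 ∪ restrictCharts 𝒜 U, ∀ φ' ∈ 𝒜 ∪ restrictCharts 𝒜 U,
      AugCompatible c₁ φ φ' := by
    intro φ hφ φ' hφ'
    obtain ⟨β, hβ, V, rfl⟩ := hrestr φ hφ
    obtain ⟨β', hβ', V', rfl⟩ := hrestr φ' hφ'
    exact (h𝒜.compatible β hβ β' hβ').restr V V'
  refine ⟨h𝒜, ⟨fun φ hφ => hchart φ (Or.inr hφ), ?_,
    fun φ hφ φ' hφ' => hcompat φ (Or.inr hφ) φ' (Or.inr hφ')⟩, ⟨hchart, ?_, hcompat⟩⟩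
  · rintro x hx
    obtain ⟨φ, hφ, hxφ⟩ := mem_iUnion₂.1 (h𝒜.covers hx)
    refine mem_iUnion₂.2 ⟨φ.restr (U φ), ⟨φ, hφ, rfl⟩, ?_⟩
    rw [φ.restr_source, (hU φ hφ).1.interior_eq]
    exact ⟨hxφ, (hU φ hφ).2 ⟨hx, hxφ⟩⟩
  · exact h𝒜.covers.trans (biUnion_mono subset_union_left fun _ _ => Subset.rfl)

lemma augEquivalent_of_compatible {c₁ : ℕ} {ℬ : Set (OpenPartialHomeomorph X (Euc c × Euc m))}
    (h𝒜 : IsAugmentedAtlas ι c₁ 𝒜) (hchart : ∀ φ ∈ ℬ, IsChartFor c m ι φ)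
    (hcov : range ι ⊆ ⋃ φ ∈ ℬ, φ.source)
    (hcompat : ∀ φ ∈ 𝒜 ∪ ℬ, ∀ φ' ∈ 𝒜 ∪ ℬ, AugCompatible c₁ φ φ') : AugEquivalent ι c₁ 𝒜 ℬ := by
  refine ⟨h𝒜, ⟨hchart, hcov, fun φ hφ φ' hφ' => hcompat φ (Or.inr hφ) φ' (Or.inr hφ')⟩,
    ⟨?_, h𝒜.covers.trans (biUnion_mono subset_union_left fun _ _ => Subset.rfl), hcompat⟩⟩
  rintro φ (hφ | hφ)
  exacts [h𝒜.isChartFor φ hφ, hchart φ hφ]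

lemma finrank_eq_of_map_frame {E : Submodule ℝ (Euc c)} {y : Y} (hφ : IsChartFor c m ι φ)
    (hy : ι y ∈ φ.source) (hS : S y = E.map (chartFrame c m ι φ y).toLinearMap) :
    Module.finrank ℝ (S y) = Module.finrank ℝ E := by
  rw [hS]
  exact (Submodule.equivMapOfInjective _ (normalCoordEquiv hφ hy).symm.injective E).finrank_eq.symm

/-- The main construction chooses inverses and needs a point of `Y`. For empty `Y` one takes `W` and
all `U φ` empty; every chart involved then has empty domain. -/
theorem exists_augEquivalent_of_isEmpty [IsEmpty Y] {c₁ : ℕ} (h𝒜 : IsAugmentedAtlas ι c₁ 𝒜) :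
    ∃ (g : SubbundleInner ι S) (T : TubularNbhd c m ι)
      (U : OpenPartialHomeomorph X (Euc c × Euc m) → Set X),
      (∀ φ ∈ 𝒜, IsOpen (U φ) ∧ range ι ∩ φ.source ⊆ U φ) ∧
      AugEquivalent ι c₁ 𝒜 (restrictCharts 𝒜 U) ∧
      ∀ ℬ, IsCutOutAtlas c₁ T g ℬ → AugEquivalent ι c₁ (restrictCharts 𝒜 U) ℬ := by
  have hU : ∀ φ ∈ 𝒜, IsOpen (∅ : Set X) ∧ range ι ∩ φ.source ⊆ (∅ : Set X) := fun φ _ =>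
    ⟨isOpen_empty, fun x hx => hx.1.elim fun y => isEmptyElim y⟩
  let g : SubbundleInner ι S :=
    { inner := isEmptyElim
      symm := isEmptyElim
      pos := isEmptyElim
      smooth := fun _ _ _ _ _ _ y => isEmptyElim y }
  let T : TubularNbhd c m ι :=
    { W := ∅
      Ψ := fun v => isEmptyElim v.1
      isOpen_W := isOpen_empty
      zero_mem := isEmptyElim
      injOn := injOn_empty _
      isLocalDiffeomorphOn := fun v => v.2.elim
      map_zero := isEmptyElim
      normalProj_deriv := isEmptyElim }
  have h1 := h𝒜.augEquivalent_restrictCharts (U := fun _ => ∅) hU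
  refine ⟨g, T, fun _ => ∅, hU, h1, fun ℬ hℬ => ?_⟩
  have hempty : ∀ φ ∈ restrictCharts 𝒜 (fun _ => ∅) ∪ ℬ, φ.source = ∅ := by
    rintro φ (⟨β, -, rfl⟩ | hφ)
    · simp
    · obtain ⟨Φ, V, -, -, hsrc, -⟩ := hℬ.isCutOutChart φ hφ
      rw [hsrc, empty_inter, image_empty]
  refine augEquivalent_of_compatible h1.right (fun φ hφ => ?_) hℬ.covers fun φ hφ φ' hφ' => ?_
  · have h2 := hempty φ (Or.inr hφ)
    have h3 : φ.target = ∅ := by rw [← φ.image_source_eq_target, h2, image_empty]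
    exact ⟨by rw [h2]; exact fun x hx => hx.elim, by rw [h3]; exact fun x hx => hx.elim,
      by rw [h2]; exact fun x hx => hx.elim⟩
  · have h2 : (φ'.symm.trans φ).source = ∅ := by
      rw [eq_empty_iff_forall_notMem]
      intro p hp
      have := hp.2
      rw [hempty φ hφ] at this
      exact this
    refine ⟨0, 0, ?_, ?_, ?_⟩ <;> rw [h2] <;> exact fun p hp => hp.elim

/-- Restricted and cut-out charts are adapted to the same `Ψ` and inner product, so one
compatibility statement covers all pairs in the union. -/
theorem exists_augEquivalent [Nonempty Y] [T2Space X] [SecondCountableTopology X] {c₁ : ℕ}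
    (hc : c₁ < c) (h𝒜 : IsSubbundleAugmentedAtlas ι c₁ S 𝒜) :
    ∃ (g : SubbundleInner ι S) (T : TubularNbhd c m ι)
      (U : OpenPartialHomeomorph X (Euc c × Euc m) → Set X),
      (∀ φ ∈ 𝒜, IsOpen (U φ) ∧ range ι ∩ φ.source ⊆ U φ) ∧
      AugEquivalent ι c₁ 𝒜 (restrictCharts 𝒜 U) ∧
      ∀ ℬ, IsCutOutAtlas c₁ T g ℬ → AugEquivalent ι c₁ (restrictCharts 𝒜 U) ℬ := by
  obtain ⟨e₀, ⟨d⟩⟩ := h𝒜.toIsAugmentedAtlas.exists_augData hc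
  obtain ⟨T, hT⟩ := exists_tubularNbhd d h𝒜.covers
  choose! U K hU using hT
  have hU' : ∀ φ ∈ 𝒜, IsOpen (U φ) ∧ range ι ∩ φ.source ⊆ U φ := fun φ hφ =>
    ⟨(hU φ hφ).1, (hU φ hφ).2.1⟩
  have h1 := h𝒜.toIsAugmentedAtlas.augEquivalent_restrictCharts hU'
  have hS : ∀ y, Module.finrank ℝ (S y) = Module.finrank ℝ (coordSubspace c c₁) := by
    intro y
    obtain ⟨φ, hφ, hy⟩ := mem_iUnion₂.1 (h𝒜.covers ⟨y, rfl⟩)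
    exact finrank_eq_of_map_frame (h𝒜.isChartFor φ hφ) hy (h𝒜.map_frame φ hφ y hy)
  refine ⟨d.subbundleInner S, T, U, hU', h1, fun ℬ hℬ => ?_⟩
  have hadapted : ∀ φ ∈ restrictCharts 𝒜 U ∪ ℬ,
      IsAdapted (coordSubspace c c₁) T (d.subbundleInner S) φ := by
    rintro φ (⟨β, hβ, rfl⟩ | hφ)
    · obtain ⟨h2, -, -, h3, h4, h5⟩ := hU β hβ
      exact d.isAdapted_restr hβ (fun y hy => h𝒜.map_frame β hβ y hy) h2 h3 h4 h5
    · exact (hℬ.isCutOutChart φ hφ).isAdapted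
  have hchart : ∀ φ ∈ ℬ, IsChartFor c m ι φ := fun φ hφ => (hℬ.isCutOutChart φ hφ).isChartFor
  refine augEquivalent_of_compatible h1.right hchart hℬ.covers fun φ hφ φ' hφ' => ?_
  refine IsAdapted.augCompatible hS ?_ (hadapted φ hφ) (hadapted φ' hφ')
  rcases hφ' with hφ' | hφ'
  exacts [h1.right.isChartFor φ' hφ', hchart φ' hφ']

end Adapted

end AugAtlas

end

theorem mainTheorem3 {c m c₁ : ℕ} (hc₁ : 1 ≤ c₁) (hc : c₁ < c) {X Y : Type*}
    [TopologicalSpace X] [T2Space X] [SecondCountableTopology X]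
    [ChartedSpace (Euc (c + m)) X] [IsManifold (𝓡 (c + m)) ∞ X]
    [TopologicalSpace Y] [ChartedSpace (Euc m) Y] [IsManifold (𝓡 m) ∞ Y]
    (ι : Y → X) [IsClosedSubmanifold c m ι]
    (S : ∀ y, Submodule ℝ (NormalFiber c m ι y)) (hS : IsSubbundle ι c₁ S)
    (𝒜 : Set (OpenPartialHomeomorph X (Euc c × Euc m)))
    (h𝒜 : IsSubbundleAugmentedAtlas ι c₁ S 𝒜) :
    ∃ (g : SubbundleInner ι S) (T : TubularNbhd c m ι)
      (U : OpenPartialHomeomorph X (Euc c × Euc m) → Set X),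
      (∀ φ ∈ 𝒜, IsOpen (U φ) ∧ range ι ∩ φ.source ⊆ U φ) ∧
      AugEquivalent ι c₁ 𝒜 (restrictCharts 𝒜 U) ∧
      ∀ ℬ, IsCutOutAtlas c₁ T g ℬ → AugEquivalent ι c₁ (restrictCharts 𝒜 U) ℬ := by
  rcases isEmpty_or_nonempty Y with hY | hY
  · exact exists_augEquivalent_of_isEmpty h𝒜.toIsAugmentedAtlas
  · exact exists_augEquivalent hc h𝒜
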